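/- **Setting.** A tabular episodic Markov game has $m\ge 1$ players, horizon $H\ge1$, a finite state set $\mathcal S$ with $S$ elements, finite action sets $\mathcal A_j$ with $A_j\ge 1$ elements, a fixed initial state $s_1$, transition kernels $\mathbb P_h(\cdot\mid s,\mathbf a)$ and deterministic rewards $r_{j,h}(s,\mathbf a)\in[0,1]$, where $\mathbf a=(a_1,\dots,a_m)$ is the joint action. Write $A=\max_j A_j$. A joint (correlated) policy $\pi=\pi_1\odot\dots\odot\pi_m$ consists of maps $\pi_{j,h}(\omega,\tau_h)\in\mathcal A_j$ of the history $\tau_h=(s_1,\mathbf a_1,\dots,s_h)$ and of one random sample $\omega$ that is drawn at the start of the episode and shared by all players and steps; $V^{\pi}_{j,1}(s_1)$ is the expected total reward of player $j$. A strategy modification $\phi_j$ of player $j$ is a family of maps $\phi_{j,h}(\tau_h,\cdot):\mathcal A_j\to\mathcal A_j$, and $V_{j,1}^{\phi_j\diamond\pi}(s_1)$ is the value when player $j$ plays $\phi_{j,h}(\tau_h,\pi_{j,h}(\omega,\tau_h))$ and the others play $\pi_{-j}$. The policy $\pi$ is an $\epsilon$-approximate correlated equilibrium (CE) if $\max_j\max_{\phi_j}[V_{j,1}^{\phi_j\diamond\pi}(s_1)-V_{j,1}^{\pi}(s_1)]\le\epsilon$.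 Let $\alpha_t=\frac{H+1}{H+t}$ and $\alpha_t^i=\alpha_i\prod_{l=i+1}^t(1-\alpha_l)$. **Bandit subroutine.** A bandit algorithm with action set $\mathcal B$, $|\mathcal B|=B$, starts from the uniform distribution $\theta_1$ and computes from the past actions and feedbacks the distribution $\theta_i$ of its next action. In round $i$ an adaptive adversary chooses $\ell_i\in[0,1]^{\mathcal B}$, the action $b_i\sim\theta_i$ is drawn, and a feedback $\tilde\ell_i\in[0,1]$ with conditional mean $\ell_i(b_i)$ is observed. A subroutine (one algorithm for every $B\ge 1$) meets the *weighted swap-regret assumption* with $\xi_{\rm sw}$, $\Xi_{\rm sw}$ if, against every adversary, for all $t\ge 1$ and $\delta\in(0,1)$, with probability at least $1-\delta$, $$\max_{\psi:\mathcal B\to\mathcal B}\ \sum_{i=1}^t\alpha_t^i\,[\langle\theta_i,\ell_i\rangle-\langle\psi\diamond\theta_i,\ell_i\rangle]\le\xi_{\rm sw}(B,t,\log(1/\delta)),$$ where $\psi\diamond\theta$ is the image of $\theta$ under $\psi$; moreover $\xi_{\rm sw}$ is non-decreasing in $B$, $\sum_{t'=1}^t\xi_{\rm sw}(B,t',\log(1/\delta))\le\Xi_{\rm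 sw}(B,t,\log(1/\delta))$ for all integers $t\ge0$, and $\Xi_{\rm sw}(B,\cdot,\log(1/\delta))$ is concave on $[0,\infty)$. **V-learning.** Every player $j$ runs the following with bonuses $\beta_{j,t}$. For all $(s,h)$ initialize $V_{h}(s)=H+1-h$, $V_{H+1}=0$, $N_h(s)=0$, and one bandit algorithm per $(s,h)$ with current strategy $\pi_h(\cdot\mid s)$. In episodes $k=1,\dots,K$ (with $K\ge 1$), starting from $s_1$, in steps $h=1,\dots,H$: draw $a_h\sim\pi_h(\cdot\mid s_h)$ (independently across players), observe the reward $r_h$ and the next state $s_{h+1}$; increase $t=N_h(s_h)$ by one; set $\tilde V_h(s_h)\leftarrow(1-\alpha_t)\tilde V_h(s_h)+\alpha_t(r_h+V_{h+1}(s_{h+1})+\beta_{j,t})$ and $V_h(s_h)\leftarrow\min\{H+1-h,\tilde V_h(s_h)\}$; give action $a_h$ and feedback $(H-r_h-V_{h+1}(s_{h+1}))/H$ to the bandit of $(s_h,h)$. **Output policy** $\hat\pi=\hat\pi_1\odot\dots\odot\hat\pi_m$. Draw $k$ uniformly from $\{1,\dots,K\}$. In step $h=1,\dots,H$, observe $s_h$,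 let $t$ be the number of episodes before $k$ in which $s_h$ was visited at step $h$, draw $i\in\{1,\dots,t\}$ with probability $\alpha_t^i$ and replace $k$ by the episode of the $i$-th of these visits (if $t=0$, keep $k$); then each player $j$ draws its action from its strategy $\pi_{j,h}^k(\cdot\mid s_h)$ at the beginning of episode $k$. The draws of $k$ and $i$ are common to all players; given $k$, the actions are drawn independently. **Theorem.** For $\delta\in(0,1)$ and $K\ge 1$ let $\iota=\log(mHSAK/\delta)$. (1) There is an absolute constant $c_0>0$ such that for every $c_1\ge c_0$ there is a constant $C>0$, depending only on $c_1$, with the following property. For every Markov game, every $\delta\in(0,1)$, every $K\ge1$, every bandit subroutine that meets the weighted swap-regret assumption with $\xi_{\rm sw},\Xi_{\rm sw}$, and all bonuses such that for all $j$ and all $t\in\{1,\dots,K\}$ $$c_0\big(H\xi_{\rm sw}(A_j,t,\iota)+\sqrt{H^3\iota/t}\big)\le\sum_{i=1}^t\alpha_t^i\beta_{j,i}\le c_1\big(H\xi_{\rm sw}(A_j,t,\iota)+\sqrt{H^3\iota/t}\big),$$ with probability at least $1-\delta$ over the $K$ episodes of training, $$\max_{j}\max_{\phi_j}\big[V_{j,1}^{\phi_j\diamond\hat\pi}(s_1)-V_{j,1}^{\hat\pi}(s_1)\big]\le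 C\Big(\frac{H^2S}{K}\,\Xi_{\rm sw}(A,K/S,\iota)+\sqrt{\frac{SH^5\iota}{K}}\Big).$$ (2) Let FTRL_swap be the bandit algorithm that starts from uniform $\theta_1$ and, after action $b_t$ and feedback $\tilde\ell_t$, sets $\hat\ell_t(b'\mid b)=\theta_t(b)\,\tilde\ell_t\,\mathbb 1\{b_t=b'\}/(\theta_t(b')+\gamma_t)$ and $\tilde\theta_{t+1}(\cdot\mid b)\propto\exp\big[-(\eta_t/w_t)\sum_{i=1}^tw_i\hat\ell_i(\cdot\mid b)\big]$, and takes $\theta_{t+1}$ with $\theta_{t+1}(\cdot)=\sum_b\theta_{t+1}(b)\tilde\theta_{t+1}(\cdot\mid b)$, with $w_t=\alpha_t\big(\prod_{i=2}^t(1-\alpha_i)\big)^{-1}$ and $\eta_t=\gamma_t=\sqrt{H\iota/t}$. There are absolute constants $c,C>0$ such that for every Markov game, every $\delta\in(0,1)$ and every $K\ge1$, V-learning with FTRL_swap and $\beta_{j,t}=c\,A_j\sqrt{H^3\iota/t}$ satisfies, with probability at least $1-\delta$, $$\max_{j}\max_{\phi_j}\big[V_{j,1}^{\phi_j\diamond\hat\pi}(s_1)-V_{j,1}^{\hat\pi}(s_1)\big]\le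 C\,A\sqrt{H^5S\iota/K}.$$ -/

import Mathlib

open MeasureTheory

noncomputable section

namespace VLearning

/-! ## Learning rates

Steps of an episode, episodes, and rounds of a bandit are numbered from `0` when they serve as
indices; the visit counter `t` and the weights `α_t^i`, `1 ≤ i ≤ t`, are numbered from `1`. -/

/-- The learning rate `α_t = (H + 1) / (H + t)`. -/
def lr (H t : ℕ) : ℝ := ((H : ℝ) + 1) / ((H : ℝ) + t)

/-- The weights `α_t^i = α_i ∏_{j = i+1}^t (1 - α_j)`. -/
def lrW (H t i : ℕ) : ℝ := lr H i * ∏ j ∈ Finset.Icc (i + 1) t, (1 - lr H j)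

theorem lr_nonneg (H t : ℕ) : 0 ≤ lr H t := by
  unfold lr; positivity

theorem lr_one (H : ℕ) : lr H 1 = 1 := by
  unfold lr
  have : (H : ℝ) + 1 ≠ 0 := by positivity
  simp [div_self this]

theorem lr_le_one (H : ℕ) {t : ℕ} (ht : 1 ≤ t) : lr H t ≤ 1 := by
  unfold lr
  have h1 : (1 : ℝ) ≤ t := by exact_mod_cast ht
  rw [div_le_one (by positivity)]
  linarith

theorem lrW_nonneg (H t i : ℕ) : 0 ≤ lrW H t i := by
  refine mul_nonneg (lr_nonneg H i) (Finset.prod_nonneg fun j hj => ?_)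
  have := lr_le_one H (t := j) (by have := (Finset.mem_Icc.mp hj).1; omega)
  linarith

theorem sum_lrW (H t : ℕ) : ∑ i ∈ Finset.range (t + 1), lrW H (t + 1) (i + 1) = 1 := by
  induction t with
  | zero => simp [lrW, lr_one]
  | succ t ih =>
    rw [Finset.sum_range_succ]
    have h1 : ∀ i ∈ Finset.range (t + 1),
        lrW H (t + 1 + 1) (i + 1) = lrW H (t + 1) (i + 1) * (1 - lr H (t + 1 + 1)) := by
      intro i hi
      have hi' := Finset.mem_range.mp hi
      unfold lrW
      rw [Finset.prod_Icc_succ_top (by omega), mul_assoc]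
    rw [Finset.sum_congr rfl h1, ← Finset.sum_mul, ih]
    simp [lrW]

/-! ## Elementary distributions -/

/-- Product of finitely many distributions on finite sets: independent sampling of all
coordinates. -/
def pmfPi {ι : Type} [Fintype ι] [DecidableEq ι] {α : ι → Type} [∀ i, Fintype (α i)]
    (p : ∀ i, PMF (α i)) : PMF (∀ i, α i) :=
  PMF.ofFintype (fun a => ∏ i, p i (a i)) (by
    rw [← Fintype.prod_sum (fun i (x : α i) => p i x)]
    refine Finset.prod_eq_one fun i _ => ?_
    rw [← tsum_fintype (L := SummationFilter.unconditional _)]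
    exact (p i).tsum_coe)

/-- The distribution on `{1, …, t}` (as `Fin t`) that gives `i` the probability `α_t^i`. -/
def weightLaw (H t : ℕ) (ht : 0 < t) : PMF (Fin t) :=
  PMF.ofFintype (fun i => ENNReal.ofReal (lrW H t (i + 1))) (by
    rw [← ENNReal.ofReal_sum_of_nonneg fun i _ => lrW_nonneg H t _,
      Fin.sum_univ_eq_sum_range (fun i => lrW H t (i + 1)) t]
    obtain ⟨n, rfl⟩ : ∃ n, t = n + 1 := ⟨t - 1, by omega⟩
    rw [sum_lrW, ENNReal.ofReal_one])

/-- The distribution proportional to `exp (x b)`. -/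
def softmax {B : ℕ} [NeZero B] (x : Fin B → ℝ) : PMF (Fin B) :=
  PMF.normalize (fun b => ENNReal.ofReal (Real.exp (x b)))
    (by
      rw [tsum_fintype]
      intro h
      have := Finset.sum_eq_zero_iff.mp h 0 (Finset.mem_univ _)
      exact absurd (ENNReal.ofReal_eq_zero.mp this) (not_le.mpr (Real.exp_pos _)))
    (by
      rw [tsum_fintype]
      exact ENNReal.sum_ne_top.mpr fun b _ => ENNReal.ofReal_ne_top)

/-- Every Markov kernel on a non-empty finite set has a stationary distribution. -/
theorem exists_stationary {B : ℕ} [NeZero B] (Q : Fin B → PMF (Fin B)) :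
    ∃ θ : PMF (Fin B), θ.bind Q = θ := by
  classical
  have hQ1 : ∀ b, ∑ b', (Q b b').toReal = 1 := fun b => by
    rw [← ENNReal.toReal_sum fun b' _ => (Q b).apply_ne_top b', ← tsum_fintype
      (L := SummationFilter.unconditional _), (Q b).tsum_coe, ENNReal.toReal_one]
  let W : Matrix (Fin B) (Fin B) ℝ := Matrix.of fun b b' => (Q b b').toReal
  have h1 : ∃ v : Fin B → ℝ, v ≠ 0 ∧ (W - 1).mulVec v = 0 :=
    ⟨fun _ => 1, fun h => one_ne_zero (congrFun h 0), by
      rw [Matrix.sub_mulVec, Matrix.one_mulVec]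
      funext b
      simp [W, Matrix.mulVec, dotProduct, hQ1]⟩
  obtain ⟨v, hv0, hv⟩ := Matrix.exists_vecMul_eq_zero_iff.mpr
    (Matrix.exists_mulVec_eq_zero_iff.mp h1)
  rw [Matrix.vecMul_sub, Matrix.vecMul_one] at hv
  have hv' : ∀ b', v b' = ∑ b, v b * (Q b b').toReal := fun b' => by
    have := congrFun hv b'
    simp only [W, Pi.sub_apply, Pi.zero_apply, Matrix.vecMul, dotProduct,
      Matrix.of_apply] at this
    linarith
  have hle : ∀ b', |v b'| ≤ ∑ b, |v b| * (Q b b').toReal := fun b' => by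
    conv_lhs => rw [hv' b']
    refine (Finset.abs_sum_le_sum_abs _ _).trans (le_of_eq ?_)
    exact Finset.sum_congr rfl fun b _ => by rw [abs_mul, abs_of_nonneg ENNReal.toReal_nonneg]
  have hsum : ∑ b', |v b'| = ∑ b', ∑ b, |v b| * (Q b b').toReal := by
    rw [Finset.sum_comm]
    simp [← Finset.mul_sum, hQ1]
  have heq : ∀ b', |v b'| = ∑ b, |v b| * (Q b b').toReal := fun b' =>
    (Finset.sum_eq_sum_iff_of_le fun i _ => hle i).mp hsum b' (Finset.mem_univ _)
  have hne : ∑' b, ENNReal.ofReal |v b| ≠ 0 := by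
    rw [tsum_fintype]
    intro h
    refine hv0 (funext fun b => ?_)
    have := Finset.sum_eq_zero_iff.mp h b (Finset.mem_univ _)
    simpa using this
  have hnt : ∑' b, ENNReal.ofReal |v b| ≠ ⊤ := by
    rw [tsum_fintype]
    exact ENNReal.sum_ne_top.mpr fun b _ => ENNReal.ofReal_ne_top
  refine ⟨PMF.normalize _ hne hnt, PMF.ext fun b' => ?_⟩
  rw [PMF.bind_apply, tsum_fintype]
  simp only [PMF.normalize_apply]
  conv_rhs => rw [heq b', ENNReal.ofReal_sum_of_nonneg fun b _ =>
    mul_nonneg (abs_nonneg _) ENNReal.toReal_nonneg, Finset.sum_mul]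
  refine Finset.sum_congr rfl fun b _ => ?_
  rw [ENNReal.ofReal_mul (abs_nonneg _), ENNReal.ofReal_toReal ((Q b).apply_ne_top b')]
  ring

/-- A distribution `θ` with `θ(·) = ∑_b θ(b) Q(· | b)`. -/
def stationary {B : ℕ} [NeZero B] (Q : Fin B → PMF (Fin B)) : PMF (Fin B) :=
  Classical.choose (exists_stationary Q)

/-! ## Adversarial bandits -/

/-- A bandit algorithm with action set `Fin B`: from the chronological list of the past pairs
(action taken, observed feedback) it computes the distribution of the next action.  The first
distribution is uniform. -/
structure BanditAlg (B : ℕ) [NeZero B] where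
  strategy : List (Fin B × ℝ) → PMF (Fin B)
  strategy_nil : strategy [] = PMF.uniformOfFintype (Fin B)

/-- `T` rounds of the interaction of a bandit algorithm with an adaptive adversary, on a
probability space `(Ω, μ)`.  The sigma-algebra `ℱ i` is the information available immediately
before the action of round `i` is drawn. -/
structure BanditRun {B : ℕ} [NeZero B] (alg : BanditAlg B) (T : ℕ) {Ω : Type}
    [mΩ : MeasurableSpace Ω] (μ : Measure Ω) where
  ℱ : Filtration ℕ mΩ
  /-- the loss vector `ℓ_i` chosen by the adversary -/
  loss : ℕ → Ω → Fin B → ℝ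
  /-- the action `b_i` of the learner -/
  act : ℕ → Ω → Fin B
  /-- the noisy feedback observed by the learner -/
  fb : ℕ → Ω → ℝ
  loss_mem : ∀ i ω b, loss i ω b ∈ Set.Icc (0 : ℝ) 1
  fb_mem : ∀ i ω, fb i ω ∈ Set.Icc (0 : ℝ) 1
  loss_meas : ∀ i < T, ∀ b, Measurable[ℱ i] fun ω => loss i ω b
  act_meas : ∀ i < T, Measurable[ℱ (i + 1)] (act i)
  fb_meas : ∀ i < T, Measurable[ℱ (i + 1)] (fb i)
  /-- given the past, `b_i` is distributed according to the strategy `θ_i` of the algorithm -/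
  act_law : ∀ i < T, ∀ b,
    μ[Set.indicator {ω | act i ω = b} (fun _ => (1 : ℝ)) | ℱ i] =ᵐ[μ] fun ω =>
      (alg.strategy ((List.range i).map fun n => (act n ω, fb n ω)) b).toReal
  /-- given the past and `b_i = b`, the feedback has mean `ℓ_i(b)`; written without dividing by
  the conditional probability `θ_i(b)` of `b_i = b` -/
  fb_mean : ∀ i < T, ∀ b,
    μ[Set.indicator {ω | act i ω = b} (fb i) | ℱ i] =ᵐ[μ] fun ω =>
      (alg.strategy ((List.range i).map fun n => (act n ω, fb n ω)) b).toReal * loss i ω b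

/-- The strategy `θ_i` played in round `i`. -/
def BanditRun.theta {B : ℕ} [NeZero B] {alg : BanditAlg B} {T : ℕ} {Ω : Type}
    [MeasurableSpace Ω] {μ : Measure Ω} (R : BanditRun alg T μ) (i : ℕ) (ω : Ω) : PMF (Fin B) :=
  alg.strategy ((List.range i).map fun n => (R.act n ω, R.fb n ω))

/-- The weighted regret `∑_{i=1}^T α_T^i (⟨θ_i, ℓ_i⟩ - ⟨ψ ⋄ θ_i, ℓ_i⟩)` with respect to the map
`ψ` of actions; `ψ ⋄ θ` is the image of the distribution `θ` under `ψ`. -/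
def BanditRun.swapRegret {B : ℕ} [NeZero B] {alg : BanditAlg B} {T : ℕ} {Ω : Type}
    [MeasurableSpace Ω] {μ : Measure Ω} (R : BanditRun alg T μ) (H : ℕ) (ψ : Fin B → Fin B)
    (ω : Ω) : ℝ :=
  ∑ i ∈ Finset.range T, lrW H T (i + 1) *
    (∑ b, (R.theta i ω b).toReal * R.loss i ω b
      - ∑ b, ((R.theta i ω).map ψ b).toReal * R.loss i ω b)

/-- The weighted swap regret requirement on a bandit subroutine (one algorithm for every number
`B ≥ 1` of actions), with regret bound `ξ B t (log (1/δ))` and cumulative bound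
`Ξ B t (log (1/δ))`.  The variable `t` of `Ξ` is real, since `Ξ` is evaluated at `K / S`. -/
structure MeetsSwapRegret (H : ℕ) (alg : ∀ (B : ℕ) [NeZero B], BanditAlg B)
    (ξ : ℕ → ℕ → ℝ → ℝ) (Ξ : ℕ → ℝ → ℝ → ℝ) : Prop where
  regret : ∀ (B : ℕ) [NeZero B] (t : ℕ) (δ : ℝ), 1 ≤ t → 0 < δ → δ < 1 →
    ∀ (Ω : Type) [MeasurableSpace Ω] (μ : Measure Ω) [IsProbabilityMeasure μ]
      (R : BanditRun (alg B) t μ),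
      ENNReal.ofReal (1 - δ) ≤
        μ {ω | ∀ ψ : Fin B → Fin B, R.swapRegret H ψ ω ≤ ξ B t (Real.log (1 / δ))}
  cumulative : ∀ (B t : ℕ) (δ : ℝ), 1 ≤ B → 0 < δ → δ < 1 →
    ∑ t' ∈ Finset.Icc 1 t, ξ B t' (Real.log (1 / δ)) ≤ Ξ B t (Real.log (1 / δ))
  mono : ∀ (B B' t : ℕ) (δ : ℝ), 1 ≤ B → B ≤ B' → 1 ≤ t → 0 < δ → δ < 1 →
    ξ B t (Real.log (1 / δ)) ≤ ξ B' t (Real.log (1 / δ))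
  concave : ∀ (B : ℕ) (δ : ℝ), 1 ≤ B → 0 < δ → δ < 1 →
    ConcaveOn ℝ (Set.Ici 0) fun t => Ξ B t (Real.log (1 / δ))

/-! ## Follow the regularized leader for swap regret -/

/-- Memory of the algorithm: the number `t` of completed rounds, the sums
`L b b' = ∑_{i ≤ t} w_i * lhat_i(b' | b)`, and the next strategy `θ_{t+1}`. -/
structure FTRLState (B : ℕ) where
  t : ℕ
  L : Fin B → Fin B → ℝ
  θ : PMF (Fin B)

/-- One round with action `x.1` and observed loss `x.2`:
`lhat_t(b' | b) = θ_t(b) * loss * 1{b_t = b'} / (θ_t(b') + γ_t)`, then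
`Q(· | b) ∝ exp (-(η_t / w_t) ∑_{i ≤ t} w_i lhat_i(· | b))`, and the next strategy is
stationary for `Q`. -/
def ftrlSwapStep {B : ℕ} [NeZero B] (w η γ : ℕ → ℝ) (σ : FTRLState B) (x : Fin B × ℝ) :
    FTRLState B :=
  let t := σ.t + 1
  let lhat : Fin B → Fin B → ℝ := fun b b' =>
    (σ.θ b).toReal * (if x.1 = b' then x.2 else 0) / ((σ.θ b').toReal + γ t)
  let L : Fin B → Fin B → ℝ := fun b b' => σ.L b b' + w t * lhat b b'
  { t := t
    L := L
    θ := stationary fun b => softmax fun b' => -(η t / w t) * L b b' }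

/-- The algorithm FTRL_swap with weights `w_t`, step sizes `η_t` and exploration parameters
`γ_t`, `t ≥ 1`. -/
def ftrlSwap (w η γ : ℕ → ℝ) (B : ℕ) [NeZero B] : BanditAlg B where
  strategy hist :=
    (hist.foldl (ftrlSwapStep w η γ)
      { t := 0, L := fun _ _ => 0, θ := PMF.uniformOfFintype (Fin B) }).θ
  strategy_nil := rfl

/-- The weights `w_t = α_t (∏_{i=2}^t (1 - α_i))⁻¹`. -/
def ftrlWeight (H t : ℕ) : ℝ := lr H t * (∏ i ∈ Finset.Icc 2 t, (1 - lr H i))⁻¹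

/-! ## Markov games, policies, values -/

/-- A tabular episodic Markov game with `m` players, horizon `H`, `S` states, `A j` actions of
player `j`, and a fixed starting state. -/
structure MarkovGame (m H S : ℕ) (A : Fin m → ℕ) where
  s₁ : Fin S
  P : Fin H → Fin S → (∀ j, Fin (A j)) → PMF (Fin S)
  r : Fin m → Fin H → Fin S → (∀ j, Fin (A j)) → ℝ
  r_mem : ∀ j h s a, r j h s a ∈ Set.Icc (0 : ℝ) 1

/-- The past `(s_1, a_1), …, (s_{h-1}, a_{h-1})` in an episode, in chronological order. -/
abbrev Hist {m : ℕ} (S : ℕ) (A : Fin m → ℕ) : Type := List (Fin S × (∀ j, Fin (A j)))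

/-- The expected reward that player `j` collects in the given (remaining) steps, when the joint
action in step `h`, past `τ` and state `s` is `d h τ s`. -/
def MarkovGame.valueFrom {m H S : ℕ} {A : Fin m → ℕ} (G : MarkovGame m H S A) (j : Fin m)
    (d : Fin H → Hist S A → Fin S → ∀ i, Fin (A i)) : List (Fin H) → Hist S A → Fin S → ℝ
  | [], _, _ => 0
  | h :: hs, τ, s =>
      G.r j h s (d h τ s)
        + ∑ s', (G.P h s (d h τ s) s').toReal * G.valueFrom j d hs (τ ++ [(s, d h τ s)]) s'

/-- A joint, potentially correlated, random policy: one random sample `ω`, drawn at the start of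
the episode and shared by all players and steps, and for every player and step a map from `ω`,
the past and the current state to an action.  In step `h` only pasts of length `h` matter. -/
structure JointPolicy {m : ℕ} (H S : ℕ) (A : Fin m → ℕ) where
  Ω : Type
  mΩ : MeasurableSpace Ω
  μ : Measure Ω
  prob : IsProbabilityMeasure μ
  act : ∀ j : Fin m, Fin H → Ω → Hist S A → Fin S → Fin (A j)
  act_meas : ∀ j h τ s, Measurable fun ω => act j h ω τ s

/-- The value `V_{j,1}^π(s_1)`: the expectation over `ω` and over the transitions. -/
def MarkovGame.value {m H S : ℕ} {A : Fin m → ℕ} (G : MarkovGame m H S A) (j : Fin m)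
    (π : JointPolicy H S A) : ℝ :=
  letI := π.mΩ
  ∫ ω, G.valueFrom j (fun h τ s i => π.act i h ω τ s) (List.finRange H) [] G.s₁ ∂π.μ

/-- A strategy modification of player `j`. -/
abbrev Modification {m : ℕ} (H S : ℕ) (A : Fin m → ℕ) (j : Fin m) : Type :=
  Fin H → Hist S A → Fin S → Fin (A j) → Fin (A j)

/-- The joint policy `(φ ⋄ π_j) ⊙ π_{-j}`. -/
def JointPolicy.modify {m H S : ℕ} {A : Fin m → ℕ} (π : JointPolicy H S A) (j : Fin m)
    (φ : Modification H S A j) : JointPolicy H S A where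
  Ω := π.Ω
  mΩ := π.mΩ
  μ := π.μ
  prob := π.prob
  act i h ω τ s :=
    Function.update (fun i => π.act i h ω τ s) j (φ h τ s (π.act j h ω τ s)) i
  act_meas := by
    intro i h τ s
    let _ := π.mΩ
    by_cases hij : i = j
    · subst hij
      simp only [Function.update_self]
      exact measurable_from_top.comp (π.act_meas i h τ s)
    · simp only [Function.update_of_ne hij]
      exact π.act_meas i h τ s

/-- `π` is an `ε`-approximate correlated equilibrium:
`max_j max_φ (V_{j,1}^{(φ ⋄ π_j) ⊙ π_{-j}}(s_1) - V_{j,1}^π(s_1)) ≤ ε`. -/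
def MarkovGame.IsApproxCE {m H S : ℕ} {A : Fin m → ℕ} (G : MarkovGame m H S A)
    (π : JointPolicy H S A) (ε : ℝ) : Prop :=
  ∀ (j : Fin m) (φ : Modification H S A j), G.value j (π.modify j φ) - G.value j π ≤ ε

/-! ## V-learning -/

/-- What a single agent with `B` actions maintains: counters `N_h(s)`, the values `Ṽ_h(s)` and
`V_h(s)` (with `V_{H+1} = 0`), and, for every `(h, s)`, the list of the pairs (action, loss) that
were fed to the bandit algorithm of `(h, s)`; this list determines `π_h(· | s)`. -/
structure Learner (H S B : ℕ) where
  N : Fin H → Fin S → ℕ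
  Vt : Fin H → Fin S → ℝ
  V : Fin (H + 1) → Fin S → ℝ
  log : Fin H → Fin S → List (Fin B × ℝ)

/-- At the start `V_h(s) = H + 1 - h` for `h = 1, …, H + 1` (here `h` starts from `0`). -/
def Learner.start (H S B : ℕ) : Learner H S B where
  N _ _ := 0
  Vt h _ := (H : ℝ) - (h : ℕ)
  V h _ := (H : ℝ) - (h : ℕ)
  log _ _ := []

/-- `f` with the entry at `(x, y)` replaced by `v`. -/
def setAt {α β γ : Type} [DecidableEq α] [DecidableEq β] (f : α → β → γ) (x : α) (y : β)
    (v : γ) : α → β → γ :=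
  Function.update f x (Function.update (f x) y v)

/-- The update after action `a` was taken in state `s` at step `h`, the reward `r` was received
and the next state `s'` was observed; `β t` is the bonus of the `t`-th visit. -/
def Learner.update {H S B : ℕ} (β : ℕ → ℝ) (σ : Learner H S B) (h : Fin H) (s : Fin S)
    (a : Fin B) (r : ℝ) (s' : Fin S) : Learner H S B :=
  let t := σ.N h s + 1
  let next := σ.V h.succ s'
  let vt := (1 - lr H t) * σ.Vt h s + lr H t * (r + next + β t)
  { N := setAt σ.N h s t
    Vt := setAt σ.Vt h s vt
    V := setAt σ.V h.castSucc s (min ((H : ℝ) - (h : ℕ)) vt)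
    log := setAt σ.log h s (σ.log h s ++ [(a, ((H : ℝ) - r - next) / H)]) }

/-- The record of one step of the training: in episode `ep` and step `step`, the joint action
`act` was taken in state `st`, and the next state was `nxt`. -/
structure Visit {m : ℕ} (H S K : ℕ) (A : Fin m → ℕ) where
  ep : Fin K
  step : Fin H
  st : Fin S
  act : ∀ j, Fin (A j)
  nxt : Fin S

/-- The memory of player `j` after the (chronological) sequence `T` of training steps. -/
def learner {m H S K : ℕ} {A : Fin m → ℕ} (G : MarkovGame m H S A) (β : Fin m → ℕ → ℝ)
    (T : List (Visit H S K A)) (j : Fin m) : Learner H S (A j) :=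
  T.foldl
    (fun σ v => σ.update (β j) v.step v.st (v.act j) (G.r j v.step v.st v.act) v.nxt)
    (Learner.start H S (A j))

/-- The current policy `π_{j,h}(· | s)` of player `j` after the training steps `T`. -/
def currentPolicy {m H S K : ℕ} {A : Fin m → ℕ} [∀ j, NeZero (A j)] (G : MarkovGame m H S A)
    (alg : ∀ (B : ℕ) [NeZero B], BanditAlg B) (β : Fin m → ℕ → ℝ) (T : List (Visit H S K A))
    (j : Fin m) (h : Fin H) (s : Fin S) : PMF (Fin (A j)) :=
  (alg (A j)).strategy ((learner G β T j).log h s)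

/-- One training step, in episode `k`, step `h`, state `s`: the players draw their actions
independently from their current policies, and the game moves to the next state. -/
def trainStep {m H S K : ℕ} {A : Fin m → ℕ} [∀ j, NeZero (A j)] (G : MarkovGame m H S A)
    (alg : ∀ (B : ℕ) [NeZero B], BanditAlg B) (β : Fin m → ℕ → ℝ) (k : Fin K)
    (Ts : List (Visit H S K A) × Fin S) (h : Fin H) : PMF (List (Visit H S K A) × Fin S) :=
  (pmfPi fun j => currentPolicy G alg β Ts.1 j h Ts.2).bind fun a =>
    (G.P h Ts.2 a).map fun s' =>
      (Ts.1 ++ [{ ep := k, step := h, st := Ts.2, act := a, nxt := s' }], s')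

/-- Episode `k` of the training, from the starting state through all `H` steps. -/
def trainEpisode {m H S K : ℕ} {A : Fin m → ℕ} [∀ j, NeZero (A j)] (G : MarkovGame m H S A)
    (alg : ∀ (B : ℕ) [NeZero B], BanditAlg B) (β : Fin m → ℕ → ℝ)
    (T : List (Visit H S K A)) (k : Fin K) : PMF (List (Visit H S K A)) :=
  ((List.finRange H).foldlM (trainStep G alg β k) (T, G.s₁)).map Prod.fst

/-- The law of the complete record of the training, when all players run V-learning for `K`
episodes. -/
def trainLaw {m H S : ℕ} {A : Fin m → ℕ} [∀ j, NeZero (A j)] (K : ℕ) (G : MarkovGame m H S A)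
    (alg : ∀ (B : ℕ) [NeZero B], BanditAlg B) (β : Fin m → ℕ → ℝ) :
    PMF (List (Visit H S K A)) :=
  (List.finRange K).foldlM (trainEpisode G alg β) []

/-! ## The output policy -/

/-- The part of the training record that precedes episode `k`. -/
def before {m H S K : ℕ} {A : Fin m → ℕ} (T : List (Visit H S K A)) (k : Fin K) :
    List (Visit H S K A) :=
  T.filter fun v => v.ep < k

/-- The policy `π_{j,h}^k(· | s)` at the beginning of episode `k`. -/
def policyAt {m H S K : ℕ} {A : Fin m → ℕ} [∀ j, NeZero (A j)] (G : MarkovGame m H S A)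
    (alg : ∀ (B : ℕ) [NeZero B], BanditAlg B) (β : Fin m → ℕ → ℝ) (T : List (Visit H S K A))
    (k : Fin K) (j : Fin m) (h : Fin H) (s : Fin S) : PMF (Fin (A j)) :=
  currentPolicy G alg β (before T k) j h s

/-- The episodes before `k` in which `s` was visited at step `h`, in chronological order: the
`i`-th entry is `k_h^i(s)`, and the length is `N_h^k(s)`. -/
def visitsBefore {m H S K : ℕ} {A : Fin m → ℕ} (T : List (Visit H S K A)) (k : Fin K)
    (h : Fin H) (s : Fin S) : List (Fin K) :=
  ((before T k).filter fun v => v.step = h ∧ v.st = s).map Visit.ep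

/-- The random replacement of the index `k` at step `h` in state `s`: with `t = N_h^k(s)`, the
new index is `k_h^i(s)` with probability `α_t^i`.  If `t = 0`, then `k` is kept. -/
def nextIndex {m H S K : ℕ} {A : Fin m → ℕ} (T : List (Visit H S K A)) (k : Fin K)
    (h : Fin H) (s : Fin S) : PMF (Fin K) :=
  if ht : 0 < (visitsBefore T k h s).length then
    (weightLaw H _ ht).map fun i => (visitsBefore T k h s).get i
  else PMF.pure k

/-- The law of the randomness used in step `h`, state `s`, with current index `k`: the new index
`k'`, common to all players, and then actions of the players drawn independently from
`π_{j,h}^{k'}(· | s)`. -/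
def outStep {m H S K : ℕ} {A : Fin m → ℕ} [∀ j, NeZero (A j)] (G : MarkovGame m H S A)
    (alg : ∀ (B : ℕ) [NeZero B], BanditAlg B) (β : Fin m → ℕ → ℝ) (T : List (Visit H S K A))
    (x : Fin H × Fin K × Fin S) : PMF (Fin K × (∀ j, Fin (A j))) :=
  (nextIndex T x.2.1 x.1 x.2.2).bind fun k' =>
    (pmfPi fun j => policyAt G alg β T k' j x.1 x.2.2).map fun a => (k', a)

/-- The random seed shared by all players: the starting index, and a draw for every
`(h, k, s)`. -/
abbrev Seed {m : ℕ} (H S K : ℕ) (A : Fin m → ℕ) : Type :=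
  Fin K × (Fin H × Fin K × Fin S → Fin K × (∀ j, Fin (A j)))

/-- The law of the seed: the starting index is uniform on the `K` episodes, and all draws are
independent. -/
def seedLaw {m H S K : ℕ} {A : Fin m → ℕ} [∀ j, NeZero (A j)] [NeZero K]
    (G : MarkovGame m H S A) (alg : ∀ (B : ℕ) [NeZero B], BanditAlg B) (β : Fin m → ℕ → ℝ)
    (T : List (Visit H S K A)) : PMF (Seed H S K A) :=
  (PMF.uniformOfFintype (Fin K)).bind fun k =>
    (pmfPi fun x => outStep G alg β T x).map fun d => (k, d)

/-- The value of the index `k` after the past `τ`. -/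
def indexAfter {m H S K : ℕ} {A : Fin m → ℕ} (ω : Seed H S K A) (τ : Hist S A) : Fin K :=
  ((List.finRange H).zip τ).foldl (fun k x => (ω.2 (x.1, k, x.2.1)).1) ω.1

/-- The correlated output policy `π̂ = π̂_1 ⊙ ⋯ ⊙ π̂_m` computed from the training record. -/
def outputPolicy {m H S K : ℕ} {A : Fin m → ℕ} [∀ j, NeZero (A j)] [NeZero K]
    (G : MarkovGame m H S A) (alg : ∀ (B : ℕ) [NeZero B], BanditAlg B) (β : Fin m → ℕ → ℝ)
    (T : List (Visit H S K A)) : JointPolicy H S A where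
  Ω := Seed H S K A
  mΩ := ⊤
  μ := @PMF.toMeasure _ ⊤ (seedLaw G alg β T)
  prob := @PMF.toMeasure.isProbabilityMeasure _ ⊤ (seedLaw G alg β T)
  act j h ω τ s := (ω.2 (h, indexAfter ω τ, s)).2 j
  act_meas := fun _ _ _ _ => measurable_from_top

/-- The probability, over the training, that the output policy is an `ε`-approximate correlated
equilibrium. -/
def ceProb {m H S : ℕ} {A : Fin m → ℕ} [∀ j, NeZero (A j)] (K : ℕ) [NeZero K]
    (G : MarkovGame m H S A) (alg : ∀ (B : ℕ) [NeZero B], BanditAlg B) (β : Fin m → ℕ → ℝ)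
    (ε : ℝ) : ENNReal :=
  (trainLaw K G alg β).toOuterMeasure {T | G.IsApproxCE (outputPolicy G alg β T) ε}

/-- The largest number `max_j A_j` of actions of a player. -/
def maxA {m : ℕ} (A : Fin m → ℕ) : ℕ := Finset.univ.sup A

/-- The logarithmic factor `ι = log (m H S A K / δ)`, with `A = max_j A_j`. -/
def iota {m : ℕ} (H S K : ℕ) (A : Fin m → ℕ) (δ : ℝ) : ℝ :=
  Real.log ((m : ℝ) * H * S * maxA A * K / δ)

end VLearning

end

open MeasureTheory

noncomputable section

namespace VLearning

open scoped ENNReal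

/-! The training is a random list of visits, and it is analysed separately along the visits of each
pair $(h,s)$. If every player has only one action, nothing can be gained. Otherwise, outside an
event of probability at most $\delta$, three one-sided bounds hold for all players, all $(h,s)$ and
all numbers $t$ of visits (`GoodRecord`): the weighted swap regret of the bandit is at most $\xi$;
the weighted average of the observed reward plus $V_{h+1}$ falls short of its conditional mean by at
most $\varepsilon_t = 10\sqrt{H^3\iota/t}$; and the weighted average of the reward plus the value
`certValue` of the output policy exceeds its conditional mean by at most $\varepsilon_t$. The last
two are Chernoff bounds (`trainLaw_deviation_le`). For the first, the visits of $(h,s)$ become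
rounds against an adversary whose state contains the whole record (`trainLaw_regret_le`).

The rest of part (1) is deterministic. Optimism (`devValue_le_V`): by backward induction over the
steps, the estimate $V_h$ at the start of episode $k$ dominates the value of every modification of
the output policy started with index $k$. The reason is that the output policy mixes the past
strategies with the same weights $\alpha_t^i$ that build $\tilde V_h$, and the bonus pays for the
regret and for $\varepsilon_t$. Gap (`V_sub_certValue_le`): $V_h$ minus `certValue` is at most bonus
plus $\varepsilon_t$ plus the $\alpha$-weighted average of the same gap at the next states of the
earlier visits. As $\sum_{t\ge i}\alpha_t^i = 1+1/H$, summation over $k$ loses a factor $1+1/H$ per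
step, at most 3 in total. The bonuses are summed over the visit counts, which add up to $K$, by
concavity of $\Xi$ and of the square root. An index without earlier visits costs $H$; this lower
order term is absorbed by means of the trivial bound $H$ on the gap (`gap_le_rate`).

For part (2), the regret of FTRL_swap is at most $84B\sqrt{H\iota/t}$ with failure probability
$e^{-\iota}$ (`envRun_ftrl_le`). For each action $b$, entropy-regularized leaders have small regret
on the estimates scaled by $\theta(b)$; stationarity of $\theta$ adds these regrets up to a swap
regret; the exploration parameter $\gamma$ gives the estimates exponential moments on the side that
matters. Since $\eta$ and $\gamma$ depend on $\iota$, this is a bound at a single confidence level,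
and `ceProb_ge_of_regret` asks for no more. -/

/-! ## Expectations under discrete distributions -/

/-- The expectation of `f ≥ 0` under `p`. -/
def pexp {α : Type} (p : PMF α) (f : α → ℝ≥0∞) : ℝ≥0∞ := ∑' a, p a * f a

theorem pexp_pure {α : Type} (a : α) (f : α → ℝ≥0∞) : pexp (PMF.pure a) f = f a := by
  classical
  unfold pexp
  rw [tsum_eq_single a]
  · simp
  · intro b hb; simp [hb]

theorem pexp_bind {α β : Type} (p : PMF α) (q : α → PMF β) (f : β → ℝ≥0∞) :
    pexp (p.bind q) f = pexp p fun a => pexp (q a) f := by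
  unfold pexp
  simp only [PMF.bind_apply, ← ENNReal.tsum_mul_right, ← ENNReal.tsum_mul_left]
  rw [ENNReal.tsum_comm]
  simp only [mul_assoc]

theorem pexp_map {α β : Type} (p : PMF α) (g : α → β) (f : β → ℝ≥0∞) :
    pexp (p.map g) f = pexp p fun a => f (g a) := by
  rw [← PMF.bind_pure_comp, pexp_bind]
  simp [pexp_pure]

theorem pexp_mono_support {α : Type} {p : PMF α} {f g : α → ℝ≥0∞}
    (h : ∀ a ∈ p.support, f a ≤ g a) : pexp p f ≤ pexp p g := by
  refine ENNReal.tsum_le_tsum fun a => ?_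
  by_cases ha : a ∈ p.support
  · gcongr; exact h a ha
  · rw [(PMF.apply_eq_zero_iff p a).mpr ha]; simp

theorem pexp_mono {α : Type} {p : PMF α} {f g : α → ℝ≥0∞} (h : ∀ a, f a ≤ g a) :
    pexp p f ≤ pexp p g := pexp_mono_support fun a _ => h a

theorem pexp_congr_support {α : Type} {p : PMF α} {f g : α → ℝ≥0∞}
    (h : ∀ a ∈ p.support, f a = g a) : pexp p f = pexp p g :=
  le_antisymm (pexp_mono_support fun a ha => (h a ha).le)
    (pexp_mono_support fun a ha => (h a ha).ge)

theorem pexp_const {α : Type} (p : PMF α) (c : ℝ≥0∞) : pexp p (fun _ => c) = c := by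
  unfold pexp
  rw [ENNReal.tsum_mul_right, p.tsum_coe, one_mul]

theorem pexp_add {α : Type} (p : PMF α) (f g : α → ℝ≥0∞) :
    pexp p (fun a => f a + g a) = pexp p f + pexp p g := by
  unfold pexp
  simp only [mul_add]
  exact ENNReal.tsum_add

theorem pexp_const_mul {α : Type} (p : PMF α) (c : ℝ≥0∞) (f : α → ℝ≥0∞) :
    pexp p (fun a => c * f a) = c * pexp p f := by
  unfold pexp
  rw [← ENNReal.tsum_mul_left]
  congr 1; funext a; ring

theorem toOuterMeasure_eq_pexp {α : Type} (p : PMF α) (s : Set α) :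
    p.toOuterMeasure s = pexp p (s.indicator fun _ => 1) := by
  rw [PMF.toOuterMeasure_apply]
  unfold pexp
  congr 1; funext a
  by_cases h : a ∈ s <;> simp [h]

theorem markov_pexp {α : Type} (p : PMF α) (f : α → ℝ≥0∞) (c : ℝ≥0∞) :
    c * p.toOuterMeasure {a | c ≤ f a} ≤ pexp p f := by
  rw [toOuterMeasure_eq_pexp, ← pexp_const_mul]
  refine pexp_mono fun a => ?_
  by_cases h : c ≤ f a <;> simp [h]

theorem toOuterMeasure_le_one {α : Type} (p : PMF α) (s : Set α) : p.toOuterMeasure s ≤ 1 := by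
  rw [toOuterMeasure_eq_pexp]
  refine (pexp_mono (g := fun _ => 1) fun a => ?_).trans (pexp_const p 1).le
  by_cases h : a ∈ s <;> simp [h]

theorem one_le_toOuterMeasure_add_compl {α : Type} (p : PMF α) (s : Set α) :
    1 ≤ p.toOuterMeasure s + p.toOuterMeasure sᶜ := by
  rw [toOuterMeasure_eq_pexp, toOuterMeasure_eq_pexp, ← pexp_add]
  refine (pexp_const p 1).ge.trans (pexp_mono fun a => ?_)
  by_cases h : a ∈ s <;> simp [h]

theorem toMeasure_eq_sum_dirac {α : Type} (p : PMF α) :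
    @PMF.toMeasure α ⊤ p = @Measure.sum α α ⊤ fun a => p a • @Measure.dirac α ⊤ a := by
  let _ : MeasurableSpace α := ⊤
  ext s hs
  rw [PMF.toMeasure_apply p hs, Measure.sum_apply _ hs]
  congr 1; funext a
  by_cases h : a ∈ s <;> simp [h]

theorem lintegral_toMeasure {α : Type} (p : PMF α) (f : α → ℝ≥0∞) :
    @lintegral α ⊤ (@PMF.toMeasure α ⊤ p) f = pexp p f := by
  let _ : MeasurableSpace α := ⊤
  rw [toMeasure_eq_sum_dirac, lintegral_sum_measure]
  unfold pexp
  congr 1; funext a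
  rw [lintegral_smul_measure, lintegral_dirac' _ measurable_from_top, smul_eq_mul]

/-! ## Expectations on finite sets -/

/-- The expectation of `f` under a distribution on a finite set. -/
def rexp {α : Type} [Fintype α] (p : PMF α) (f : α → ℝ) : ℝ := ∑ a, (p a).toReal * f a

section rexp
variable {α β : Type} [Fintype α] [Fintype β]

theorem sum_toReal_eq_one (p : PMF α) : ∑ a, (p a).toReal = 1 := by
  rw [← ENNReal.toReal_sum fun a _ => p.apply_ne_top a,
    ← tsum_fintype (L := SummationFilter.unconditional _), p.tsum_coe, ENNReal.toReal_one]

theorem rexp_const (p : PMF α) (c : ℝ) : rexp p (fun _ => c) = c := by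
  unfold rexp
  rw [← Finset.sum_mul, sum_toReal_eq_one, one_mul]

theorem rexp_add (p : PMF α) (f g : α → ℝ) :
    rexp p (fun a => f a + g a) = rexp p f + rexp p g := by
  simp [rexp, mul_add, Finset.sum_add_distrib]

theorem rexp_sub (p : PMF α) (f g : α → ℝ) :
    rexp p (fun a => f a - g a) = rexp p f - rexp p g := by
  simp [rexp, mul_sub, Finset.sum_sub_distrib]

theorem rexp_const_mul (p : PMF α) (c : ℝ) (f : α → ℝ) :
    rexp p (fun a => c * f a) = c * rexp p f := by
  unfold rexp
  rw [Finset.mul_sum]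
  exact Finset.sum_congr rfl fun a _ => by ring

theorem rexp_mono {p : PMF α} {f g : α → ℝ} (h : ∀ a, f a ≤ g a) : rexp p f ≤ rexp p g :=
  Finset.sum_le_sum fun a _ => mul_le_mul_of_nonneg_left (h a) ENNReal.toReal_nonneg

theorem rexp_nonneg {p : PMF α} {f : α → ℝ} (h : ∀ a, 0 ≤ f a) : 0 ≤ rexp p f :=
  Finset.sum_nonneg fun a _ => mul_nonneg ENNReal.toReal_nonneg (h a)

theorem rexp_le {p : PMF α} {f : α → ℝ} {c : ℝ} (h : ∀ a, f a ≤ c) : rexp p f ≤ c :=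
  (rexp_mono h).trans (rexp_const p c).le

theorem rexp_bind (p : PMF α) (q : α → PMF β) (f : β → ℝ) :
    rexp (p.bind q) f = rexp p fun a => rexp (q a) f := by
  unfold rexp
  simp only [PMF.bind_apply, tsum_fintype, Finset.mul_sum]
  rw [Finset.sum_comm]
  refine Finset.sum_congr rfl fun b _ => ?_
  rw [ENNReal.toReal_sum fun a _ => ENNReal.mul_ne_top (p.apply_ne_top a) ((q a).apply_ne_top b),
    Finset.sum_mul]
  exact Finset.sum_congr rfl fun a _ => by rw [ENNReal.toReal_mul, mul_assoc]

theorem rexp_pure (a : α) (f : α → ℝ) : rexp (PMF.pure a) f = f a := by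
  classical
  unfold rexp
  rw [Finset.sum_eq_single a]
  · simp
  · intro b _ hb; simp [hb]
  · simp

theorem rexp_map (p : PMF α) (g : α → β) (f : β → ℝ) :
    rexp (p.map g) f = rexp p fun a => f (g a) := by
  rw [← PMF.bind_pure_comp, rexp_bind]
  simp [rexp_pure]

theorem pexp_ofReal (p : PMF α) {f : α → ℝ} (h : ∀ a, 0 ≤ f a) :
    pexp p (fun a => ENNReal.ofReal (f a)) = ENNReal.ofReal (rexp p f) := by
  unfold pexp rexp
  rw [tsum_fintype, ENNReal.ofReal_sum_of_nonneg fun a _ => mul_nonneg ENNReal.toReal_nonneg (h a)]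
  refine Finset.sum_congr rfl fun a _ => ?_
  rw [ENNReal.ofReal_mul ENNReal.toReal_nonneg, ENNReal.ofReal_toReal (p.apply_ne_top a)]

theorem rexp_comm (p : PMF α) (q : PMF β) (f : α → β → ℝ) :
    rexp p (fun a => rexp q (f a)) = rexp q fun b => rexp p fun a => f a b := by
  unfold rexp
  simp only [Finset.mul_sum]
  rw [Finset.sum_comm]
  exact Finset.sum_congr rfl fun b _ => Finset.sum_congr rfl fun a _ => by ring

theorem rexp_uniform [Nonempty α] (f : α → ℝ) :
    rexp (PMF.uniformOfFintype α) f = (∑ a, f a) / Fintype.card α := by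
  unfold rexp
  simp [PMF.uniformOfFintype_apply, ← Finset.mul_sum, div_eq_inv_mul]

end rexp

/-! ## Product distributions: resampling one coordinate -/

/-- Exchanging `y` with the coordinate `d x` does not change the weight of the pair `(y, d)`; this
symmetry makes resampling of a coordinate harmless. -/
theorem prod_update_mul {ι : Type} [Fintype ι] [DecidableEq ι] {α : ι → Type}
    (p : ∀ i, PMF (α i)) (x : ι) (y : α x) (d : ∀ i, α i) :
    p x (d x) * ∏ i, p i (Function.update d x y i) = p x y * ∏ i, p i (d i) := by
  have h1 : ∏ i ∈ Finset.univ.erase x, p i (Function.update d x y i)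
      = ∏ i ∈ Finset.univ.erase x, p i (d i) := by
    refine Finset.prod_congr rfl fun i hi => ?_
    rw [Function.update_of_ne (Finset.ne_of_mem_erase hi)]
  rw [← Finset.mul_prod_erase _ _ (Finset.mem_univ x),
    ← Finset.mul_prod_erase _ (fun i => p i (d i)) (Finset.mem_univ x), h1, Function.update_self]
  ring

section resample
variable {ι : Type} [Fintype ι] [DecidableEq ι] {α : ι → Type} [∀ i, Fintype (α i)]

theorem pmfPi_apply (p : ∀ i, PMF (α i)) (a : ∀ i, α i) : pmfPi p a = ∏ i, p i (a i) := rfl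

/-- Used twice: to single out the action of one player among independent actions, and to reveal one
entry of the random seed at a time. -/
theorem pmfPi_eq_bind_update (p : ∀ i, PMF (α i)) (x : ι) :
    pmfPi p = (p x).bind fun y => (pmfPi p).map fun d => Function.update d x y := by
  classical
  have key : ∀ F : (∀ i, α i) → ℝ≥0∞,
      pexp ((p x).bind fun y => (pmfPi p).map fun d => Function.update d x y) F
        = pexp (pmfPi p) F := by
    intro F
    simp only [pexp_bind, pexp_map]
    have e : pexp (p x) (fun y => pexp (pmfPi p) fun d => F (Function.update d x y))
        = pexp (p x) (fun _ => pexp (pmfPi p) F) := by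
      unfold pexp
      simp only [tsum_fintype, Finset.mul_sum]
      rw [← Finset.sum_product' (f := fun y d => p x y * (pmfPi p d * F (Function.update d x y))),
        ← Finset.sum_product' (f := fun y d => p x y * (pmfPi p d * F d))]
      let σ : (α x × ∀ i, α i) → (α x × ∀ i, α i) :=
        fun yd => (yd.2 x, Function.update yd.2 x yd.1)
      have hσ : Function.Involutive σ := fun yd => by simp [σ]
      refine Finset.sum_bijective σ hσ.bijective (by simp) fun yd _ => ?_
      simp only [σ, pmfPi_apply]
      rw [← mul_assoc, ← mul_assoc, prod_update_mul]
    rw [e, pexp_const]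
  refine PMF.ext fun d => ?_
  have := key (Set.indicator {d} fun _ => 1)
  rw [← toOuterMeasure_eq_pexp, ← toOuterMeasure_eq_pexp, PMF.toOuterMeasure_apply_singleton,
    PMF.toOuterMeasure_apply_singleton] at this
  exact this.symm

theorem rexp_pmfPi_resample (p : ∀ i, PMF (α i)) (x : ι)
    (F : (∀ i, α i) → ℝ) :
    rexp (pmfPi p) F = rexp (p x) fun y => rexp (pmfPi p) fun d => F (Function.update d x y) := by
  conv_lhs => rw [pmfPi_eq_bind_update p x]
  rw [rexp_bind]
  simp only [rexp_map]

end resample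

/-! ## Two exponential inequalities -/

/-- Applied to a centered variable, the linear term vanishes in the mean, so a sub-Gaussian bound
results without any smallness condition on the parameter of the exponential moment. -/
theorem exp_le_add_exp_sq (x : ℝ) : Real.exp x ≤ x + Real.exp (x ^ 2) := by
  have h2 := Real.add_one_le_exp (x ^ 2)
  by_cases h : |x| ≤ 1
  · have := abs_le.mp (Real.abs_exp_sub_one_sub_id_le h)
    linarith [this.2]
  · rcases le_or_gt 0 x with hx | hx
    · rw [abs_of_nonneg hx] at h
      have : Real.exp x ≤ Real.exp (x ^ 2) := Real.exp_le_exp.mpr (by nlinarith)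
      linarith
    · rw [abs_of_neg hx] at h
      have : Real.exp x ≤ 1 := Real.exp_le_one_iff.mpr hx.le
      nlinarith

/-! ## Learning rates -/

theorem lr_pos (H t : ℕ) (h : 1 ≤ H) : 0 < lr H t := by
  unfold lr
  have : (1 : ℝ) ≤ H := by exact_mod_cast h
  positivity

theorem one_sub_lr_succ (H t : ℕ) : 1 - lr H (t + 1) = (t : ℝ) / (H + t + 1) := by
  unfold lr
  have : (H : ℝ) + t + 1 ≠ 0 := by positivity
  have h2 : (H : ℝ) + ((t + 1 : ℕ) : ℝ) ≠ 0 := by positivity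
  rw [eq_div_iff this, sub_mul, div_mul_eq_mul_div, div_eq_mul_inv]
  push_cast at *
  field_simp
  ring

theorem lrW_self (H t : ℕ) : lrW H t t = lr H t := by simp [lrW]

theorem lrW_succ {H t i : ℕ} (h : i ≤ t) :
    lrW H (t + 1) i = (1 - lr H (t + 1)) * lrW H t i := by
  unfold lrW
  rw [Finset.prod_Icc_succ_top (by omega)]
  ring

/-- The latest weight is the largest because $(1-\alpha_{t+1})\alpha_t\le\alpha_{t+1}$. With total
weight 1 this bounds the sum of squares. -/
theorem lrW_le_lr {H i t : ℕ} (hi : 1 ≤ i) (h : i ≤ t) : lrW H t i ≤ lr H t := by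
  induction t, h using Nat.le_induction with
  | base => rw [lrW_self]
  | succ t ht ih =>
    rw [lrW_succ ht, one_sub_lr_succ]
    refine (mul_le_mul_of_nonneg_left ih (by positivity)).trans ?_
    unfold lr
    have : (1 : ℝ) ≤ t := by exact_mod_cast hi.trans ht
    have h0 : (0 : ℝ) ≤ H := by positivity
    rw [div_mul_div_comm, div_le_div_iff₀ (by positivity) (by push_cast; positivity)]
    push_cast
    nlinarith [mul_nonneg h0 h0, mul_nonneg h0 (by linarith : (0 : ℝ) ≤ t),
      mul_nonneg (mul_nonneg h0 h0) h0, mul_nonneg (mul_nonneg h0 h0) (by linarith : (0 : ℝ) ≤ t)]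

theorem lr_le {H t : ℕ} (hH : 1 ≤ H) (ht : 1 ≤ t) : lr H t ≤ 2 * H / t := by
  unfold lr
  have h1 : (1 : ℝ) ≤ H := by exact_mod_cast hH
  have h2 : (1 : ℝ) ≤ t := by exact_mod_cast ht
  rw [div_le_div_iff₀ (by positivity) (by positivity)]
  nlinarith

theorem sum_lrW_fin (H t : ℕ) (ht : 0 < t) : ∑ i : Fin t, lrW H t (i + 1) = 1 := by
  obtain ⟨n, rfl⟩ : ∃ n, t = n + 1 := ⟨t - 1, by omega⟩
  rw [Fin.sum_univ_eq_sum_range (fun i => lrW H (n + 1) (i + 1)) (n + 1), sum_lrW]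

theorem sum_lrW_sq_le {H t : ℕ} (hH : 1 ≤ H) (ht : 1 ≤ t) :
    ∑ i ∈ Finset.range t, lrW H t (i + 1) ^ 2 ≤ 2 * H / t := by
  obtain ⟨n, rfl⟩ : ∃ n, t = n + 1 := ⟨t - 1, by omega⟩
  calc ∑ i ∈ Finset.range (n + 1), lrW H (n + 1) (i + 1) ^ 2
      ≤ ∑ i ∈ Finset.range (n + 1), lrW H (n + 1) (i + 1) * (2 * H / (n + 1 : ℕ)) := by
        refine Finset.sum_le_sum fun i hi => ?_
        rw [sq]
        refine mul_le_mul_of_nonneg_left ?_ (lrW_nonneg _ _ _)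
        exact (lrW_le_lr (by omega) (by have := Finset.mem_range.mp hi; omega)).trans (lr_le hH ht)
    _ = _ := by rw [← Finset.sum_mul, sum_lrW, one_mul]

theorem sum_lrW_div_sqrt_le (H : ℕ) (t : ℕ) (ht : 1 ≤ t) :
    ∑ i ∈ Finset.Icc 1 t, lrW H t i / Real.sqrt i ≤ 2 / Real.sqrt t := by
  induction t, ht using Nat.le_induction with
  | base =>
    simp only [Finset.Icc_self, Finset.sum_singleton, lrW_self, lr_one]
    norm_num
  | succ t ht ih =>
    rw [Finset.sum_Icc_succ_top (by omega), lrW_self]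
    have h1 : ∑ i ∈ Finset.Icc 1 t, lrW H (t + 1) i / Real.sqrt i
        = (1 - lr H (t + 1)) * ∑ i ∈ Finset.Icc 1 t, lrW H t i / Real.sqrt i := by
      rw [Finset.mul_sum]
      refine Finset.sum_congr rfl fun i hi => ?_
      rw [lrW_succ (Finset.mem_Icc.mp hi).2]
      ring
    rw [h1, one_sub_lr_succ]
    refine (add_le_add_left (mul_le_mul_of_nonneg_left ih (by positivity)) _).trans ?_
    unfold lr
    have ht' : (1 : ℝ) ≤ t := by exact_mod_cast ht
    set u := Real.sqrt t with hu
    set v := Real.sqrt ((t + 1 : ℕ) : ℝ) with hv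
    have hu0 : 0 < u := Real.sqrt_pos.mpr (by linarith)
    have hv0 : 0 < v := Real.sqrt_pos.mpr (by positivity)
    have hu2 : u ^ 2 = t := Real.sq_sqrt (by linarith)
    have hv2 : v ^ 2 = t + 1 := by rw [hv, Real.sq_sqrt (by positivity)]; push_cast; rfl
    have e : (H : ℝ) + ((t + 1 : ℕ) : ℝ) = H + t + 1 := by push_cast; ring
    rw [e]
    have hp : (0 : ℝ) < H + t + 1 := by positivity
    have e2 : (t : ℝ) / (H + t + 1) * (2 / u) = 2 * u / (H + t + 1) := by
      rw [← hu2]; field_simp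
    rw [e2, div_div, div_add_div _ _ hp.ne' (by positivity), div_le_div_iff₀ (by positivity) hv0]
    -- $2uv\le u^2+v^2=2t+1$.
    have key : 2 * u * v + (H + 1) ≤ 2 * (H + t + 1) := by
      nlinarith [sq_nonneg (u - v), (by positivity : (0 : ℝ) ≤ H)]
    nlinarith [mul_le_mul_of_nonneg_left key (by positivity : 0 ≤ (H + t + 1 : ℝ) * v)]

/-- An average of numbers that are all at least $1/\sqrt t$. With `sum_lrW_div_sqrt_le` it
determines the weighted sum of the FTRL bonuses up to a factor 2. -/
theorem le_sum_lrW_div_sqrt (H : ℕ) (t : ℕ) (ht : 1 ≤ t) :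
    1 / Real.sqrt t ≤ ∑ i ∈ Finset.Icc 1 t, lrW H t i / Real.sqrt i := by
  obtain ⟨n, rfl⟩ : ∃ n, t = n + 1 := ⟨t - 1, by omega⟩
  have h := sum_lrW H n
  rw [Finset.range_eq_Ico, Finset.sum_Ico_add' (fun i => lrW H (n + 1) i) 0 (n + 1) 1] at h
  have e : Finset.Ico (0 + 1) (n + 1 + 1) = Finset.Icc 1 (n + 1) := by ext; simp
  rw [e] at h
  rw [← h, Finset.sum_div]
  refine Finset.sum_le_sum fun i hi => ?_
  obtain ⟨h1, h2⟩ := Finset.mem_Icc.mp hi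
  refine div_le_div_of_nonneg_left (lrW_nonneg _ _ _) ?_ ?_
  · exact Real.sqrt_pos.mpr (by exact_mod_cast h1)
  · exact Real.sqrt_le_sqrt (by exact_mod_cast h2)

/-! ## Weighted averages and sums along lists -/

/-- The average `∑_{i=1}^t α_t^i f(x_i)` over the list `x_1, …, x_t`. -/
def wavg {γ : Type} (H : ℕ) (l : List γ) (f : γ → ℝ) : ℝ :=
  ∑ i : Fin l.length, lrW H l.length (i + 1) * f (l.get i)

/-- The sum of `G [x_1, …, x_{i-1}] x_i` over the entries of the list `x_1, …, x_t`. -/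
def prefixSum {γ : Type} (G : List γ → γ → ℝ) (l : List γ) : ℝ :=
  ∑ i : Fin l.length, G (l.take i) (l.get i)

section lists
variable {γ γ' : Type}

theorem sum_fin_cast {n m : ℕ} (h : n = m) (f : Fin m → ℝ) :
    ∑ i : Fin m, f i = ∑ i : Fin n, f (i.cast h) := by
  subst h; rfl

theorem prefixSum_nil (G : List γ → γ → ℝ) : prefixSum G [] = 0 := by
  simp [prefixSum]

theorem prefixSum_snoc (G : List γ → γ → ℝ) (l : List γ) (x : γ) :
    prefixSum G (l ++ [x]) = prefixSum G l + G l x := by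
  unfold prefixSum
  rw [sum_fin_cast (n := l.length + 1) (by simp), Fin.sum_univ_castSucc]
  congr 1
  · refine Finset.sum_congr rfl fun i _ => ?_
    have := i.2
    simp only [Fin.val_cast, Fin.val_castSucc, List.get_eq_getElem]
    rw [List.take_append_of_le_length (by omega), List.getElem_append_left (by omega)]
  · simp

theorem wavg_nil (H : ℕ) (f : γ → ℝ) : wavg H [] f = 0 := by simp [wavg]

theorem wavg_snoc (H : ℕ) (l : List γ) (x : γ) (f : γ → ℝ) :
    wavg H (l ++ [x]) f
      = (1 - lr H (l.length + 1)) * wavg H l f + lr H (l.length + 1) * f x := by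
  unfold wavg
  rw [sum_fin_cast (n := l.length + 1) (by simp), Fin.sum_univ_castSucc, Finset.mul_sum]
  congr 1
  · refine Finset.sum_congr rfl fun i _ => ?_
    have := i.2
    simp only [Fin.val_cast, Fin.val_castSucc, List.get_eq_getElem, List.length_append,
      List.length_singleton]
    rw [lrW_succ (by omega), List.getElem_append_left (by omega)]
    ring
  · simp [lrW_self]

theorem wavg_map (H : ℕ) (l : List γ) (g : γ → γ') (f : γ' → ℝ) :
    wavg H (l.map g) f = wavg H l fun x => f (g x) := by
  unfold wavg
  rw [sum_fin_cast (n := l.length) (by simp)]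
  simp

theorem wavg_congr {H : ℕ} {l : List γ} {f g : γ → ℝ} (h : ∀ x ∈ l, f x = g x) :
    wavg H l f = wavg H l g :=
  Finset.sum_congr rfl fun i _ => by rw [h _ (List.get_mem _ _)]

theorem wavg_mono {H : ℕ} {l : List γ} {f g : γ → ℝ} (h : ∀ x ∈ l, f x ≤ g x) :
    wavg H l f ≤ wavg H l g :=
  Finset.sum_le_sum fun _ _ => mul_le_mul_of_nonneg_left (h _ (List.get_mem _ _)) (lrW_nonneg _ _ _)

theorem wavg_nonneg {H : ℕ} {l : List γ} {f : γ → ℝ} (h : ∀ x ∈ l, 0 ≤ f x) : 0 ≤ wavg H l f :=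
  Finset.sum_nonneg fun _ _ => mul_nonneg (lrW_nonneg _ _ _) (h _ (List.get_mem _ _))

theorem wavg_sub (H : ℕ) (l : List γ) (f g : γ → ℝ) :
    wavg H l (fun x => f x - g x) = wavg H l f - wavg H l g := by
  simp [wavg, mul_sub, Finset.sum_sub_distrib]

theorem wavg_const_mul (H : ℕ) (l : List γ) (c : ℝ) (f : γ → ℝ) :
    wavg H l (fun x => c * f x) = c * wavg H l f := by
  unfold wavg
  rw [Finset.mul_sum]
  exact Finset.sum_congr rfl fun i _ => by ring

theorem wavg_const (H : ℕ) (l : List γ) (hl : l ≠ []) (c : ℝ) : wavg H l (fun _ => c) = c := by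
  unfold wavg
  rw [← Finset.sum_mul, sum_lrW_fin _ _ (List.length_pos_iff.mpr hl), one_mul]

theorem wavg_le {H : ℕ} {l : List γ} (hl : l ≠ []) {f : γ → ℝ} {c : ℝ} (h : ∀ x ∈ l, f x ≤ c) :
    wavg H l f ≤ c := (wavg_mono h).trans (wavg_const H l hl c).le

/-- A finite form of $\sum_{t\ge i}\alpha_t^i=1+1/H$: the tail over $t\ge n$ is $(n/H+1)\alpha_n^i$,
which is the subtracted term for a list of length $n$. -/
theorem prefixSum_wavg (H : ℕ) (hH : 1 ≤ H) (l : List γ) (f : γ → ℝ) :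
    prefixSum (fun p _ => wavg H p f) l
      = (1 + 1 / H) * (l.map f).sum - (l.length / H + 1) * wavg H l f := by
  have hH' : (H : ℝ) ≠ 0 := by positivity
  induction l using List.reverseRecOn with
  | nil => simp [prefixSum_nil, wavg_nil]
  | append_singleton l x ih =>
    rw [prefixSum_snoc, ih, wavg_snoc, one_sub_lr_succ]
    unfold lr
    have h1 : (H : ℝ) + l.length + 1 ≠ 0 := by positivity
    have h2 : (H : ℝ) + (l.length + 1) ≠ 0 := by positivity
    simp only [List.map_append, List.sum_append, List.map_cons, List.map_nil, List.sum_cons,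
      List.sum_nil, List.length_append, List.length_singleton]
    push_cast
    field_simp
    ring

/-- Summing weighted averages over all proper prefixes costs at most a factor `1 + 1/H`. -/
theorem prefixSum_wavg_le (H : ℕ) (hH : 1 ≤ H) (l : List γ) (f : γ → ℝ)
    (hf : ∀ x ∈ l, 0 ≤ f x) :
    prefixSum (fun p _ => wavg H p f) l ≤ (1 + 1 / H) * (l.map f).sum := by
  rw [prefixSum_wavg H hH]
  have : 0 ≤ (l.length / H + 1 : ℝ) * wavg H l f := mul_nonneg (by positivity) (wavg_nonneg hf)
  linarith

theorem prefixSum_add (G G' : List γ → γ → ℝ) (l : List γ) :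
    prefixSum (fun p x => G p x + G' p x) l = prefixSum G l + prefixSum G' l := by
  simp [prefixSum, Finset.sum_add_distrib]

/-- Sums along a list are regrouped by the colors of the entries. -/
theorem prefixSum_filter {σ : Type} [Fintype σ] [DecidableEq σ] (st : γ → σ)
    (G : List γ → γ → ℝ) (l : List γ) :
    prefixSum (fun p x => G (p.filter fun y => st y = st x) x) l
      = ∑ s, prefixSum G (l.filter fun y => st y = s) := by
  induction l using List.reverseRecOn with
  | nil => simp [prefixSum_nil]
  | append_singleton l x ih =>
    rw [prefixSum_snoc, ih, ← Finset.add_sum_erase _ _ (Finset.mem_univ (st x)),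
      ← Finset.add_sum_erase _ (fun s => prefixSum G ((l ++ [x]).filter fun y => st y = s))
        (Finset.mem_univ (st x))]
    have h1 : ∀ s ∈ Finset.univ.erase (st x), prefixSum G ((l ++ [x]).filter fun y => st y = s)
        = prefixSum G (l.filter fun y => st y = s) := by
      intro s hs
      have : st x ≠ s := (Finset.ne_of_mem_erase hs).symm
      simp [List.filter_append, this]
    rw [Finset.sum_congr rfl h1]
    have h2 : (l ++ [x]).filter (fun y => st y = st x)
        = l.filter (fun y => st y = st x) ++ [x] := by simp [List.filter_append]
    rw [h2, prefixSum_snoc]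
    ring

end lists

/-! ## Bandits against a Markovian adversary -/

/-- The entries of a list, each paired with the entries before it. -/
def splits {γ : Type} (l : List γ) : List (List γ × γ) :=
  List.ofFn fun i : Fin l.length => (l.take i, l.get i)

theorem splits_nil {γ : Type} : splits ([] : List γ) = [] := by simp [splits]

theorem splits_length {γ : Type} (l : List γ) : (splits l).length = l.length := by simp [splits]

theorem splits_snoc {γ : Type} (l : List γ) (x : γ) : splits (l ++ [x]) = splits l ++ [(l, x)] := by
  refine List.ext_getElem (by simp [splits]) fun i h1 h2 => ?_
  have hi : i < l.length + 1 := by simpa [splits] using h1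
  rcases Nat.lt_succ_iff_lt_or_eq.mp hi with h | rfl
  · rw [List.getElem_append_left (by simpa [splits] using h)]
    simp only [splits, List.getElem_ofFn, List.get_eq_getElem, List.getElem_append_left h,
      List.take_append_of_le_length h.le]
  · rw [List.getElem_append_right (by simp [splits])]
    simp only [splits, List.getElem_ofFn, List.get_eq_getElem, List.length_ofFn, Nat.sub_self,
      List.getElem_cons_zero, List.take_left, List.getElem_concat_length]

/-- A round of the interaction: the state of the adversary, the action and the feedback. -/
abbrev Round (Z : Type) (B : ℕ) : Type := Z × Fin B × unitInterval

section envRun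
variable {Z : Type} {B : ℕ} [NeZero B]

/-- What the learner sees. -/
def feedbacks {Z : Type} {B : ℕ} (ω : List (Round Z B)) : List (Fin B × ℝ) :=
  ω.map fun x => (x.2.1, (x.2.2 : ℝ))

/-- The law of `t` more rounds against an adversary that in state `z`, after action `b`, draws the
feedback and its next state from `κ z b`. -/
def envRun (alg : BanditAlg B) (κ : Z → Fin B → PMF (unitInterval × Z)) :
    ℕ → List (Round Z B) → Z → PMF (List (Round Z B))
  | 0, ω, _ => PMF.pure ω
  | t + 1, ω, z => (alg.strategy (feedbacks ω)).bind fun b =>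
      (κ z b).bind fun xz => envRun alg κ t (ω ++ [(z, b, xz.1)]) xz.2

/-- The expected feedback. -/
def meanLoss {Z : Type} {B : ℕ} (κ : Z → Fin B → PMF (unitInterval × Z)) (z : Z) (b : Fin B) : ℝ :=
  (pexp (κ z b) fun xz => ENNReal.ofReal xz.1).toReal

/-- The weighted regret along a trajectory. -/
def runRegret (alg : BanditAlg B) (κ : Z → Fin B → PMF (unitInterval × Z)) (H : ℕ)
    (ψ : Fin B → Fin B) (ω : List (Round Z B)) : ℝ :=
  wavg H (splits ω) fun p =>
    rexp (alg.strategy (feedbacks p.1)) (meanLoss κ p.2.1)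
      - rexp (alg.strategy (feedbacks p.1)) fun b => meanLoss κ p.2.1 (ψ b)

theorem pexp_feedback_le_one {Z : Type} {B : ℕ} (κ : Z → Fin B → PMF (unitInterval × Z)) (z : Z) (b : Fin B) :
    pexp (κ z b) (fun xz => ENNReal.ofReal xz.1) ≤ 1 :=
  (pexp_mono fun xz => ENNReal.ofReal_le_one.mpr xz.1.2.2).trans (pexp_const _ 1).le

theorem ofReal_meanLoss {Z : Type} {B : ℕ} (κ : Z → Fin B → PMF (unitInterval × Z)) (z : Z) (b : Fin B) :
    ENNReal.ofReal (meanLoss κ z b) = pexp (κ z b) fun xz => ENNReal.ofReal xz.1 :=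
  ENNReal.ofReal_toReal (ne_top_of_le_ne_top ENNReal.one_ne_top (pexp_feedback_le_one κ z b))

theorem meanLoss_mem {Z : Type} {B : ℕ} (κ : Z → Fin B → PMF (unitInterval × Z)) (z : Z) (b : Fin B) :
    meanLoss κ z b ∈ Set.Icc (0 : ℝ) 1 :=
  ⟨ENNReal.toReal_nonneg, ENNReal.toReal_le_of_le_ofReal zero_le_one
    (by simpa using pexp_feedback_le_one κ z b)⟩

theorem prefix_of_mem_support_envRun {alg : BanditAlg B}
    {κ : Z → Fin B → PMF (unitInterval × Z)} {t : ℕ} {ω₀ ω : List (Round Z B)} {z : Z}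
    (h : ω ∈ (envRun alg κ t ω₀ z).support) : ω₀ <+: ω ∧ ω.length = ω₀.length + t := by
  induction t generalizing ω₀ z with
  | zero =>
    simp only [envRun, PMF.support_pure, Set.mem_singleton_iff] at h
    subst h; simp
  | succ t ih =>
    simp only [envRun, PMF.support_bind, Set.mem_iUnion] at h
    obtain ⟨b, _, xz, _, h⟩ := h
    obtain ⟨h1, h2⟩ := ih h
    refine ⟨(List.prefix_append _ _).trans h1, ?_⟩
    rw [h2, List.length_append, List.length_singleton]; omega

/-- The information before the action of round `i`. -/
def runInfo {Z : Type} {B : ℕ} (i : ℕ) (ω : List (Round Z B)) : List (Round Z B) × Option Z :=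
  (ω.take i, (ω[i]?).map Prod.fst)

/-- The defining identity of a conditional expectation: `F` depends only on the information before
the action of round `i`, and `v` is the mean of `w` over the action and the feedback of that round.
-/
theorem pexp_envRun_round (alg : BanditAlg B) (κ : Z → Fin B → PMF (unitInterval × Z)) (i : ℕ)
    (F v : List (Round Z B) × Option Z → ℝ≥0∞) (w : Option (Round Z B) → ℝ≥0∞)
    (hv : ∀ l z, l.length = i → v (l, some z) = pexp (alg.strategy (feedbacks l)) fun b =>
      pexp (κ z b) fun xz => w (some (z, b, xz.1)))
    (t : ℕ) (ω₀ : List (Round Z B)) (z : Z) (h1 : ω₀.length ≤ i) (h2 : i < ω₀.length + t) :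
    pexp (envRun alg κ t ω₀ z) (fun ω => F (runInfo i ω) * w ω[i]?)
      = pexp (envRun alg κ t ω₀ z) (fun ω => F (runInfo i ω) * v (runInfo i ω)) := by
  induction t generalizing ω₀ z with
  | zero => omega
  | succ t ih =>
    simp only [envRun, pexp_bind]
    rcases Nat.lt_or_ge ω₀.length i with h | h
    · refine pexp_congr_support fun b _ => pexp_congr_support fun xz _ => ?_
      exact ih _ _ (by simp; omega) (by simp; omega)
    · have hi : i = ω₀.length := le_antisymm h h1
      subst hi
      -- Every continuation keeps the first rounds as a prefix, so whatever depends only on the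
      -- information before round `i` and on round `i` itself is already constant.
      have key : ∀ (G : List (Round Z B) × Option Z → Option (Round Z B) → ℝ≥0∞) b
          (xz : unitInterval × Z),
          pexp (envRun alg κ t (ω₀ ++ [(z, b, xz.1)]) xz.2)
            (fun ω => G (runInfo ω₀.length ω) ω[ω₀.length]?)
            = G (ω₀, some z) (some (z, b, xz.1)) := by
        intro G b xz
        refine (pexp_congr_support (g := fun _ => G (ω₀, some z) (some (z, b, xz.1)))
          fun ω hω => ?_).trans (pexp_const _ _)
        obtain ⟨r, rfl⟩ := (prefix_of_mem_support_envRun hω).1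
        simp [runInfo]
      rw [show (fun b => pexp (κ z b) fun xz => pexp (envRun alg κ t (ω₀ ++ [(z, b, xz.1)]) xz.2)
          fun ω => F (runInfo ω₀.length ω) * w ω[ω₀.length]?)
          = fun b => pexp (κ z b) fun xz => F (ω₀, some z) * w (some (z, b, xz.1)) from
          funext fun b => congrArg _ (funext fun xz => key (fun p q => F p * w q) b xz)]
      rw [show (fun b => pexp (κ z b) fun xz => pexp (envRun alg κ t (ω₀ ++ [(z, b, xz.1)]) xz.2)
          fun ω => F (runInfo ω₀.length ω) * v (runInfo ω₀.length ω))
          = fun b => pexp (κ z b) fun xz => F (ω₀, some z) * v (ω₀, some z) from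
          funext fun b => congrArg _ (funext fun xz => key (fun p q => F p * v p) b xz)]
      simp only [pexp_const_mul, pexp_const, hv _ _ rfl]

/-- Earlier information is a function of later information, so the generated sigma-algebras
increase. -/
theorem runInfo_eq_of_le {Z : Type} {B : ℕ} {i j : ℕ} (hij : i ≤ j) :
    ∃ g : List (Round Z B) × Option Z → List (Round Z B) × Option Z,
      ∀ ω, runInfo i ω = g (runInfo j ω) := by
  rcases hij.eq_or_lt with rfl | h
  · exact ⟨id, fun _ => rfl⟩
  · refine ⟨fun p => runInfo i p.1, fun ω => ?_⟩
    simp [runInfo, List.take_take, h.le, h]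

/-- The filtration generated by `runInfo`. -/
def runFiltration (Z : Type) (B : ℕ) [NeZero B] :
    @Filtration (List (Round Z B)) ℕ _ ⊤ :=
  letI : MeasurableSpace (List (Round Z B)) := ⊤
  { seq := fun i => MeasurableSpace.comap (runInfo i) ⊤
    mono' := by
      intro i j hij
      obtain ⟨g, hg⟩ := runInfo_eq_of_le (Z := Z) (B := B) hij
      rintro s ⟨s', _, rfl⟩
      exact ⟨g ⁻¹' s', trivial, by ext ω; simp [hg]⟩
    le' := fun _ => le_top }

theorem measurable_runFiltration {Z : Type} {B : ℕ} [NeZero B] {β : Type} [MeasurableSpace β]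
    (i : ℕ) {f : List (Round Z B) → β} (g : List (Round Z B) × Option Z → β)
    (h : ∀ ω, f ω = g (runInfo i ω)) :
    @Measurable _ _ (@Filtration.seq _ _ _ ⊤ (runFiltration Z B) i) _ f := by
  intro s _
  exact ⟨g ⁻¹' s, trivial, by ext ω; simp [h]⟩

/-- All sets are measurable on the space of trajectories, so it suffices to compare integrals over
the sets $\{$`runInfo i`$\in s'\}$; this is `pexp_envRun_round` with `F` an indicator. -/
theorem condExp_envRun (alg : BanditAlg B) (κ : Z → Fin B → PMF (unitInterval × Z)) (t : ℕ) (z₀ : Z)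
    (i : ℕ) (hi : i < t) (f g : List (Round Z B) → ℝ)
    (hf0 : ∀ ω, f ω ∈ Set.Icc (0 : ℝ) 1) (hg0 : ∀ ω, g ω ∈ Set.Icc (0 : ℝ) 1)
    (w : Option (Round Z B) → ℝ) (hw : ∀ ω, f ω = w ω[i]?)
    (v : List (Round Z B) × Option Z → ℝ) (hgv : ∀ ω, g ω = v (runInfo i ω))
    (hv : ∀ l z, l.length = i → ENNReal.ofReal (v (l, some z)) = pexp (alg.strategy (feedbacks l)) fun b =>
      pexp (κ z b) fun xz => ENNReal.ofReal (w (some (z, b, xz.1)))) :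
    @condExp _ _ (@Filtration.seq _ _ _ ⊤ (runFiltration Z B) i) ⊤ _ _
      (@PMF.toMeasure _ ⊤ (envRun alg κ t [] z₀)) f
      =ᵐ[@PMF.toMeasure _ ⊤ (envRun alg κ t [] z₀)] g := by
  let _ : MeasurableSpace (List (Round Z B)) := ⊤
  have hint : ∀ f : List (Round Z B) → ℝ, (∀ ω, f ω ∈ Set.Icc (0 : ℝ) 1) →
      Integrable f (envRun alg κ t [] z₀).toMeasure := fun f hf =>
    Integrable.of_mem_Icc 0 1 measurable_from_top.aemeasurable (Filter.Eventually.of_forall hf)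
  refine (ae_eq_condExp_of_forall_setIntegral_eq ((runFiltration Z B).le i) (hint f hf0)
    (fun s _ _ => (hint g hg0).integrableOn) ?_ ?_).symm
  · rintro s ⟨s', _, rfl⟩ _
    rw [integral_eq_lintegral_of_nonneg_ae (Filter.Eventually.of_forall fun ω => (hg0 ω).1)
        measurable_from_top.aestronglyMeasurable,
      integral_eq_lintegral_of_nonneg_ae (Filter.Eventually.of_forall fun ω => (hf0 ω).1)
        measurable_from_top.aestronglyMeasurable,
      ← lintegral_indicator (s := runInfo i ⁻¹' s') MeasurableSpace.measurableSet_top, ← lintegral_indicator (s := runInfo i ⁻¹' s') MeasurableSpace.measurableSet_top, lintegral_toMeasure,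
      lintegral_toMeasure]
    congr 1
    have := pexp_envRun_round alg κ i (s'.indicator fun _ => 1) (fun p => ENNReal.ofReal (v p))
      (fun o => ENNReal.ofReal (w o)) hv t [] z₀ (by simp) (by simpa using hi)
    have e : ∀ u : List (Round Z B) → ℝ≥0∞, (runInfo i ⁻¹' s').indicator u
        = fun ω => s'.indicator (fun _ => (1 : ℝ≥0∞)) (runInfo i ω) * u ω := by
      intro u; funext ω
      by_cases h : runInfo i ω ∈ s' <;> simp [h]
    rw [e, e]
    simp only [hw, hgv]
    exact this.symm
  · exact (measurable_runFiltration i v hgv).aestronglyMeasurable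

theorem feedbacks_eq_map_range (l : List (Round Z B)) :
    feedbacks l = (List.range l.length).map fun n =>
      ((l[n]?).elim 0 fun r => r.2.1, (l[n]?).elim (0 : ℝ) fun r => (r.2.2 : ℝ)) := by
  refine List.ext_getElem (by simp [feedbacks]) fun n h1 h2 => ?_
  have : n < l.length := by simpa [feedbacks] using h1
  simp [feedbacks, this]

theorem map_range_take (i : ℕ) (ω : List (Round Z B)) :
    ((List.range i).map fun n =>
      (((ω.take i)[n]?).elim 0 fun r => r.2.1, ((ω.take i)[n]?).elim (0 : ℝ) fun r => (r.2.2 : ℝ)))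
    = (List.range i).map fun n =>
      ((ω[n]?).elim 0 fun r => r.2.1, (ω[n]?).elim (0 : ℝ) fun r => (r.2.2 : ℝ)) := by
  refine List.map_congr_left fun n hn => ?_
  have := List.mem_range.mp hn
  simp [this]

theorem pexp_ite_eq {α : Type} [DecidableEq α] (p : PMF α) (b : α) (c : ℝ≥0∞) :
    pexp p (fun a => if a = b then c else 0) = p b * c := by
  unfold pexp
  rw [tsum_eq_single b]
  · simp
  · intro a ha; simp [ha]

theorem toReal_mem_Icc {α : Type} (p : PMF α) (b : α) : (p b).toReal ∈ Set.Icc (0 : ℝ) 1 :=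
  ⟨ENNReal.toReal_nonneg, ENNReal.toReal_le_of_le_ofReal zero_le_one
    (by simpa using p.coe_le_one b)⟩

/-- The interaction with a Markovian adversary as a bandit run. -/
def envBanditRun (alg : BanditAlg B) (κ : Z → Fin B → PMF (unitInterval × Z)) (t : ℕ) (z₀ : Z) :
    @BanditRun B _ alg t (List (Round Z B)) ⊤ (@PMF.toMeasure _ ⊤ (envRun alg κ t [] z₀)) :=
  letI : MeasurableSpace (List (Round Z B)) := ⊤
  { ℱ := runFiltration Z B
    -- The sample space contains lists of every length; rounds that are missing get the value 0. The
    -- loss is known before the action, because `runInfo i` contains the state of the adversary in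
    -- round `i`.
    loss := fun i ω b => (ω[i]?).elim 0 fun r => meanLoss κ r.1 b
    act := fun i ω => (ω[i]?).elim 0 fun r => r.2.1
    fb := fun i ω => (ω[i]?).elim 0 fun r => r.2.2
    loss_mem := by
      intro i ω b
      rcases ω[i]? with _ | r
      · simp
      · exact meanLoss_mem κ r.1 b
    fb_mem := by
      intro i ω
      rcases ω[i]? with _ | r
      · simp
      · exact r.2.2.2
    loss_meas := by
      intro i _ b
      refine measurable_runFiltration i (fun p => p.2.elim 0 fun z => meanLoss κ z b) fun ω => ?_
      simp only [runInfo]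
      rcases ω[i]? with _ | r <;> rfl
    act_meas := by
      intro i _
      refine measurable_runFiltration (i + 1) (fun p => (p.1[i]?).elim 0 fun r => r.2.1) fun ω => ?_
      simp [runInfo]
    fb_meas := by
      intro i _
      refine measurable_runFiltration (i + 1) (fun p => (p.1[i]?).elim 0 fun r => (r.2.2 : ℝ))
        fun ω => ?_
      simp [runInfo]
    act_law := by
      intro i hi b
      refine condExp_envRun alg κ t z₀ i hi _ _ ?_ (fun ω => toReal_mem_Icc _ _)
        (fun o => if (o.elim 0 fun r => r.2.1) = b then 1 else 0) ?_
        (fun p => (alg.strategy ((List.range i).map fun n => ((p.1[n]?).elim 0 fun r => r.2.1,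
          (p.1[n]?).elim (0 : ℝ) fun r => (r.2.2 : ℝ))) b).toReal) ?_ ?_
      · intro ω
        by_cases h : ((ω[i]?).elim 0 fun r => r.2.1) = b <;> simp [Set.indicator, h]
      · intro ω; simp [Set.indicator]
      · intro ω
        simp only [runInfo, map_range_take]
      · intro l z hl
        subst hl
        rw [← feedbacks_eq_map_range, ENNReal.ofReal_toReal (PMF.apply_ne_top _ _)]
        have := pexp_ite_eq (alg.strategy (feedbacks l)) b 1
        rw [mul_one] at this
        rw [← this]
        congr 1; funext b'
        by_cases h : b' = b <;> simp [h, pexp_const]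
    fb_mean := by
      intro i hi b
      refine condExp_envRun alg κ t z₀ i hi _ _ ?_ ?_
        (fun o => if (o.elim 0 fun r => r.2.1) = b then o.elim 0 fun r => (r.2.2 : ℝ) else 0) ?_
        (fun p => (alg.strategy ((List.range i).map fun n => ((p.1[n]?).elim 0 fun r => r.2.1,
          (p.1[n]?).elim (0 : ℝ) fun r => (r.2.2 : ℝ))) b).toReal
            * p.2.elim 0 fun z => meanLoss κ z b) ?_ ?_
      · intro ω
        by_cases h : ((ω[i]?).elim 0 fun r => r.2.1) = b
        · rw [Set.indicator_of_mem (by exact h)]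
          rcases ω[i]? with _ | r
          · simp
          · exact r.2.2.2
        · rw [Set.indicator_of_notMem (by exact h)]
          simp
      · intro ω
        rcases ω[i]? with _ | r
        · simp
        · exact unitInterval.mul_mem (toReal_mem_Icc _ _) (meanLoss_mem κ r.1 b)
      · intro ω; simp [Set.indicator]
      · intro ω
        simp only [runInfo, map_range_take]
        rcases ω[i]? with _ | r <;> rfl
      · intro l z hl
        subst hl
        rw [← feedbacks_eq_map_range, ENNReal.ofReal_mul ENNReal.toReal_nonneg,
          ENNReal.ofReal_toReal (PMF.apply_ne_top _ _)]
        simp only [Option.elim]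
        rw [ofReal_meanLoss, ← pexp_ite_eq]
        congr 1; funext b'
        by_cases h : b' = b
        · subst h; simp
        · simp [h, pexp_const] }

theorem envBanditRun_swapRegret (alg : BanditAlg B) (κ : Z → Fin B → PMF (unitInterval × Z))
    (H t : ℕ) (z₀ : Z) (ψ : Fin B → Fin B) (ω : List (Round Z B)) (hω : ω.length = t) :
    @BanditRun.swapRegret B _ alg t _ ⊤ _ (envBanditRun alg κ t z₀) H ψ ω
      = runRegret alg κ H ψ ω := by
  subst hω
  let _ : MeasurableSpace (List (Round Z B)) := ⊤
  have hθ : ∀ i < ω.length,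
      @BanditRun.theta B _ alg ω.length _ ⊤ _ (envBanditRun alg κ ω.length z₀) i ω
        = alg.strategy (feedbacks (ω.take i)) := by
    intro i hi
    unfold BanditRun.theta
    rw [feedbacks_eq_map_range, List.length_take, min_eq_left hi.le, map_range_take]
    rfl
  unfold BanditRun.swapRegret runRegret wavg
  rw [sum_fin_cast (n := ω.length) (by rw [splits_length]), ← Fin.sum_univ_eq_sum_range
    (fun i => lrW H ω.length (i + 1) * _) ω.length]
  refine Finset.sum_congr rfl fun i _ => ?_
  have hl : ∀ b, (envBanditRun alg κ ω.length z₀).loss i ω b = meanLoss κ (ω.get i).1 b := by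
    intro b
    change ((ω[(i : ℕ)]?).elim 0 fun r => meanLoss κ r.1 b) = _
    rw [List.getElem?_eq_getElem i.2]; rfl
  rw [hθ i i.2]
  simp only [hl]
  rw [show ∑ b, ((alg.strategy (feedbacks (ω.take i))).map ψ b).toReal
      * meanLoss κ (ω.get i).1 b = rexp (alg.strategy (feedbacks (ω.take i)))
        (fun b => meanLoss κ (ω.get i).1 (ψ b)) from rexp_map _ _ _]
  simp only [splits, rexp, List.get_eq_getElem, List.length_ofFn, List.getElem_ofFn]
  rfl

/-- A regret guarantee against all adversaries applies to Markovian adversaries. -/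
theorem MeetsSwapRegret.envRun_le {H : ℕ} {alg : ∀ (B : ℕ) [NeZero B], BanditAlg B}
    {ξ : ℕ → ℕ → ℝ → ℝ} {Ξ : ℕ → ℝ → ℝ → ℝ} (h : MeetsSwapRegret H alg ξ Ξ)
    (κ : Z → Fin B → PMF (unitInterval × Z)) {t : ℕ} (ht : 1 ≤ t) (z₀ : Z) {δ : ℝ} (h0 : 0 < δ)
    (h1 : δ < 1) :
    (envRun (alg B) κ t [] z₀).toOuterMeasure
      {ω | ∃ ψ, ξ B t (Real.log (1 / δ)) < runRegret (alg B) κ H ψ ω} ≤ ENNReal.ofReal δ := by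
  let _ : MeasurableSpace (List (Round Z B)) := ⊤
  have key := h.regret B t δ ht h0 h1 _ (envRun (alg B) κ t [] z₀).toMeasure
    (envBanditRun (alg B) κ t z₀)
  have e : (envRun (alg B) κ t [] z₀).toOuterMeasure
      {ω | ∃ ψ, ξ B t (Real.log (1 / δ)) < runRegret (alg B) κ H ψ ω}
      = (envRun (alg B) κ t [] z₀).toMeasure {ω | ∀ ψ : Fin B → Fin B,
        (envBanditRun (alg B) κ t z₀).swapRegret H ψ ω ≤ ξ B t (Real.log (1 / δ))}ᶜ := by
    rw [PMF.toMeasure_apply_eq_toOuterMeasure_apply _ MeasurableSpace.measurableSet_top]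
    refine PMF.toOuterMeasure_apply_eq_of_inter_support_eq _ ?_
    ext ω
    simp only [Set.mem_inter_iff, Set.mem_ofPred_eq, Set.mem_compl_iff, not_forall, not_le]
    -- The two expressions of the regret agree only on lists of length `t`, that is, on the support.
    refine and_congr_left fun hω => exists_congr fun ψ => ?_
    rw [envBanditRun_swapRegret _ _ _ _ _ _ _ (by simpa using (prefix_of_mem_support_envRun hω).2)]
  rw [e, prob_compl_eq_one_sub MeasurableSpace.measurableSet_top]
  refine tsub_le_iff_right.mpr ?_
  refine le_trans ?_ (add_le_add_right key _)
  rw [← ENNReal.ofReal_add h0.le (by linarith)]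
  simp

/-- The identity map has regret 0, so a negative bound would be violated on every trajectory, with
probability $1>\delta$. -/
theorem MeetsSwapRegret.nonneg {H : ℕ} {alg : ∀ (B : ℕ) [NeZero B], BanditAlg B}
    {ξ : ℕ → ℕ → ℝ → ℝ} {Ξ : ℕ → ℝ → ℝ → ℝ} (h : MeetsSwapRegret H alg ξ Ξ) {B : ℕ} [NeZero B]
    {t : ℕ} (ht : 1 ≤ t) {δ : ℝ} (h0 : 0 < δ) (h1 : δ < 1) : 0 ≤ ξ B t (Real.log (1 / δ)) := by
  by_contra! hneg
  have key := h.envRun_le (B := B) (Z := Unit) (fun _ _ => PMF.pure (0, ())) ht () h0 h1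
  have e : {ω : List (Round Unit B) | ∃ ψ, ξ B t (Real.log (1 / δ))
      < runRegret (alg B) (fun _ _ => PMF.pure (0, ())) H ψ ω} = Set.univ := by
    refine Set.eq_univ_of_forall fun ω => ⟨id, ?_⟩
    simpa [runRegret, wavg] using hneg
  rw [e, toOuterMeasure_eq_pexp] at key
  simp only [Set.indicator_univ, pexp_const] at key
  rw [ENNReal.one_le_ofReal] at key
  linarith

end envRun

/-! ## Training as a process of single steps -/

section training
variable {m H S K : ℕ} {A : Fin m → ℕ}

/-- The state in which step `h` is taken after the record `T`. -/
def curState (G : MarkovGame m H S A) (T : List (Visit H S K A)) (h : Fin H) : Fin S :=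
  if (h : ℕ) = 0 then G.s₁ else (T.getLast?).elim G.s₁ Visit.nxt

/-- The joint action and the next state when `a ∼ p`. -/
def outcome (G : MarkovGame m H S A) (h : Fin H) (s : Fin S) (p : PMF (∀ j, Fin (A j))) :
    PMF ((∀ j, Fin (A j)) × Fin S) :=
  p.bind fun a => (G.P h s a).map fun s' => (a, s')

variable [∀ j, NeZero (A j)]

/-- The law of the joint action and the next state at a visit of `(h, s)` after the record `T`. -/
def outLaw (G : MarkovGame m H S A) (alg : ∀ (B : ℕ) [NeZero B], BanditAlg B)
    (β : Fin m → ℕ → ℝ) (T : List (Visit H S K A)) (h : Fin H) (s : Fin S) :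
    PMF ((∀ j, Fin (A j)) × Fin S) :=
  outcome G h s (pmfPi fun j => currentPolicy G alg β T j h s)

/-- The law of the next visit. -/
def stepLaw (G : MarkovGame m H S A) (alg : ∀ (B : ℕ) [NeZero B], BanditAlg B)
    (β : Fin m → ℕ → ℝ) (T : List (Visit H S K A)) (x : Fin K × Fin H) : PMF (Visit H S K A) :=
  (outLaw G alg β T x.2 (curState G T x.2)).map fun y =>
    { ep := x.1, step := x.2, st := curState G T x.2, act := y.1, nxt := y.2 }

/-- The law of the record after the steps `xs`, starting from the record `T`. -/
def runSteps (G : MarkovGame m H S A) (alg : ∀ (B : ℕ) [NeZero B], BanditAlg B)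
    (β : Fin m → ℕ → ℝ) : List (Fin K × Fin H) → List (Visit H S K A) → PMF (List (Visit H S K A))
  | [], T => PMF.pure T
  | x :: xs, T => (stepLaw G alg β T x).bind fun v => runSteps G alg β xs (T ++ [v])

/-- All steps of the training, in chronological order. -/
def allSteps (K H : ℕ) : List (Fin K × Fin H) :=
  (List.finRange K).flatMap fun k => (List.finRange H).map fun h => (k, h)

variable (G : MarkovGame m H S A) (alg : ∀ (B : ℕ) [NeZero B], BanditAlg B) (β : Fin m → ℕ → ℝ)

theorem runSteps_append (xs ys : List (Fin K × Fin H)) (T : List (Visit H S K A)) :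
    runSteps G alg β (xs ++ ys) T = (runSteps G alg β xs T).bind (runSteps G alg β ys) := by
  induction xs generalizing T with
  | nil => simp [runSteps]
  | cons x xs ih => simp only [List.cons_append, runSteps, PMF.bind_bind, ih]

theorem trainStep_eq (k : Fin K) (h : Fin H) (T : List (Visit H S K A)) :
    trainStep G alg β k (T, curState G T h) h
      = (stepLaw G alg β T (k, h)).map fun v => (T ++ [v], v.nxt) := by
  unfold trainStep stepLaw outLaw outcome
  simp only [PMF.map_bind, PMF.map_comp]
  rfl

/-- The state carried along the fold is redundant: it is the end of the last recorded visit. Step 0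
is excluded because there the game restarts from `G.s₁`. -/
theorem foldlM_trainStep (k : Fin K) (hs : List (Fin H)) (hs0 : ∀ h ∈ hs, (h : ℕ) ≠ 0)
    (T : List (Visit H S K A)) (v : Visit H S K A) :
    (hs.foldlM (trainStep G alg β k) (T ++ [v], v.nxt)).map Prod.fst
      = runSteps G alg β (hs.map fun h => (k, h)) (T ++ [v]) := by
  induction hs generalizing T v with
  | nil => exact PMF.pure_map _ _
  | cons h hs ih =>
    have hc : v.nxt = curState G (T ++ [v]) h := by
      simp [curState, hs0 h (by simp)]
    rw [List.foldlM_cons, List.map_cons, runSteps]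
    change ((trainStep G alg β k (T ++ [v], v.nxt) h).bind _).map Prod.fst = _
    rw [hc, trainStep_eq, PMF.bind_map, PMF.map_bind]
    congr 1; funext w
    exact ih (fun h' hh' => hs0 h' (by simp [hh'])) (T ++ [v]) w

theorem trainEpisode_eq [NeZero H] (T : List (Visit H S K A)) (k : Fin K) :
    trainEpisode G alg β T k
      = runSteps G alg β ((List.finRange H).map fun h => (k, h)) T := by
  obtain ⟨n, rfl⟩ : ∃ n, H = n + 1 := ⟨H - 1, by have := NeZero.pos H; omega⟩
  unfold trainEpisode
  rw [List.finRange_succ, List.foldlM_cons, List.map_cons, runSteps]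
  change ((trainStep G alg β k (T, G.s₁) 0).bind _).map Prod.fst = _
  have hc : G.s₁ = curState G T 0 := by simp [curState]
  rw [hc, trainStep_eq, PMF.bind_map, PMF.map_bind]
  congr 1; funext w
  refine foldlM_trainStep G alg β k _ ?_ T w
  intro h hh
  obtain ⟨i, _, rfl⟩ := List.mem_map.mp hh
  simp

theorem trainLaw_eq [NeZero H] : trainLaw K G alg β = runSteps G alg β (allSteps K H) [] := by
  unfold trainLaw allSteps
  generalize ([] : List (Visit H S K A)) = T
  induction List.finRange K generalizing T with
  | nil => rfl
  | cons k ks ih =>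
    rw [List.foldlM_cons, List.flatMap_cons, runSteps_append]
    change (trainEpisode G alg β T k).bind _ = _
    rw [trainEpisode_eq]
    congr 1; funext T'
    exact ih T'

/-- Supermartingales do not increase in the mean. The one-step inequality is demanded for all
records, reachable or not, so functions of the record have to be bounded everywhere. -/
theorem pexp_runSteps_le (Φ : List (Visit H S K A) → ℝ≥0∞)
    (hΦ : ∀ T x, pexp (stepLaw G alg β T x) (fun v => Φ (T ++ [v])) ≤ Φ T)
    (xs : List (Fin K × Fin H)) (T : List (Visit H S K A)) :
    pexp (runSteps G alg β xs T) Φ ≤ Φ T := by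
  induction xs generalizing T with
  | nil => rw [runSteps, pexp_pure]
  | cons x xs ih =>
    rw [runSteps, pexp_bind]
    exact (pexp_mono fun v => ih (T ++ [v])).trans (hΦ T x)

theorem prefix_of_mem_support_runSteps {xs : List (Fin K × Fin H)} {T T' : List (Visit H S K A)}
    (h : T' ∈ (runSteps G alg β xs T).support) : T <+: T' := by
  induction xs generalizing T with
  | nil =>
    simp only [runSteps, PMF.support_pure, Set.mem_singleton_iff] at h
    subst h; exact List.prefix_rfl
  | cons x xs ih =>
    simp only [runSteps, PMF.support_bind, Set.mem_iUnion] at h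
    obtain ⟨v, _, h⟩ := h
    exact (List.prefix_append _ _).trans (ih h)

/-- The record consists of the steps `xs`, and every visit starts where the last one ended. -/
def IsRecord (G : MarkovGame m H S A) (xs : List (Fin K × Fin H)) (T : List (Visit H S K A)) :
    Prop :=
  T.map (fun v => (v.ep, v.step)) = xs ∧
    ∀ l v r, T = l ++ v :: r → v.st = curState G l v.step

theorem isRecord_of_mem_support_runSteps {xs ys : List (Fin K × Fin H)}
    {T T' : List (Visit H S K A)} (hT : IsRecord G ys T)
    (h : T' ∈ (runSteps G alg β xs T).support) : IsRecord G (ys ++ xs) T' := by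
  induction xs generalizing T ys with
  | nil =>
    simp only [runSteps, PMF.support_pure, Set.mem_singleton_iff] at h
    subst h; simpa using hT
  | cons x xs ih =>
    simp only [runSteps, PMF.support_bind, Set.mem_iUnion] at h
    obtain ⟨v, hv, h⟩ := h
    have hv' : (v.ep, v.step) = x ∧ v.st = curState G T v.step := by
      simp only [stepLaw, PMF.support_map, Set.mem_image] at hv
      obtain ⟨y, _, rfl⟩ := hv
      exact ⟨rfl, rfl⟩
    rw [List.append_cons]
    refine ih ⟨by simp [hT.1, hv'.1], ?_⟩ h
    intro l w r hl
    -- Either the visit `w` is the newly appended one, or the split already takes place inside the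
    -- old record.
    rcases List.eq_nil_or_concat r with rfl | ⟨r', u, rfl⟩
    · obtain ⟨rfl, hw⟩ := List.append_inj' hl rfl
      simp only [List.cons.injEq, and_true] at hw
      subst hw; exact hv'.2
    · rw [List.concat_eq_append, ← List.cons_append, ← List.append_assoc] at hl
      exact hT.2 l w r' (List.append_inj' hl rfl).1

theorem isRecord_of_mem_support_trainLaw [NeZero H] {T : List (Visit H S K A)}
    (h : T ∈ (trainLaw K G alg β).support) : IsRecord G (allSteps K H) T := by
  rw [trainLaw_eq] at h
  refine isRecord_of_mem_support_runSteps G alg β (ys := []) ⟨rfl, ?_⟩ h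
  intro l v r hl
  simp at hl

/-- Strict chronological order of steps. -/
def chrono (x y : Fin K × Fin H) : Prop := x.1 < y.1 ∨ (x.1 = y.1 ∧ x.2 < y.2)

theorem allSteps_pairwise (K H : ℕ) : (allSteps K H).Pairwise chrono := by
  unfold allSteps
  rw [List.pairwise_flatMap]
  refine ⟨fun k _ => ?_, ?_⟩
  · rw [List.pairwise_map]
    exact (List.pairwise_lt_finRange H).imp fun h => Or.inr ⟨rfl, h⟩
  · refine (List.pairwise_lt_finRange K).imp fun {a b} h x hx y hy => ?_
    obtain ⟨i, _, rfl⟩ := List.mem_map.mp hx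
    obtain ⟨i', _, rfl⟩ := List.mem_map.mp hy
    exact Or.inl h

/-! ## The memory of a learner in terms of the visits -/

/-- The visits of `(h, s)`, each with the record before it. -/
def hits (T : List (Visit H S K A)) (h : Fin H) (s : Fin S) :
    List (List (Visit H S K A) × Visit H S K A) :=
  (splits T).filter fun p => p.2.step = h ∧ p.2.st = s

end training

section learner
variable {m H S K : ℕ} {A : Fin m → ℕ}

theorem hits_nil (h : Fin H) (s : Fin S) : hits ([] : List (Visit H S K A)) h s = [] := by
  simp [hits, splits_nil]

theorem hits_snoc (T : List (Visit H S K A)) (v : Visit H S K A) (h : Fin H) (s : Fin S) :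
    hits (T ++ [v]) h s = hits T h s ++ if v.step = h ∧ v.st = s then [(T, v)] else [] := by
  unfold hits
  rw [splits_snoc, List.filter_append]
  by_cases hv : v.step = h ∧ v.st = s
  · rw [if_pos hv]; simp [hv]
  · rw [if_neg hv]; simpa using hv

theorem hits_map_snd (T : List (Visit H S K A)) (h : Fin H) (s : Fin S) :
    (hits T h s).map Prod.snd = T.filter fun v => v.step = h ∧ v.st = s := by
  induction T using List.reverseRecOn with
  | nil => simp [hits_nil]
  | append_singleton T v ih =>
    rw [hits_snoc, List.map_append, ih, List.filter_append]
    by_cases hv : v.step = h ∧ v.st = s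
    · rw [if_pos hv]; simp [hv]
    · rw [if_neg hv]; simpa using hv

theorem hits_prefix {T T' : List (Visit H S K A)} (hT : T <+: T') (h : Fin H) (s : Fin S) :
    hits T h s <+: hits T' h s := by
  obtain ⟨r, rfl⟩ := hT
  induction r using List.reverseRecOn with
  | nil => simp
  | append_singleton r v ih =>
    rw [← List.append_assoc, hits_snoc]
    exact ih.trans (List.prefix_append _ _)

theorem mem_hits {T : List (Visit H S K A)} {h : Fin H} {s : Fin S}
    {p : List (Visit H S K A) × Visit H S K A} (hp : p ∈ hits T h s) :
    p.1 ++ [p.2] <+: T ∧ p.2.step = h ∧ p.2.st = s := by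
  induction T using List.reverseRecOn with
  | nil => simp [hits_nil] at hp
  | append_singleton T v ih =>
    rw [hits_snoc, List.mem_append] at hp
    rcases hp with hp | hp
    · exact ⟨(ih hp).1.trans (List.prefix_append _ _), (ih hp).2⟩
    · by_cases hv : v.step = h ∧ v.st = s
      · rw [if_pos hv, List.mem_singleton] at hp
        subst hp
        exact ⟨List.prefix_rfl, hv⟩
      · rw [if_neg hv] at hp
        simp at hp

/-- Consequently the data of the bandit of $(h,s)$ at a visit come from exactly the preceding visits
of $(h,s)$. -/
theorem hits_getElem_fst (T : List (Visit H S K A)) (h : Fin H) (s : Fin S) (i : ℕ)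
    (hi : i < (hits T h s).length) :
    hits ((hits T h s)[i]).1 h s = (hits T h s).take i := by
  induction T using List.reverseRecOn with
  | nil => simp [hits_nil] at hi
  | append_singleton T v ih =>
    by_cases hv : v.step = h ∧ v.st = s
    · have e : hits (T ++ [v]) h s = hits T h s ++ [(T, v)] := by rw [hits_snoc, if_pos hv]
      simp only [e] at hi ⊢
      rw [List.length_append, List.length_singleton] at hi
      rcases Nat.lt_succ_iff_lt_or_eq.mp hi with hi' | rfl
      · simp only [List.getElem_append_left hi', List.take_append_of_le_length hi'.le]
        exact ih hi'
      · simp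
    · have e : hits (T ++ [v]) h s = hits T h s := by rw [hits_snoc, if_neg hv, List.append_nil]
      simp only [e] at hi ⊢
      exact ih hi

theorem setAt_apply {α β γ : Type} [DecidableEq α] [DecidableEq β] (f : α → β → γ) (x : α) (y : β)
    (v : γ) (x' : α) (y' : β) : setAt f x y v x' y' = if x = x' ∧ y = y' then v else f x' y' := by
  unfold setAt
  by_cases hx : x = x'
  · subst hx
    by_cases hy : y = y'
    · subst hy; simp
    · simp [Function.update_of_ne (Ne.symm hy), hy]
  · simp [Function.update_of_ne (Ne.symm hx), hx]

variable (G : MarkovGame m H S A) (β : Fin m → ℕ → ℝ)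

theorem learner_snoc (T : List (Visit H S K A)) (v : Visit H S K A) (j : Fin m) :
    learner G β (T ++ [v]) j = (learner G β T j).update (β j) v.step v.st (v.act j)
      (G.r j v.step v.st v.act) v.nxt := by
  simp [learner, List.foldl_append]

/-- The value `V_{h+1}(s)` of player `j` after the record `T`, at the level above step `h`. -/
def nextV (T : List (Visit H S K A)) (j : Fin m) (h : Fin H) (s : Fin S) : ℝ :=
  (learner G β T j).V h.succ s

theorem learner_N (T : List (Visit H S K A)) (j : Fin m) (h : Fin H) (s : Fin S) :
    (learner G β T j).N h s = (hits T h s).length := by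
  induction T using List.reverseRecOn with
  | nil => simp [learner, Learner.start, hits_nil]
  | append_singleton T v ih =>
    rw [learner_snoc, hits_snoc]
    simp only [Learner.update, setAt_apply]
    by_cases hv : v.step = h ∧ v.st = s
    · obtain ⟨rfl, rfl⟩ := hv
      simp [ih]
    · simp [hv, ih]

theorem learner_log (T : List (Visit H S K A)) (j : Fin m) (h : Fin H) (s : Fin S) :
    (learner G β T j).log h s = (hits T h s).map fun p =>
      (p.2.act j, ((H : ℝ) - G.r j h s p.2.act - nextV G β p.1 j h p.2.nxt) / H) := by
  induction T using List.reverseRecOn with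
  | nil => simp [learner, Learner.start, hits_nil]
  | append_singleton T v ih =>
    rw [learner_snoc, hits_snoc]
    simp only [Learner.update, setAt_apply]
    by_cases hv : v.step = h ∧ v.st = s
    · obtain ⟨rfl, rfl⟩ := hv
      simp [ih, nextV]
    · simp [hv, ih]

/-- The update unrolled. The initial value leaves no trace, since $\alpha_1=1$; hence at least one
visit is assumed. -/
theorem learner_Vt (T : List (Visit H S K A)) (j : Fin m) (h : Fin H) (s : Fin S)
    (hT : hits T h s ≠ []) :
    (learner G β T j).Vt h s
      = wavg H (hits T h s) (fun p => G.r j h s p.2.act + nextV G β p.1 j h p.2.nxt)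
        + ∑ i ∈ Finset.Icc 1 (hits T h s).length, lrW H (hits T h s).length i * β j i := by
  induction T using List.reverseRecOn with
  | nil => simp [hits_nil] at hT
  | append_singleton T v ih =>
    by_cases hv : v.step = h ∧ v.st = s
    · obtain ⟨rfl, rfl⟩ := hv
      have e : hits (T ++ [v]) v.step v.st = hits T v.step v.st ++ [(T, v)] := by
        rw [hits_snoc, if_pos ⟨rfl, rfl⟩]
      rw [e, learner_snoc, wavg_snoc]
      simp only [Learner.update, setAt_apply, and_self, if_true, learner_N, List.length_append,
        List.length_singleton]
      rw [Finset.sum_Icc_succ_top (by omega), lrW_self]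
      have e2 : ∑ i ∈ Finset.Icc 1 (hits T v.step v.st).length,
          lrW H ((hits T v.step v.st).length + 1) i * β j i
          = (1 - lr H ((hits T v.step v.st).length + 1)) *
            ∑ i ∈ Finset.Icc 1 (hits T v.step v.st).length,
              lrW H (hits T v.step v.st).length i * β j i := by
        rw [Finset.mul_sum]
        refine Finset.sum_congr rfl fun i hi => ?_
        rw [lrW_succ (Finset.mem_Icc.mp hi).2]; ring
      rw [e2]
      by_cases h0 : hits T v.step v.st = []
      · simp [h0, wavg_nil, lr_one, nextV, add_assoc]
      · rw [ih h0]
        simp only [nextV]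
        ring
    · have e : hits (T ++ [v]) h s = hits T h s := by rw [hits_snoc, if_neg hv, List.append_nil]
      rw [e] at hT ⊢
      rw [← ih hT, learner_snoc]
      simp [Learner.update, setAt_apply, hv]

theorem learner_V_last (T : List (Visit H S K A)) (j : Fin m) (s : Fin S) :
    (learner G β T j).V (Fin.last H) s = 0 := by
  induction T using List.reverseRecOn with
  | nil => simp [learner, Learner.start]
  | append_singleton T v ih =>
    rw [learner_snoc]
    simp only [Learner.update, setAt_apply]
    rw [if_neg (fun h => (Fin.castSucc_lt_last v.step).ne h.1), ih]

theorem learner_V (T : List (Visit H S K A)) (j : Fin m) (h : Fin H) (s : Fin S) :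
    (learner G β T j).V h.castSucc s
      = if hits T h s = [] then (H : ℝ) - (h : ℕ)
        else min ((H : ℝ) - (h : ℕ)) ((learner G β T j).Vt h s) := by
  induction T using List.reverseRecOn with
  | nil => simp [learner, Learner.start, hits_nil]
  | append_singleton T v ih =>
    by_cases hv : v.step = h ∧ v.st = s
    · obtain ⟨rfl, rfl⟩ := hv
      have e : hits (T ++ [v]) v.step v.st = hits T v.step v.st ++ [(T, v)] := by
        rw [hits_snoc, if_pos ⟨rfl, rfl⟩]
      rw [e, if_neg (by simp), learner_snoc]
      simp [Learner.update, setAt_apply]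
    · rw [hits_snoc, if_neg hv, List.append_nil, learner_snoc]
      simp only [Learner.update, setAt_apply, if_neg hv]
      rw [if_neg (fun h' => hv ⟨Fin.castSucc_injective _ h'.1, h'.2⟩)]
      exact ih

/-- Visits at other levels do not change the value at a level. -/
theorem learner_V_append (T r : List (Visit H S K A)) (j : Fin m) (q : Fin (H + 1)) (s : Fin S)
    (hr : ∀ v ∈ r, v.step.castSucc ≠ q) :
    (learner G β (T ++ r) j).V q s = (learner G β T j).V q s := by
  induction r using List.reverseRecOn with
  | nil => simp
  | append_singleton r v ih =>
    rw [← List.append_assoc, learner_snoc]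
    simp only [Learner.update, setAt_apply]
    rw [if_neg (fun h => hr v (by simp) h.1), ih fun w hw => hr w (by simp [hw])]

theorem learner_log_append (T r : List (Visit H S K A)) (j : Fin m) (h : Fin H) (s : Fin S)
    (hr : ∀ v ∈ r, v.step ≠ h) :
    (learner G β (T ++ r) j).log h s = (learner G β T j).log h s := by
  induction r using List.reverseRecOn with
  | nil => simp
  | append_singleton r v ih =>
    rw [← List.append_assoc, learner_snoc]
    simp only [Learner.update, setAt_apply]
    rw [if_neg (fun h => hr v (by simp) h.1), ih fun w hw => hr w (by simp [hw])]

/-- The record is in chronological order. -/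
def Chronological (T : List (Visit H S K A)) : Prop :=
  T.Pairwise fun v w => chrono (v.ep, v.step) (w.ep, w.step)

theorem Chronological.of_prefix {T T' : List (Visit H S K A)} (h : Chronological T') (hT : T <+: T') :
    Chronological T := List.Pairwise.sublist hT.sublist h

theorem IsRecord.chronological {G : MarkovGame m H S A} {T : List (Visit H S K A)}
    (h : IsRecord G (allSteps K H) T) : Chronological T := by
  have := allSteps_pairwise K H
  rw [← h.1, List.pairwise_map] at this
  exact this

/-- An episode contains the step `h` at most once, so the visits lie in distinct episodes. -/
theorem Chronological.length_hits_le {T : List (Visit H S K A)} (hT : Chronological T) (h : Fin H)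
    (s : Fin S) : (hits T h s).length ≤ K := by
  have h1 : (T.filter fun v => v.step = h ∧ v.st = s).Pairwise fun v w => v.ep ≠ w.ep := by
    refine List.Pairwise.imp_of_mem ?_ (hT.sublist List.filter_sublist)
    intro v w hv hw hvw
    have hv' := (List.mem_filter.mp hv).2
    have hw' := (List.mem_filter.mp hw).2
    simp only [decide_eq_true_eq] at hv' hw'
    rcases hvw with hlt | ⟨_, hlt⟩
    · exact ne_of_lt hlt
    · simp only [hv'.1, hw'.1, lt_self_iff_false] at hlt
  have h2 : ((T.filter fun v => v.step = h ∧ v.st = s).map Visit.ep).Nodup :=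
    List.pairwise_map.mpr h1
  have h3 := h2.length_le_card
  rwa [List.length_map, Fintype.card_fin, ← hits_map_snd, List.length_map] at h3

variable {G β}

/-- Single bonuses may be negative; only their weighted sums enter, and only for $t\le K$, which is
where chronological order is used. The induction is on the length of the record, since an estimate
is built from estimates at earlier times. -/
theorem learner_V_mem (hβ : ∀ j t, 1 ≤ t → t ≤ K → 0 ≤ ∑ i ∈ Finset.Icc 1 t, lrW H t i * β j i)
    {T : List (Visit H S K A)} (hT : Chronological T) (j : Fin m) (q : Fin (H + 1)) (s : Fin S) :
    (learner G β T j).V q s ∈ Set.Icc (0 : ℝ) ((H : ℝ) - (q : ℕ)) := by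
  induction hn : T.length using Nat.strong_induction_on generalizing T q s with
  | _ n ih =>
    induction q using Fin.lastCases with
    | last => rw [learner_V_last]; simp
    | cast h =>
      have hh : ((h : ℕ) : ℝ) ≤ H := by exact_mod_cast h.2.le
      rw [learner_V]
      by_cases h0 : hits T h s = []
      · rw [if_pos h0]; simp [hh]
      · rw [if_neg h0]
        refine ⟨le_min (by linarith) ?_, min_le_left _ _⟩
        rw [learner_Vt G β T j h s h0]
        refine add_nonneg (wavg_nonneg fun p hp => ?_)
          (hβ j _ (List.length_pos_iff.mpr h0) (hT.length_hits_le h s))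
        have hp' := (mem_hits hp).1
        refine add_nonneg (G.r_mem _ _ _ _).1 ?_
        refine (ih p.1.length ?_ (hT.of_prefix ((List.prefix_append _ _).trans hp')) _ _ rfl).1
        have := hp'.length_le
        simp at this; omega

end learner

/-! ## Concentration along the visits of one state -/

theorem prefixSum_take {γ : Type} (f : ℕ → γ → ℝ) (t : ℕ) (L : List γ) :
    prefixSum (fun p x => if p.length < t then f p.length x else 0) L
      = ∑ i : Fin (L.take t).length, f i ((L.take t).get i) := by
  induction L using List.reverseRecOn with
  | nil =>
    rw [prefixSum_nil]
    exact (Finset.sum_eq_zero fun i _ => absurd i.2 (by simp)).symm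
  | append_singleton L x ih =>
    rw [prefixSum_snoc, ih]
    rcases Nat.lt_or_ge L.length t with h | h
    · have e1 : (L ++ [x]).take t = L ++ [x] := List.take_of_length_le (by simp; omega)
      have e2 : L.take t = L := List.take_of_length_le h.le
      rw [if_pos h, e1, e2, sum_fin_cast (n := L.length + 1) (m := (L ++ [x]).length) (by simp),
        Fin.sum_univ_castSucc]
      congr 1
      · refine Finset.sum_congr rfl fun i _ => ?_
        have := i.2
        simp only [List.get_eq_getElem, Fin.val_cast, Fin.val_castSucc]
        rw [List.getElem_append_left]
      · simp
    · rw [if_neg (by omega), add_zero, List.take_append_of_le_length h]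

/-- A compensated deviation at the entry `x` after the entries `p`. -/
def compDev {γ : Type} (H t : ℕ) (c d : ℝ) (f : γ → ℝ) (p : List γ) (x : γ) : ℝ :=
  if p.length < t then c * (lrW H t (p.length + 1) * f x) - d * lrW H t (p.length + 1) ^ 2 else 0

theorem prefixSum_compDev {γ : Type} (H t : ℕ) (L : List γ) (ht : t ≤ L.length) (c d : ℝ)
    (f : γ → ℝ) :
    prefixSum (compDev H t c d f) L
      = c * wavg H (L.take t) f - d * ∑ i ∈ Finset.range t, lrW H t (i + 1) ^ 2 := by
  have hl : (L.take t).length = t := by simp [ht]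
  refine (prefixSum_take (fun n x => c * (lrW H t (n + 1) * f x) - d * lrW H t (n + 1) ^ 2)
    t L).trans ?_
  rw [Finset.sum_sub_distrib]
  congr 1
  · rw [wavg, Finset.mul_sum]
    simp only [hl]
  · rw [Finset.mul_sum, ← Fin.sum_univ_eq_sum_range (fun i => d * lrW H t (i + 1) ^ 2) t,
      sum_fin_cast hl]
    rfl

/-- `exp_le_add_exp_sq` for the centered variable, whose linear term has mean zero and whose square
is at most $(cM)^2$. -/
theorem rexp_exp_le {α : Type} [Fintype α] (p : PMF α) (g : α → ℝ) {M : ℝ}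
    (hg : ∀ a, g a ∈ Set.Icc 0 M) (c : ℝ) :
    rexp p (fun a => Real.exp (c * (rexp p g - g a) - (c * M) ^ 2)) ≤ 1 := by
  have hE : rexp p g ∈ Set.Icc 0 M := ⟨rexp_nonneg fun a => (hg a).1, rexp_le fun a => (hg a).2⟩
  have h1 : ∀ a, Real.exp (c * (rexp p g - g a))
      ≤ c * (rexp p g - g a) + Real.exp ((c * M) ^ 2) := by
    intro a
    refine (exp_le_add_exp_sq _).trans (add_le_add_right (Real.exp_le_exp.mpr ?_) _)
    rw [mul_pow, mul_pow]
    refine mul_le_mul_of_nonneg_left ?_ (sq_nonneg c)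
    have := hg a
    exact sq_le_sq' (by linarith [this.2, hE.1]) (by linarith [this.1, hE.2])
  have h2 := rexp_mono (p := p) h1
  rw [rexp_add, rexp_const_mul, rexp_sub, rexp_const, rexp_const, sub_self, mul_zero,
    zero_add] at h2
  simp only [sub_eq_add_neg _ ((c * M) ^ 2), Real.exp_add, mul_comm _ (Real.exp (-(c * M) ^ 2)),
    rexp_const_mul]
  refine (mul_le_mul_of_nonneg_left h2 (Real.exp_pos _).le).trans ?_
  rw [← Real.exp_add, neg_add_cancel, Real.exp_zero]

section concentration
variable {m H S K : ℕ} {A : Fin m → ℕ} [∀ j, NeZero (A j)]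
  (G : MarkovGame m H S A) (alg : ∀ (B : ℕ) [NeZero B], BanditAlg B) (β : Fin m → ℕ → ℝ)

/-- The deviation of `g` at a visit of `(h, s)` from its conditional expectation. -/
def deviation (h : Fin H) (s : Fin S)
    (g : List (Visit H S K A) → Fin K → (∀ j, Fin (A j)) × Fin S → ℝ)
    (p : List (Visit H S K A) × Visit H S K A) : ℝ :=
  rexp (outLaw G alg β p.1 h s) (g p.1 p.2.ep) - g p.1 p.2.ep (p.2.act, p.2.nxt)

/-- The exponential of the compensated deviations along the first `t` visits of `(h, s)` is a
supermartingale. -/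
theorem pexp_exp_deviation_le (h : Fin H) (s : Fin S) (t : ℕ) {M : ℝ}
    (g : List (Visit H S K A) → Fin K → (∀ j, Fin (A j)) × Fin S → ℝ)
    (hg : ∀ T k y, g T k y ∈ Set.Icc 0 M) (c : ℝ) (xs : List (Fin K × Fin H)) :
    pexp (runSteps G alg β xs []) (fun T => ENNReal.ofReal (Real.exp
      (prefixSum (compDev H t c ((c * M) ^ 2) (deviation G alg β h s g)) (hits T h s)))) ≤ 1 := by
  refine (pexp_runSteps_le G alg β (fun T => ENNReal.ofReal (Real.exp
    (prefixSum (compDev H t c ((c * M) ^ 2) (deviation G alg β h s g)) (hits T h s))))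
    ?_ xs []).trans ?_
  · rintro T ⟨k, h'⟩
    simp only [stepLaw, pexp_map]
    -- A visit elsewhere leaves `hits` unchanged. A visit of $(h,s)$ multiplies the process by a
    -- factor of conditional mean at most 1, and after `t` visits by 1.
    by_cases hv : h' = h ∧ curState G T h' = s
    · obtain ⟨rfl, rfl⟩ := hv
      simp only [hits_snoc, and_self, if_true, prefixSum_snoc, Real.exp_add]
      rw [pexp_ofReal _ fun y => by positivity, rexp_const_mul]
      refine ENNReal.ofReal_le_ofReal (mul_le_of_le_one_right (Real.exp_pos _).le ?_)
      unfold compDev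
      by_cases hl : (hits T h' (curState G T h')).length < t
      · simp only [hl, if_true]
        refine le_of_eq_of_le ?_ (rexp_exp_le (outLaw G alg β T h' (curState G T h')) (g T k)
          (hg T k) (c * lrW H t ((hits T h' (curState G T h')).length + 1)))
        congr 1; funext y
        congr 1
        simp only [deviation]
        ring
      · simp only [hl, if_false, Real.exp_zero, rexp_const, le_refl]
    · simp only [hits_snoc, hv, if_false, List.append_nil, pexp_const, le_refl]
  · simp [hits_nil, prefixSum_nil]

/-- Chernoff's method for the first `t` visits, with the number `t` fixed in advance; the training
may contain fewer visits, so reaching `t` is part of the event. -/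
theorem trainLaw_deviation_le [NeZero H] (h : Fin H) (s : Fin S) {t : ℕ} (ht : 1 ≤ t)
    (g : List (Visit H S K A) → Fin K → (∀ j, Fin (A j)) × Fin S → ℝ)
    (hg : ∀ T k y, g T k y ∈ Set.Icc (0 : ℝ) (2 * H)) {x : ℝ} (hx : 0 ≤ x) :
    (trainLaw K G alg β).toOuterMeasure {T | t ≤ (hits T h s).length ∧
      x < wavg H ((hits T h s).take t) (deviation G alg β h s g)}
      ≤ ENNReal.ofReal (Real.exp (-(x ^ 2 * t / (32 * H ^ 3)))) := by
  have hH : (0 : ℝ) < H := by exact_mod_cast NeZero.pos H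
  have hH1 : 1 ≤ H := NeZero.pos H
  have ht0 : (0 : ℝ) < t := by exact_mod_cast ht
  -- With range $2H$ and $\sum_i(\alpha_t^i)^2\le 2H/t$ the exponent is $cx-8H^3c^2/t$; this `c`
  -- maximizes it.
  set c : ℝ := x * t / (16 * H ^ 3) with hc
  have hc0 : 0 ≤ c := by positivity
  have key := pexp_exp_deviation_le G alg β h s t g hg c (allSteps K H)
  rw [← trainLaw_eq] at key
  have mk := (markov_pexp (trainLaw K G alg β) _
    (ENNReal.ofReal (Real.exp (x ^ 2 * t / (32 * H ^ 3))))).trans key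
  rw [Real.exp_neg, ENNReal.ofReal_inv_of_pos (Real.exp_pos _), ← one_div,
    ENNReal.le_div_iff_mul_le (Or.inl (by simp [Real.exp_pos])) (Or.inl ENNReal.ofReal_ne_top),
    mul_comm]
  refine le_trans (mul_le_mul_right (measure_mono ?_) _) mk
  rintro T ⟨hT, hxT⟩
  simp only [Set.mem_ofPred_eq]
  refine ENNReal.ofReal_le_ofReal (Real.exp_le_exp.mpr ?_)
  rw [prefixSum_compDev H t (hits T h s) hT]
  have h1 := mul_le_mul_of_nonneg_left hxT.le hc0
  have h2 := mul_le_mul_of_nonneg_left (sum_lrW_sq_le hH1 ht) (sq_nonneg (c * (2 * H)))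
  have h3 : c * x - (c * (2 * H)) ^ 2 * (2 * H / t) = x ^ 2 * t / (32 * H ^ 3) := by
    rw [hc]; field_simp; ring
  linarith

end concentration

/-! ## The visits of one state as a bandit problem -/

section transfer
variable {m H S K : ℕ} {A : Fin m → ℕ} [∀ j, NeZero (A j)]
  (G : MarkovGame m H S A) (alg : ∀ (B : ℕ) [NeZero B], BanditAlg B) (β : Fin m → ℕ → ℝ)

/-- The law of the joint action and the next state, given that player `j` takes action `b`. -/
def condOut (T : List (Visit H S K A)) (h : Fin H) (s : Fin S) (j : Fin m) (b : Fin (A j)) :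
    PMF ((∀ j, Fin (A j)) × Fin S) :=
  outcome G h s ((pmfPi fun i => currentPolicy G alg β T i h s).map fun a => Function.update a j b)

/-- The players act independently, so player `j` may draw first and face everything else as an
environment. -/
theorem outLaw_eq_bind_condOut (T : List (Visit H S K A)) (h : Fin H) (s : Fin S) (j : Fin m) :
    outLaw G alg β T h s
      = (currentPolicy G alg β T j h s).bind (condOut G alg β T h s j) := by
  unfold outLaw condOut
  conv_lhs => rw [pmfPi_eq_bind_update _ j]
  unfold outcome
  rw [PMF.bind_bind]

theorem act_eq_of_mem_support_condOut {T : List (Visit H S K A)} {h : Fin H} {s : Fin S} {j : Fin m}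
    {b : Fin (A j)} {y : (∀ j, Fin (A j)) × Fin S}
    (hy : y ∈ (condOut G alg β T h s j b).support) : y.1 j = b := by
  simp only [condOut, outcome, PMF.bind_map, PMF.support_bind, Set.mem_iUnion, PMF.support_map,
    Function.comp] at hy
  obtain ⟨a, _, s', _, rfl⟩ := hy
  simp

/-- The next visit of `(h, s)`: the record before it, its episode, and the steps after it. -/
def nextHit (h : Fin H) (s : Fin S) : List (Fin K × Fin H) → List (Visit H S K A) →
    PMF (Option (List (Visit H S K A) × Fin K × List (Fin K × Fin H)))
  | [], _ => PMF.pure none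
  | x :: xs, T =>
    if x.2 = h ∧ curState G T x.2 = s then PMF.pure (some (T, x.1, xs))
    else (stepLaw G alg β T x).bind fun v => nextHit h s xs (T ++ [v])

/-- The loss that player `j` feeds to the bandit algorithm, truncated to `[0, 1]`. -/
def lossAt (h : Fin H) (s : Fin S) (j : Fin m) (T : List (Visit H S K A))
    (y : (∀ j, Fin (A j)) × Fin S) : unitInterval :=
  Set.projIcc 0 1 zero_le_one (((H : ℝ) - G.r j h s y.1 - nextV G β T j h y.2) / H)

/-- The adversary that the bandit algorithm of player `j` at `(h, s)` faces. -/
def visitEnv (h : Fin H) (s : Fin S) (j : Fin m) :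
    Option (List (Visit H S K A) × Fin K × List (Fin K × Fin H)) → Fin (A j) →
      PMF (unitInterval × Option (List (Visit H S K A) × Fin K × List (Fin K × Fin H)))
  -- When no visit remains, the adversary idles with zero feedback, so that the bandit always
  -- completes its `t` rounds.
  | none, _ => PMF.pure (0, none)
  | some z, b => (condOut G alg β z.1 h s j b).bind fun y =>
      (nextHit G alg β h s z.2.2 (z.1 ++ [⟨z.2.1, h, s, y.1, y.2⟩])).map fun z' =>
        (lossAt G β h s j z.1 y, z')

/-- A visit of `(h, s)` corresponds to a round of the bandit. -/
def Matches (h : Fin H) (s : Fin S) (j : Fin m) (p : List (Visit H S K A) × Visit H S K A)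
    (r : Round (Option (List (Visit H S K A) × Fin K × List (Fin K × Fin H))) (A j)) : Prop :=
  (∃ w, r.1 = some (p.1, w)) ∧ r.2.1 = p.2.act j ∧
    r.2.2 = lossAt G β h s j p.1 (p.2.act, p.2.nxt)

variable {G β}

/-- The truncation is inactive on chronological records, where $V_{h+1}$ has the range given by
`learner_V_mem`. -/
theorem coe_lossAt {m H S K : ℕ} {A : Fin m → ℕ} {G : MarkovGame m H S A} {β : Fin m → ℕ → ℝ}
    (hβ : ∀ j t, 1 ≤ t → t ≤ K → 0 ≤ ∑ i ∈ Finset.Icc 1 t, lrW H t i * β j i)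
    {T : List (Visit H S K A)} (hT : Chronological T) (h : Fin H) (s : Fin S) (j : Fin m)
    (y : (∀ j, Fin (A j)) × Fin S) :
    (lossAt G β h s j T y : ℝ) = ((H : ℝ) - G.r j h s y.1 - nextV G β T j h y.2) / H := by
  have hH : (0 : ℝ) < H := by exact_mod_cast h.pos
  have h1 := G.r_mem j h s y.1
  have h2 : nextV G β T j h y.2 ∈ Set.Icc (0 : ℝ) ((H : ℝ) - (h.succ : ℕ)) :=
    learner_V_mem hβ hT j h.succ y.2
  have h3 : ((h.succ : ℕ) : ℝ) = h + 1 := by simp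
  have h4 : (0 : ℝ) ≤ ((h : ℕ) : ℝ) := by positivity
  rw [h3] at h2
  unfold lossAt
  rw [Set.projIcc_of_mem zero_le_one (x := ((H : ℝ) - G.r j h s y.1 - nextV G β T j h y.2) / H)]
  constructor
  · exact div_nonneg (by linarith [h1.2, h2.2]) hH.le
  · rw [div_le_one hH]; linarith [h1.1, h2.1]

theorem feedbacks_eq_log {m H S K : ℕ} {A : Fin m → ℕ} {G : MarkovGame m H S A} {β : Fin m → ℕ → ℝ}
    (hβ : ∀ j t, 1 ≤ t → t ≤ K → 0 ≤ ∑ i ∈ Finset.Icc 1 t, lrW H t i * β j i)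
    {T : List (Visit H S K A)} (hT : Chronological T) {h : Fin H} {s : Fin S} {j : Fin m}
    {ω : List (Round (Option (List (Visit H S K A) × Fin K × List (Fin K × Fin H))) (A j))}
    (hω : List.Forall₂ (Matches G β h s j) (hits T h s) ω) :
    feedbacks ω = (learner G β T j).log h s := by
  rw [learner_log]
  unfold feedbacks
  refine List.ext_getElem (by simp [hω.length_eq]) fun i h1 h2 => ?_
  have hi : i < (hits T h s).length := by simpa using h2
  have hi' : i < ω.length := by simpa using h1
  have hm := hω.get hi hi'
  simp only [List.get_eq_getElem] at hm
  simp only [List.getElem_map]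
  rw [hm.2.1, hm.2.2, coe_lossAt hβ
    (hT.of_prefix ((List.prefix_append _ _).trans (mem_hits (List.getElem_mem hi)).1))]

variable (G β)

/-- The sequences of rounds that correspond to `t` visits with the property `Q`. -/
def badRounds (h : Fin H) (s : Fin S) (j : Fin m) (t : ℕ)
    (Q : List (List (Visit H S K A) × Visit H S K A) → Prop) :
    Set (List (Round (Option (List (Visit H S K A) × Fin K × List (Fin K × Fin H))) (A j))) :=
  {ω | ∃ T, Chronological T ∧ t ≤ (hits T h s).length ∧
    List.Forall₂ (Matches G β h s j) ((hits T h s).take t) ω ∧ Q ((hits T h s).take t)}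

/-- All `t` rounds have been played and the first `t` visits are fixed; further training cannot
change whether they have the property `Q`. -/
theorem runSteps_hits_le_of_length_eq
    (h : Fin H) (s : Fin S) (j : Fin m) (t : ℕ)
    (Q : List (List (Visit H S K A) × Visit H S K A) → Prop)
    (xs : List (Fin K × Fin H)) (T : List (Visit H S K A))
    (ω : List (Round (Option (List (Visit H S K A) × Fin K × List (Fin K × Fin H))) (A j)))
    (hTc : Chronological T) (hωt : ω.length = t)
    (hω : List.Forall₂ (Matches G β h s j) ((hits T h s).take t) ω) :
    (runSteps G alg β xs T).toOuterMeasure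
        {T' | Chronological T' ∧ t ≤ (hits T' h s).length ∧ Q ((hits T' h s).take t)}
      ≤ pexp (nextHit G alg β h s xs T) fun z =>
        (envRun (alg (A j)) (visitEnv G alg β h s j) (t - ω.length) ω z).toOuterMeasure
          (badRounds G β h s j t Q) := by
  have htl : t ≤ (hits T h s).length := by
    have hlen := hω.length_eq
    rw [List.length_take] at hlen
    omega
  have e : ∀ T', T <+: T' → (hits T' h s).take t = (hits T h s).take t := by
    intro T' hp
    obtain ⟨r, hr⟩ := hits_prefix hp h s
    rw [← hr, List.take_append_of_le_length htl]
  rw [hωt, Nat.sub_self]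
  simp only [envRun, pexp_const, toOuterMeasure_eq_pexp, pexp_pure]
  by_cases hQ : Q ((hits T h s).take t)
  · rw [Set.indicator_of_mem (by exact ⟨T, hTc, htl, hω, hQ⟩), ← toOuterMeasure_eq_pexp]
    exact toOuterMeasure_le_one _ _
  · refine (pexp_mono_support (g := fun _ => 0) fun T' hT' => ?_).trans (by simp [pexp_const])
    rw [Set.indicator_of_notMem]
    rintro ⟨_, _, hQ'⟩
    rw [e T' (prefix_of_mem_support_runSteps G alg β hT')] at hQ'
    exact hQ hQ'

/-- The visits of `(h, s)` during the training are at most as likely to have a given property as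
the rounds of the bandit. -/
theorem runSteps_hits_le
    (hβ : ∀ j t, 1 ≤ t → t ≤ K → 0 ≤ ∑ i ∈ Finset.Icc 1 t, lrW H t i * β j i)
    (h : Fin H) (s : Fin S) (j : Fin m) (t : ℕ)
    (Q : List (List (Visit H S K A) × Visit H S K A) → Prop)
    (xs : List (Fin K × Fin H)) (T : List (Visit H S K A))
    (ω : List (Round (Option (List (Visit H S K A) × Fin K × List (Fin K × Fin H))) (A j)))
    (hT : (T.map (fun v => (v.ep, v.step)) ++ xs).Pairwise chrono) (hωt : ω.length ≤ t)
    (hω : List.Forall₂ (Matches G β h s j) ((hits T h s).take t) ω) :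
    (runSteps G alg β xs T).toOuterMeasure
        {T' | Chronological T' ∧ t ≤ (hits T' h s).length ∧ Q ((hits T' h s).take t)}
      ≤ pexp (nextHit G alg β h s xs T) fun z =>
        (envRun (alg (A j)) (visitEnv G alg β h s j) (t - ω.length) ω z).toOuterMeasure
          (badRounds G β h s j t Q) := by
  induction xs generalizing T ω with
  | nil =>
    have hTc : Chronological T := by
      have := (List.pairwise_append.mp hT).1
      rwa [List.pairwise_map] at this
    rcases hωt.eq_or_lt with hωt' | hωt'
    · exact runSteps_hits_le_of_length_eq G alg β h s j t Q _ T ω hTc hωt' hω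
    -- The training is over with fewer than `t` visits, so the event is empty.
    · have hlen := hω.length_eq
      rw [List.length_take] at hlen
      simp only [runSteps, toOuterMeasure_eq_pexp, pexp_pure]
      rw [Set.indicator_of_notMem]
      · exact zero_le
      · rintro ⟨_, h1, _⟩; omega
  | cons x xs ih =>
    have hTc : Chronological T := by
      have := (List.pairwise_append.mp hT).1
      rwa [List.pairwise_map] at this
    rcases hωt.eq_or_lt with hωt' | hωt'
    · exact runSteps_hits_le_of_length_eq G alg β h s j t Q _ T ω hTc hωt' hω
    have hlen := hω.length_eq
    rw [List.length_take] at hlen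
    have hlt : (hits T h s).length < t := by omega
    have hω' := hω
    rw [List.take_of_length_le hlt.le] at hω'
    obtain ⟨k, h'⟩ := x
    by_cases hv : h' = h ∧ curState G T h' = s
    · obtain ⟨rfl, rfl⟩ := hv
      -- A visit of $(h,s)$ consumes one round. By `feedbacks_eq_log` the bandit has the same past
      -- on both sides, hence the same law of its action; the remaining randomness is drawn
      -- identically.
      obtain ⟨n, hn⟩ : ∃ n, t - ω.length = n + 1 := ⟨t - ω.length - 1, by omega⟩
      rw [nextHit, if_pos ⟨rfl, rfl⟩, pexp_pure, hn, envRun, feedbacks_eq_log hβ hTc hω', runSteps]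
      simp only [toOuterMeasure_eq_pexp, pexp_bind, stepLaw, pexp_map, outLaw_eq_bind_condOut (j := j),
        visitEnv]
      refine pexp_mono fun b => pexp_mono_support fun y hy => ?_
      have hb := act_eq_of_mem_support_condOut G alg β hy
      have hm : Matches G β h' (curState G T h') j (T, ⟨k, h', curState G T h', y.1, y.2⟩)
          (some (T, k, xs), b, lossAt G β h' (curState G T h') j T y) :=
        ⟨⟨_, rfl⟩, hb.symm, rfl⟩
      have hh : hits (T ++ [⟨k, h', curState G T h', y.1, y.2⟩]) h' (curState G T h')
          = hits T h' (curState G T h') ++ [(T, ⟨k, h', curState G T h', y.1, y.2⟩)] := by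
        rw [hits_snoc, if_pos ⟨rfl, rfl⟩]
      have := ih (T ++ [⟨k, h', curState G T h', y.1, y.2⟩])
        (ω ++ [(some (T, k, xs), b, lossAt G β h' (curState G T h') j T y)])
        (by simpa using hT) (by simp; omega) (by
          rw [hh, List.take_of_length_le (by simp; omega)]
          exact List.rel_append hω' (List.Forall₂.cons hm List.Forall₂.nil))
      rw [show t - (ω ++ [(some (T, k, xs), b, lossAt G β h' (curState G T h') j T y)]).length = n by
        simp; omega] at this
      simpa only [toOuterMeasure_eq_pexp] using this
    -- A step elsewhere belongs to the search of the adversary for the next visit and follows the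
    -- same `stepLaw`.
    · rw [nextHit, if_neg hv, runSteps, toOuterMeasure_eq_pexp, pexp_bind, pexp_bind]
      simp only [stepLaw, pexp_map]
      refine pexp_mono fun y => ?_
      have hh : hits (T ++ [⟨k, h', curState G T h', y.1, y.2⟩]) h s = hits T h s := by
        rw [hits_snoc, if_neg hv, List.append_nil]
      rw [← toOuterMeasure_eq_pexp]
      exact ih _ ω (by simpa using hT) hωt (by rwa [hh])

/-- The difference of the expected losses of player `j` with and without the map `ψ`. -/
def lossGap (h : Fin H) (s : Fin S) (j : Fin m) (ψ : Fin (A j) → Fin (A j))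
    (T : List (Visit H S K A)) : ℝ :=
  rexp (currentPolicy G alg β T j h s) fun b =>
    rexp (condOut G alg β T h s j b) (fun y => (lossAt G β h s j T y : ℝ))
      - rexp (condOut G alg β T h s j (ψ b)) fun y => (lossAt G β h s j T y : ℝ)

theorem runRegret_eq_wavg
    (hβ : ∀ j t, 1 ≤ t → t ≤ K → 0 ≤ ∑ i ∈ Finset.Icc 1 t, lrW H t i * β j i)
    (h : Fin H) (s : Fin S) (j : Fin m) (t : ℕ) (ψ : Fin (A j) → Fin (A j))
    {T : List (Visit H S K A)} (hT : Chronological T)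
    {ω : List (Round (Option (List (Visit H S K A) × Fin K × List (Fin K × Fin H))) (A j))}
    (hω : List.Forall₂ (Matches G β h s j) ((hits T h s).take t) ω) :
    runRegret (alg (A j)) (visitEnv G alg β h s j) H ψ ω
      = wavg H ((hits T h s).take t) fun p => lossGap G alg β h s j ψ p.1 := by
  have hlen := hω.length_eq
  unfold runRegret wavg
  rw [sum_fin_cast (n := (splits ω).length) (m := ((hits T h s).take t).length)
    (by rw [splits_length, hlen])]
  refine Finset.sum_congr rfl fun i _ => ?_
  obtain ⟨i, hi⟩ := i
  rw [splits_length] at hi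
  have hi2 : i < ((hits T h s).take t).length := by omega
  have hi3 : i < (hits T h s).length := by
    rw [List.length_take] at hi2; omega
  have hm := hω.get hi2 hi
  simp only [List.get_eq_getElem, List.getElem_take] at hm
  obtain ⟨⟨w, hw⟩, _, _⟩ := hm
  have hpre : ((hits T h s)[i]).1 <+: T :=
    (List.prefix_append _ _).trans (mem_hits (List.getElem_mem hi3)).1
  have hθ : feedbacks (ω.take i) = (learner G β ((hits T h s)[i]).1 j).log h s := by
    refine feedbacks_eq_log hβ (hT.of_prefix hpre) ?_
    rw [hits_getElem_fst]
    have := List.forall₂_take i hω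
    rw [List.length_take] at hi2
    rwa [List.take_take, min_eq_left (by omega)] at this
  -- The search for the next visit integrates out, so the expected feedback depends only on the
  -- record and on the action.
  have hl : meanLoss (visitEnv G alg β h s j) ω[i].1
      = fun b => rexp (condOut G alg β ((hits T h s)[i]).1 h s j b)
        (fun y => (lossAt G β h s j ((hits T h s)[i]).1 y : ℝ)) := by
    funext b
    rw [hw]
    unfold meanLoss
    simp only [visitEnv, pexp_bind, pexp_map, pexp_const]
    rw [pexp_ofReal _ fun y => (lossAt G β h s j ((hits T h s)[i]).1 y).2.1,
      ENNReal.toReal_ofReal (rexp_nonneg fun y => (lossAt G β h s j ((hits T h s)[i]).1 y).2.1)]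
  simp only [splits, List.get_eq_getElem, List.getElem_ofFn, List.getElem_take, List.length_ofFn,
    hlen]
  rw [hθ]
  simp only [lossGap, rexp_sub, hl]
  rfl

/-- A regret bound against Markovian adversaries holds along the visits of `(h, s)`. -/
theorem trainLaw_regret_le [NeZero H]
    (hβ : ∀ j t, 1 ≤ t → t ≤ K → 0 ≤ ∑ i ∈ Finset.Icc 1 t, lrW H t i * β j i)
    (h : Fin H) (s : Fin S) (j : Fin m) (t : ℕ) (x : ℝ) (p : ℝ≥0∞)
    (hreg : ∀ (Z : Type) (κ : Z → Fin (A j) → PMF (unitInterval × Z)) (z : Z),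
      (envRun (alg (A j)) κ t [] z).toOuterMeasure
        {ω | ∃ ψ, x < runRegret (alg (A j)) κ H ψ ω} ≤ p) :
    (trainLaw K G alg β).toOuterMeasure {T | t ≤ (hits T h s).length ∧
      ∃ ψ, x < wavg H ((hits T h s).take t) fun q => lossGap G alg β h s j ψ q.1} ≤ p := by
  have key := runSteps_hits_le G alg β hβ h s j t
    (fun L => ∃ ψ, x < wavg H L fun q => lossGap G alg β h s j ψ q.1) (allSteps K H) [] []
    (by simpa using allSteps_pairwise K H) (by simp) (by simp [hits_nil])
  rw [← trainLaw_eq] at key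
  refine le_trans (PMF.toOuterMeasure_mono _ ?_) (key.trans ?_)
  · rintro T ⟨hT, hT'⟩
    exact ⟨(isRecord_of_mem_support_trainLaw G alg β hT').chronological, hT⟩
  · refine (pexp_mono fun z => ?_).trans (pexp_const _ p).le
    refine (measure_mono ?_).trans (hreg _ (visitEnv G alg β h s j) z)
    rintro ω ⟨T, hTc, _, hm, ψ, hψ⟩
    exact ⟨ψ, by rwa [runRegret_eq_wavg G alg β hβ h s j t ψ hTc hm]⟩

end transfer

/-! ## The value of the output policy -/

section output
variable {m H S K : ℕ} {A : Fin m → ℕ}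

/-- The value along the path determined by the draws `d`, when the joint action `a` is replaced by
`f h τ s a`. -/
def pathValue (G : MarkovGame m H S A) (j : Fin m)
    (f : Fin H → Hist S A → Fin S → (∀ i, Fin (A i)) → ∀ i, Fin (A i))
    (d : Fin H × Fin K × Fin S → Fin K × (∀ i, Fin (A i))) :
    List (Fin H) → Hist S A → Fin S → Fin K → ℝ
  | [], _, _, _ => 0
  | h :: hs, τ, s, k =>
      G.r j h s (f h τ s (d (h, k, s)).2) + rexp (G.P h s (f h τ s (d (h, k, s)).2)) fun s' =>
        pathValue G j f d hs (τ ++ [(s, f h τ s (d (h, k, s)).2)]) s' (d (h, k, s)).1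

variable (G : MarkovGame m H S A) (j : Fin m)
  (f : Fin H → Hist S A → Fin S → (∀ i, Fin (A i)) → ∀ i, Fin (A i))

theorem drop_finRange_eq_cons {n : ℕ} {h : Fin H} {hs : List (Fin H)}
    (e : h :: hs = (List.finRange H).drop n) : (h : ℕ) = n ∧ hs = (List.finRange H).drop (n + 1) := by
  have hn : n < (List.finRange H).length := by
    by_contra hn
    rw [List.drop_of_length_le (by omega)] at e
    exact absurd e (by simp)
  rw [List.drop_eq_getElem_cons hn] at e
  simp only [List.cons.injEq] at e
  refine ⟨?_, e.2⟩
  rw [e.1]; simp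

theorem indexAfter_snoc (ω : Seed H S K A) (τ : Hist S A) (x : Fin S × (∀ i, Fin (A i))) (h : Fin H)
    (hτ : τ.length = h) :
    indexAfter ω (τ ++ [x]) = (ω.2 (h, indexAfter ω τ, x.1)).1 := by
  unfold indexAfter
  have hh := h.2
  have e : (List.finRange H).zip (τ ++ [x]) = (List.finRange H).zip τ ++ [(h, x)] := by
    refine List.ext_getElem (by simp; omega) fun i h1 h2 => ?_
    have hi : i < τ.length + 1 := by
      simp only [List.length_append, List.length_zip, List.length_finRange,
        List.length_singleton] at h2
      omega
    rcases Nat.lt_succ_iff_lt_or_eq.mp hi with hi' | rfl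
    · rw [List.getElem_append_left (by simp; omega)]
      simp [List.getElem_append_left hi']
    · rw [List.getElem_append_right (by simp)]
      simp [hτ]
  rw [e, List.foldl_append]
  rfl

/-- A policy recomputes its index from the whole past, while `pathValue` carries the index along.
The two agree as long as the past has the length of the current step. -/
theorem valueFrom_eq_pathValue (ω : Seed H S K A) (hs : List (Fin H)) (τ : Hist S A) (s : Fin S)
    (hhs : hs = (List.finRange H).drop τ.length) :
    G.valueFrom j (fun h τ s => f h τ s (ω.2 (h, indexAfter ω τ, s)).2) hs τ s
      = pathValue G j f ω.2 hs τ s (indexAfter ω τ) := by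
  induction hs generalizing τ s with
  | nil => rfl
  | cons h hs ih =>
    obtain ⟨h1, h2⟩ := drop_finRange_eq_cons hhs
    unfold MarkovGame.valueFrom pathValue rexp
    congr 1
    refine Finset.sum_congr rfl fun s' _ => ?_
    rw [ih _ _ (by simpa using h2), indexAfter_snoc ω τ _ h h1.symm]

theorem pathValue_update (d : Fin H × Fin K × Fin S → Fin K × (∀ i, Fin (A i)))
    (x : Fin H × Fin K × Fin S) (y : Fin K × (∀ i, Fin (A i))) (hs : List (Fin H)) (τ : Hist S A)
    (s : Fin S) (k : Fin K) (hx : x.1 ∉ hs) :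
    pathValue G j f (Function.update d x y) hs τ s k = pathValue G j f d hs τ s k := by
  induction hs generalizing τ s k with
  | nil => rfl
  | cons h hs ih =>
    have hne : (h, k, s) ≠ x := fun e => hx (by simp [← e])
    unfold pathValue
    simp only [Function.update_of_ne hne]
    congr 2
    funext s'
    exact ih _ _ _ fun hm => hx (List.mem_cons_of_mem _ hm)

variable [∀ j, NeZero (A j)] (alg : ∀ (B : ℕ) [NeZero B], BanditAlg B) (β : Fin m → ℕ → ℝ)
  (T : List (Visit H S K A))

/-- The expected value in the steps `hs` with index `k`, when the joint action `a` is replaced by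
`f h τ s a`. -/
def devValue : List (Fin H) → Hist S A → Fin S → Fin K → ℝ
  | [], _, _, _ => 0
  | h :: hs, τ, s, k => rexp (outStep G alg β T (h, k, s)) fun y =>
      G.r j h s (f h τ s y.2) + rexp (G.P h s (f h τ s y.2)) fun s' =>
        devValue hs (τ ++ [(s, f h τ s y.2)]) s' y.1

/-- The seed fixes all draws in advance, but a path consults only one entry per step and the steps
are distinct. Resampling the entry at `(h, k, s)` therefore separates it from the entries used
later, and the fixed seed acts like fresh draws. -/
theorem rexp_pathValue (hs : List (Fin H)) (hhs : hs.Nodup) (τ : Hist S A) (s : Fin S) (k : Fin K) :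
    rexp (pmfPi fun x => outStep G alg β T x) (fun d => pathValue G j f d hs τ s k)
      = devValue G j f alg β T hs τ s k := by
  induction hs generalizing τ s k with
  | nil => exact rexp_const _ _
  | cons h hs ih =>
    rw [rexp_pmfPi_resample _ (h, k, s), devValue]
    congr 1; funext y
    simp only [pathValue, Function.update_self]
    have hn := List.nodup_cons.mp hhs
    simp only [pathValue_update G j f _ (h, k, s) _ hs _ _ _ hn.1]
    rw [rexp_add, rexp_const, rexp_comm]
    simp only [ih hn.2]

/-- Covers the output policy and its modifications at once; in both cases `h` holds by definition.
-/
theorem value_eq_of_act [NeZero K] (π : JointPolicy H S A)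
    (h : π = { outputPolicy G alg β T with
      act := fun i h ω τ s => f h τ s (ω.2 (h, indexAfter ω τ, s)).2 i
      act_meas := fun _ _ _ _ => measurable_from_top }) :
    G.value j π = (∑ k, devValue G j f alg β T (List.finRange H) [] G.s₁ k) / K := by
  subst h
  let _ : MeasurableSpace (Seed H S K A) := ⊤
  have : MeasurableSingletonClass (Seed H S K A) := ⟨fun _ => MeasurableSpace.measurableSet_top⟩
  unfold MarkovGame.value
  change ∫ ω, G.valueFrom j (fun h τ s => f h τ s (ω.2 (h, indexAfter ω τ, s)).2) (List.finRange H)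
    [] G.s₁ ∂(seedLaw G alg β T).toMeasure = _
  rw [PMF.integral_eq_sum]
  change rexp (seedLaw G alg β T) _ = _
  unfold seedLaw
  rw [rexp_bind]
  simp only [rexp_map]
  rw [rexp_uniform, Fintype.card_fin]
  congr 1
  refine Finset.sum_congr rfl fun k _ => ?_
  rw [← rexp_pathValue G j f alg β T _ (List.nodup_finRange H)]
  congr 1; funext d
  rw [valueFrom_eq_pathValue G j f (k, d) _ [] _ (by simp)]
  simp [indexAfter]

theorem value_outputPolicy [NeZero K] :
    G.value j (outputPolicy G alg β T)
      = (∑ k, devValue G j (fun _ _ _ a => a) alg β T (List.finRange H) [] G.s₁ k) / K :=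
  value_eq_of_act G j _ alg β T _ rfl

theorem value_modify_outputPolicy [NeZero K] (φ : Modification H S A j) :
    G.value j ((outputPolicy G alg β T).modify j φ)
      = (∑ k, devValue G j (fun h τ s a => Function.update a j (φ h τ s (a j))) alg β T
          (List.finRange H) [] G.s₁ k) / K :=
  value_eq_of_act G j (fun h τ s a => Function.update a j (φ h τ s (a j))) alg β T _ rfl

theorem visitsBefore_eq {m H S K : ℕ} {A : Fin m → ℕ} (T : List (Visit H S K A)) (k : Fin K) (h : Fin H) (s : Fin S) :
    visitsBefore T k h s = (hits (before T k) h s).map fun p => p.2.ep := by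
  unfold visitsBefore
  rw [← hits_map_snd, List.map_map]
  rfl

theorem rexp_outStep (h : Fin H) (k : Fin K) (s : Fin S) (F : Fin K × (∀ i, Fin (A i)) → ℝ) :
    rexp (outStep G alg β T (h, k, s)) F
      = if hits (before T k) h s = [] then
          rexp (pmfPi fun i => policyAt G alg β T k i h s) fun a => F (k, a)
        else wavg H (hits (before T k) h s) fun p =>
          rexp (pmfPi fun i => policyAt G alg β T p.2.ep i h s) fun a => F (p.2.ep, a) := by
  unfold outStep nextIndex
  rw [rexp_bind]
  simp only [rexp_map]
  by_cases h0 : hits (before T k) h s = []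
  · rw [dif_neg (by rw [visitsBefore_eq, h0]; simp), if_pos h0, rexp_pure]
  · have h1 : 0 < (visitsBefore T k h s).length := by
      rw [visitsBefore_eq, List.length_map]; exact List.length_pos_iff.mpr h0
    rw [dif_pos h1, if_neg h0, rexp_map]
    rw [← wavg_map H (hits (before T k) h s) (fun p => p.2.ep) (fun k' =>
      rexp (pmfPi fun i => policyAt G alg β T k' i h s) fun a => F (k', a)), ← visitsBefore_eq]
    unfold rexp wavg weightLaw
    refine Finset.sum_congr rfl fun i _ => ?_
    rw [PMF.ofFintype_apply, ENNReal.toReal_ofReal (lrW_nonneg _ _ _)]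

theorem devValue_mem (hs : List (Fin H)) (τ : Hist S A) (s : Fin S) (k : Fin K) :
    devValue G j f alg β T hs τ s k ∈ Set.Icc (0 : ℝ) hs.length := by
  induction hs generalizing τ s k with
  | nil => simp [devValue]
  | cons h hs ih =>
    unfold devValue
    constructor
    · exact rexp_nonneg fun y => add_nonneg (G.r_mem _ _ _ _).1 (rexp_nonneg fun s' => (ih _ _ _).1)
    · refine rexp_le fun y => ?_
      have h1 := (G.r_mem j h s (f h τ s y.2)).2
      have h2 : rexp (G.P h s (f h τ s y.2)) (fun s' =>
        devValue G j f alg β T hs (τ ++ [(s, f h τ s y.2)]) s' y.1) ≤ hs.length :=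
        rexp_le fun s' => (ih _ _ _).2
      push_cast [List.length_cons]
      linarith

/-- The value of player `j` under the output policy in the steps `hs`, with index `k`. -/
def certValue (G : MarkovGame m H S A) (j : Fin m) (alg : ∀ (B : ℕ) [NeZero B], BanditAlg B)
    (β : Fin m → ℕ → ℝ) (T : List (Visit H S K A)) (hs : List (Fin H)) (s : Fin S) (k : Fin K) : ℝ :=
  devValue G j (fun _ _ _ a => a) alg β T hs [] s k

/-- Without a modification the past is irrelevant, so the value is a function of state and index
alone. -/
theorem devValue_id (hs : List (Fin H)) (τ : Hist S A) (s : Fin S) (k : Fin K) :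
    devValue G j (fun _ _ _ a => a) alg β T hs τ s k = certValue G j alg β T hs s k := by
  unfold certValue
  generalize ([] : Hist S A) = τ'
  induction hs generalizing τ τ' s k with
  | nil => rfl
  | cons h hs ih =>
    unfold devValue
    congr 1; funext y; congr 2; funext s'
    exact ih _ _ _ _

theorem certValue_cons (h : Fin H) (hs : List (Fin H)) (s : Fin S) (k : Fin K) :
    certValue G j alg β T (h :: hs) s k = rexp (outStep G alg β T (h, k, s)) fun y =>
      G.r j h s y.2 + rexp (G.P h s y.2) fun s' => certValue G j alg β T hs s' y.1 := by
  conv_lhs => unfold certValue devValue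
  simp only [devValue_id]

theorem before_before {m H S K : ℕ} {A : Fin m → ℕ} {T : List (Visit H S K A)} {k k' : Fin K} (h : k' ≤ k) :
    before (before T k) k' = before T k' := by
  unfold before
  rw [List.filter_filter]
  refine List.filter_congr fun v _ => ?_
  by_cases h' : v.ep < k'
  · simp [h', h'.trans_le h]
  · simp [h']

/-- The value with index `k` depends only on the record before episode `k`. -/
theorem certValue_congr {T T' : List (Visit H S K A)} (hs : List (Fin H)) (s : Fin S) (k : Fin K)
    (e : before T k = before T' k) : certValue G j alg β T hs s k = certValue G j alg β T' hs s k := by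
  induction hs generalizing s k with
  | nil => rfl
  | cons h hs ih =>
    rw [certValue_cons, certValue_cons, rexp_outStep, rexp_outStep, e]
    have hp : policyAt G alg β T k = policyAt G alg β T' k := by
      unfold policyAt; rw [e]
    simp only [ih _ _ e, hp]
    congr 1
    refine wavg_congr fun p hp' => ?_
    -- The index is only ever replaced by an earlier episode, so the recursion never leaves the
    -- record before `k`. This makes the value predictable, as the concentration argument requires.
    have hlt : p.2.ep ≤ k := by
      have h1 : p.2 ∈ before T' k := (mem_hits hp').1.subset (by simp)
      have h2 := (List.mem_filter.mp h1).2
      exact (of_decide_eq_true h2).le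
    have e' : before T p.2.ep = before T' p.2.ep := by
      rw [← before_before hlt, e, before_before hlt]
    have hp2 : policyAt G alg β T p.2.ep = policyAt G alg β T' p.2.ep := by
      unfold policyAt; rw [e']
    simp only [ih _ _ e', hp2]

end output

/-! ## The record of a complete training -/

section record
variable {m H S K : ℕ} {A : Fin m → ℕ}

theorem Chronological.before_append {T : List (Visit H S K A)} (hT : Chronological T) (k : Fin K) :
    T = before T k ++ T.filter fun v => k ≤ v.ep := by
  induction T with
  | nil => rfl
  | cons v T ih =>
    have hT' := List.pairwise_cons.mp hT
    unfold before at *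
    by_cases hv : v.ep < k
    · rw [List.filter_cons_of_pos (by simpa using hv), List.filter_cons_of_neg (by simpa using hv),
        List.cons_append, ← ih hT'.2]
    · have h1 : ∀ w ∈ T, ¬ w.ep < k := fun w hw h => by
        rcases hT'.1 w hw with h' | ⟨h', _⟩
        · exact hv (lt_trans h' h)
        · exact hv (lt_of_eq_of_lt h' h)
      have h2 : T.filter (fun w => decide (w.ep < k)) = [] := by
        rw [List.filter_eq_nil_iff]; simpa using h1
      have h3 : T.filter (fun w => decide (k ≤ w.ep)) = T := by
        rw [List.filter_eq_self]; simpa using h1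
      rw [List.filter_cons_of_neg (by simpa using hv),
        List.filter_cons_of_pos (by simpa using hv), h2, h3]
      rfl

theorem Chronological.before_prefix {T : List (Visit H S K A)} (hT : Chronological T) (k : Fin K) :
    before T k <+: T := ⟨_, (hT.before_append k).symm⟩

/-- The record before a visit consists of the earlier episodes and of earlier steps of the same
episode. -/
theorem Chronological.eq_before_append {T l : List (Visit H S K A)} {v : Visit H S K A}
    (hT : Chronological T) (hl : l ++ [v] <+: T) :
    before l v.ep = before T v.ep ∧
      ∃ r, l = before T v.ep ++ r ∧ ∀ w ∈ r, w.ep = v.ep ∧ w.step < v.step := by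
  obtain ⟨t, rfl⟩ := hl
  have h1 : before (l ++ [v] ++ t) v.ep = before l v.ep := by
    unfold before
    rw [List.append_assoc, List.filter_append]
    have : ([v] ++ t).filter (fun w => decide (w.ep < v.ep)) = [] := by
      rw [List.filter_eq_nil_iff]
      intro w hw
      have hp := (List.pairwise_append.mp hT).1
      rcases List.mem_append.mp hw with hw | hw
      · rw [List.mem_singleton.mp hw]; simp
      · rcases (List.pairwise_append.mp hT).2.2 v (by simp) w hw with h' | ⟨h', _⟩
        · simpa using h'.le
        · simp only [decide_eq_true_eq, not_lt]; exact le_of_eq h'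
    rw [this, List.append_nil]
  have hlv : Chronological (l ++ [v]) := hT.of_prefix (List.prefix_append _ _)
  have hlc : Chronological l := hlv.of_prefix (List.prefix_append _ _)
  refine ⟨h1.symm, l.filter (fun w => v.ep ≤ w.ep), ?_, ?_⟩
  · rw [h1]; exact hlc.before_append v.ep
  · intro w hw
    obtain ⟨hw1, hw2⟩ := List.mem_filter.mp hw
    rcases (List.pairwise_append.mp hlv).2.2 w hw1 v (by simp) with h' | h'
    · exact absurd h' (by simpa using hw2)
    · exact h'

/-- Entries with distinct labels can be addressed by their labels; here the labels are the pairs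
(episode, step). -/
theorem exists_map_of_nodup {α β : Type} [Inhabited α] [DecidableEq β] (f : α → β)
    (l : List α) (hl : (l.map f).Nodup) :
    ∃ g : β → α, l = (l.map f).map g ∧ ∀ x ∈ l.map f, f (g x) = x := by
  induction l with
  | nil => exact ⟨fun _ => default, rfl, by simp⟩
  | cons a l ih =>
    rw [List.map_cons, List.nodup_cons] at hl
    obtain ⟨g, hg1, hg2⟩ := ih hl.2
    have hne : ∀ x ∈ l.map f, x ≠ f a := fun x hx e => hl.1 (e ▸ hx)
    refine ⟨Function.update g (f a) a, ?_, ?_⟩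
    · rw [List.map_cons, List.map_cons, Function.update_self]
      congr 1
      conv_lhs => rw [hg1]
      exact List.map_congr_left fun x hx => by rw [Function.update_of_ne (hne x hx)]
    · intro x hx
      rw [List.map_cons, List.mem_cons] at hx
      rcases hx with rfl | hx
      · rw [Function.update_self]
      · rw [Function.update_of_ne (hne x hx), hg2 x hx]

theorem mem_allSteps (x : Fin K × Fin H) : x ∈ allSteps K H := by
  simp [allSteps, Prod.ext_iff]

theorem allSteps_filter_step (h : Fin H) :
    (allSteps K H).filter (fun x => x.2 = h) = (List.finRange K).map fun k => (k, h) := by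
  unfold allSteps
  rw [List.filter_flatMap, List.map_eq_flatMap]
  congr 1; funext k
  rw [List.filter_map]
  have : (List.finRange H).filter ((fun x : Fin K × Fin H => decide (x.2 = h)) ∘ fun h => (k, h))
      = [h] := by
    refine List.perm_singleton.mp ?_
    rw [List.perm_ext_iff_of_nodup ((List.nodup_finRange H).filter _) (by simp)]
    intro a; simp
  rw [this]; rfl

/-- The visits of a complete training, and the states in which the steps start. -/
theorem IsRecord.exists_visit {G : MarkovGame m H S A} {T : List (Visit H S K A)} [NeZero H]
    [∀ j, NeZero (A j)] (hT : IsRecord G (allSteps K H) T) :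
    ∃ vis : Fin K → Fin H → Visit H S K A, T = (allSteps K H).map (fun x => vis x.1 x.2) ∧
      (∀ k h, (vis k h).ep = k ∧ (vis k h).step = h) ∧
      ∃ sto : Fin K → Fin (H + 1) → Fin S, (∀ k, sto k 0 = G.s₁) ∧
        (∀ k h, (vis k h).st = sto k h.castSucc) ∧ ∀ k h, (vis k h).nxt = sto k h.succ := by
  rcases Nat.eq_zero_or_pos K with rfl | hK
  · refine ⟨fun k => k.elim0, ?_, fun k => k.elim0, fun k => k.elim0, fun k => k.elim0,
      fun k => k.elim0, fun k => k.elim0⟩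
    have := hT.1
    simp only [allSteps, List.finRange_zero, List.flatMap_nil, List.map_eq_nil_iff] at this ⊢
    exact this
  have : Inhabited (Visit H S K A) :=
    ⟨⟨⟨0, hK⟩, ⟨0, NeZero.pos H⟩, G.s₁, fun _ => 0, G.s₁⟩⟩
  have hnd : (T.map fun v => (v.ep, v.step)).Nodup := by
    rw [hT.1]
    refine (allSteps_pairwise K H).imp fun {a b} h e => ?_
    subst e
    rcases h with h | ⟨_, h⟩ <;> exact lt_irrefl _ h
  obtain ⟨g, hg1, hg2⟩ := exists_map_of_nodup (fun v : Visit H S K A => (v.ep, v.step)) T hnd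
  rw [hT.1] at hg1 hg2
  have hv : ∀ k h, (g (k, h)).ep = k ∧ (g (k, h)).step = h := fun k h => by
    have := hg2 (k, h) (mem_allSteps _)
    exact ⟨congrArg Prod.fst this, congrArg Prod.snd this⟩
  refine ⟨fun k h => g (k, h), hg1, hv,
    -- The state at level `h + 1` is read off as the end of step `h`; that it is also the start of
    -- the following step is what remains.
    fun k => Fin.cases G.s₁ fun h => (g (k, h)).nxt, fun k => rfl, ?_, fun k h => rfl⟩
  intro k h
  obtain ⟨X, Y, hXY⟩ := List.append_of_mem (List.mem_finRange k)
  have hh : (h : ℕ) < (List.finRange H).length := by simp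
  have e2 : List.finRange H = (List.finRange H).take h ++ h :: (List.finRange H).drop (h + 1) := by
    conv_lhs => rw [← List.take_append_drop h (List.finRange H), List.drop_eq_getElem_cons hh]
    simp
  have e3 : T = ((X.flatMap fun k => (List.finRange H).map fun h => g (k, h))
      ++ ((List.finRange H).take h).map fun h => g (k, h)) ++ g (k, h) ::
      (((List.finRange H).drop (h + 1)).map (fun h => g (k, h))
      ++ Y.flatMap fun k => (List.finRange H).map fun h => g (k, h)) := by
    rw [hg1]
    unfold allSteps
    rw [hXY, List.flatMap_append, List.flatMap_cons]
    conv_lhs => rw [show ((List.finRange H).map fun h => (k, h)) = (((List.finRange H).take h ++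
      h :: (List.finRange H).drop (h + 1)).map fun h => (k, h)) from by rw [← e2]]
    simp [List.map_flatMap, Function.comp_def]
  have h3 := hT.2 _ _ _ e3
  rw [h3, (hv k h).2]
  obtain ⟨n, hn⟩ := h
  cases n with
  | zero => simp [curState]
  | succ n =>
    have e4 : (List.finRange H).take (n + 1) = (List.finRange H).take n ++ [⟨n, by omega⟩] := by
      rw [List.take_succ_eq_append_getElem (by simp; omega)]
      simp
    simp only [curState, e4, List.map_append, List.map_cons, List.map_nil, ← List.append_assoc]
    simp

end record

/-! ## Deterministic consequences of the concentration events -/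

section gap
variable {m H S K : ℕ} {A : Fin m → ℕ}

/-- Translates averages over recorded visits into averages over the episodes $k'<k$ whose step `h`
starts in `s`, so that sums over episodes can be regrouped by states. -/
theorem hits_before_congr {α : Type} {T : List (Visit H S K A)} (vis : Fin K → Fin H → Visit H S K A)
    (hT : T = (allSteps K H).map fun x => vis x.1 x.2)
    (hvis : ∀ k h, (vis k h).ep = k ∧ (vis k h).step = h) (k : Fin K) (h : Fin H) (s : Fin S)
    (f : Visit H S K A → α) :
    (hits (before T k) h s).map (fun p => f p.2)
      = (((List.finRange K).filter (· < k)).filter fun k' => (vis k' h).st = s).map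
        fun k' => f (vis k' h) := by
  have h1 : (hits (before T k) h s).map (fun p => f p.2)
      = ((hits (before T k) h s).map Prod.snd).map f := by rw [List.map_map]; rfl
  have h2 : T.filter (fun v => v.step = h) = (List.finRange K).map fun k => vis k h := by
    rw [hT, List.filter_map]
    have : (fun v : Visit H S K A => decide (v.step = h)) ∘ (fun x => vis x.1 x.2)
        = fun x : Fin K × Fin H => decide (x.2 = h) := by
      funext x; simp [(hvis x.1 x.2).2]
    rw [this, allSteps_filter_step, List.map_map]
    rfl
  have h3 : (before T k).filter (fun v => v.step = h ∧ v.st = s)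
      = ((T.filter fun v => v.step = h).filter fun v => v.ep < k).filter fun v => v.st = s := by
    unfold before
    simp only [List.filter_filter]
    refine List.filter_congr fun v _ => ?_
    by_cases a : v.ep < k <;> by_cases b : v.step = h <;> by_cases c : v.st = s <;> simp [a, b, c]
  rw [h1, hits_map_snd, h3, h2, List.filter_map, List.filter_map, List.map_map]
  congr 1
  congr 2
  funext k'
  simp [(hvis k' h).1]

theorem take_finRange (k : Fin K) :
    (List.finRange K).take k = (List.finRange K).filter (· < k) := by
  conv_rhs => rw [← List.take_append_drop k (List.finRange K), List.filter_append]
  rw [List.filter_eq_self.mpr, List.filter_eq_nil_iff.mpr, List.append_nil]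
  · intro a ha
    obtain ⟨i, hi, rfl⟩ := List.mem_iff_getElem.mp ha
    simp [Fin.lt_def]
  · intro a ha
    obtain ⟨i, hi, rfl⟩ := List.mem_iff_getElem.mp ha
    have : i < (k : ℕ) := by simp at hi; omega
    simpa [Fin.lt_def] using this

theorem sum_eq_prefixSum_finRange (F : List (Fin K) → Fin K → ℝ) :
    ∑ k, F ((List.finRange K).filter (· < k)) k = prefixSum F (List.finRange K) := by
  unfold prefixSum
  rw [sum_fin_cast (n := K) (m := (List.finRange K).length) (by simp)]
  refine Finset.sum_congr rfl fun k _ => ?_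
  rw [← take_finRange]
  simp

theorem prefixSum_of_entry {γ : Type} (f : γ → ℝ) (l : List γ) :
    prefixSum (fun _ x => f x) l = (l.map f).sum := by
  induction l using List.reverseRecOn with
  | nil => simp [prefixSum_nil]
  | append_singleton l x ih => rw [prefixSum_snoc, ih]; simp

theorem prefixSum_of_length {γ : Type} (e : ℕ → ℝ) (l : List γ) :
    prefixSum (fun p _ => e p.length) l = ∑ n ∈ Finset.range l.length, e n := by
  induction l using List.reverseRecOn with
  | nil => simp [prefixSum_nil]
  | append_singleton l x ih => rw [prefixSum_snoc, ih]; simp [Finset.sum_range_succ]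

/-- If `x_k` is at most a term that depends on the number of earlier visits of the same state, plus
a weighted average of `y` over these visits, then `∑ x_k` is controlled by `∑ y_k`. -/
theorem sum_le_of_le_wavg (hH : 1 ≤ H) (st : Fin K → Fin S) (x y : Fin K → ℝ) (hy : ∀ k, 0 ≤ y k)
    (e : ℕ → ℝ) {E : ℝ}
    (hE : ∀ N : Fin S → ℕ, ∑ s, N s = K → ∑ s, ∑ n ∈ Finset.range (N s), e n ≤ E)
    (hx : ∀ k, x k ≤ e (((List.finRange K).filter (· < k)).filter fun k' => st k' = st k).length
      + wavg H (((List.finRange K).filter (· < k)).filter fun k' => st k' = st k) y) :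
    ∑ k, x k ≤ E + (1 + 1 / H) * ∑ k, y k := by
  refine (Finset.sum_le_sum fun k _ => hx k).trans ?_
  -- Grouped by state, the earlier visits of the same state are precisely the proper prefixes of the
  -- list of its visits, and `prefixSum_wavg_le` applies to each state.
  rw [sum_eq_prefixSum_finRange (fun p k => e (p.filter fun k' => st k' = st k).length
    + wavg H (p.filter fun k' => st k' = st k) y),
    prefixSum_filter st (fun p _ => e p.length + wavg H p y)]
  simp only [prefixSum_add, Finset.sum_add_distrib, prefixSum_of_length]
  refine add_le_add (hE _ ?_) ?_
  · have := prefixSum_filter st (fun _ _ => (1 : ℝ)) (List.finRange K)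
    rw [prefixSum_of_entry] at this
    simp only [prefixSum_of_entry, List.map_const', List.sum_replicate, List.length_finRange,
      nsmul_eq_mul, mul_one] at this
    exact_mod_cast this.symm
  · refine (Finset.sum_le_sum fun s _ => prefixSum_wavg_le H hH _ y fun k _ => hy k).trans ?_
    rw [← Finset.mul_sum]
    refine mul_le_mul_of_nonneg_left (le_of_eq ?_) (by positivity)
    have := prefixSum_filter st (fun _ k => y k) (List.finRange K)
    simp only [prefixSum_of_entry] at this
    rw [← this, ← List.ofFn_eq_map, List.sum_ofFn]

variable [∀ j, NeZero (A j)] (G : MarkovGame m H S A) (alg : ∀ (B : ℕ) [NeZero B], BanditAlg B)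
  (β : Fin m → ℕ → ℝ)

theorem rexp_outcome {m H S : ℕ} {A : Fin m → ℕ} (G : MarkovGame m H S A) (h : Fin H) (s : Fin S) (p : PMF (∀ j, Fin (A j)))
    (f : (∀ j, Fin (A j)) × Fin S → ℝ) :
    rexp (outcome G h s p) f = rexp p fun a => rexp (G.P h s a) fun s' => f (a, s') := by
  unfold outcome
  rw [rexp_bind]
  simp only [rexp_map]

/-- The expected reward plus continuation value when player `j` replaces its action `b` by
`ψ b`. -/
def swapValue (T : List (Visit H S K A)) (h : Fin H) (s : Fin S) (j : Fin m)
    (ψ : Fin (A j) → Fin (A j)) (F : Fin S → ℝ) : ℝ :=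
  rexp (currentPolicy G alg β T j h s) fun b =>
    rexp (condOut G alg β T h s j (ψ b)) fun y => G.r j h s y.1 + F y.2

theorem rexp_pmfPi_eq_swapValue (T : List (Visit H S K A)) (h : Fin H) (s : Fin S) (j : Fin m)
    (ψ : Fin (A j) → Fin (A j)) (F : Fin S → ℝ) :
    rexp (pmfPi fun i => currentPolicy G alg β T i h s) (fun a =>
      G.r j h s (Function.update a j (ψ (a j)))
        + rexp (G.P h s (Function.update a j (ψ (a j)))) F)
      = swapValue G alg β T h s j ψ F := by
  unfold swapValue condOut
  rw [rexp_pmfPi_resample _ j]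
  simp only [rexp_outcome, rexp_map, Function.update_self, Function.update_idem, rexp_add,
    rexp_const]

theorem rexp_outLaw_eq_swapValue (T : List (Visit H S K A)) (h : Fin H) (s : Fin S) (j : Fin m)
    (F : Fin S → ℝ) :
    rexp (outLaw G alg β T h s) (fun y => G.r j h s y.1 + F y.2)
      = swapValue G alg β T h s j id F := by
  rw [outLaw_eq_bind_condOut G alg β T h s j, rexp_bind]
  rfl

variable {G β}

/-- The loss is one minus the return divided by $H$, so what a swap gains in return is $H$ times
what it saves in loss. -/
theorem swapValue_sub_eq_lossGap
    (hβ : ∀ j t, 1 ≤ t → t ≤ K → 0 ≤ ∑ i ∈ Finset.Icc 1 t, lrW H t i * β j i)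
    {T : List (Visit H S K A)} (hT : Chronological T) (h : Fin H) (s : Fin S) (j : Fin m)
    (ψ : Fin (A j) → Fin (A j)) :
    swapValue G alg β T h s j ψ (nextV G β T j h) - swapValue G alg β T h s j id (nextV G β T j h)
      = H * lossGap G alg β h s j ψ T := by
  have hH : (H : ℝ) ≠ 0 := by have := h.pos; positivity
  unfold swapValue lossGap
  rw [← rexp_sub, ← rexp_const_mul]
  congr 1; funext b
  simp only [coe_lossAt hβ hT, id]
  have e : ∀ b, rexp (condOut G alg β T h s j b)
      (fun y => ((H : ℝ) - G.r j h s y.1 - nextV G β T j h y.2) / H)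
      = 1 - rexp (condOut G alg β T h s j b) (fun y => G.r j h s y.1 + nextV G β T j h y.2) / H := by
    intro b
    rw [div_eq_inv_mul, ← rexp_const_mul, ← rexp_const (condOut G alg β T h s j b) 1, ← rexp_sub]
    congr 1; funext y
    field_simp
    ring
  rw [e, e]
  field_simp
  ring

variable (G β)

/-- Reward plus estimated value of the next state. -/
def estReturn (j : Fin m) (h : Fin H) (s : Fin S) (T : List (Visit H S K A)) (_ : Fin K)
    (y : (∀ j, Fin (A j)) × Fin S) : ℝ :=
  G.r j h s y.1 + max 0 (min (H : ℝ) (nextV G β T j h y.2))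

/-- Reward plus value of the next state under the output policy, subtracted from `2H`. -/
def certReturn (j : Fin m) (h : Fin H) (s : Fin S) (T : List (Visit H S K A)) (k : Fin K)
    (y : (∀ j, Fin (A j)) × Fin S) : ℝ :=
  -- The reflection lets one one-sided deviation bound serve here too: it now prevents the observed
  -- returns from being too large. The range is again $[0,2H]$.
  2 * H - (G.r j h s y.1 + certValue G j alg β T ((List.finRange H).drop (h + 1)) y.2 k)

/-- The events on which the analysis of the training relies: along the visits of every state, the
bandits have small regret, and the observed returns are close to their expectations. -/
structure GoodRecord (ξ : Fin m → ℕ → ℝ) (ε : ℕ → ℝ) (T : List (Visit H S K A)) : Prop where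
  regret : ∀ j h s t, 1 ≤ t → t ≤ (hits T h s).length → ∀ ψ,
    wavg H ((hits T h s).take t) (fun q => lossGap G alg β h s j ψ q.1) ≤ ξ j t
  est : ∀ j h s t, 1 ≤ t → t ≤ (hits T h s).length →
    wavg H ((hits T h s).take t) (deviation G alg β h s (estReturn G β j h s)) ≤ ε t
  cert : ∀ j h s t, 1 ≤ t → t ≤ (hits T h s).length →
    wavg H ((hits T h s).take t) (deviation G alg β h s (certReturn G alg β j h s)) ≤ ε t

variable {G β alg} {ξ : Fin m → ℕ → ℝ} {ε : ℕ → ℝ} {T : List (Visit H S K A)}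

theorem hits_before_eq_take {m H S K : ℕ} {A : Fin m → ℕ} {T : List (Visit H S K A)} (hT : Chronological T) (k : Fin K) (h : Fin H) (s : Fin S) :
    hits (before T k) h s = (hits T h s).take (hits (before T k) h s).length ∧
      (hits (before T k) h s).length ≤ (hits T h s).length :=
  ⟨List.prefix_iff_eq_take.mp (hits_prefix (hT.before_prefix k) h s),
    (hits_prefix (hT.before_prefix k) h s).length_le⟩

/-- The policies and estimates at the time of a visit are those from the start of its episode. -/
theorem at_visit (hT : Chronological T) {k : Fin K} {h : Fin H} {s : Fin S}
    {p : List (Visit H S K A) × Visit H S K A} (hp : p ∈ hits (before T k) h s) :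
    Chronological p.1 ∧ before p.1 p.2.ep = before T p.2.ep ∧
      (∀ i, policyAt G alg β T p.2.ep i h s = currentPolicy G alg β p.1 i h s) ∧
      ∀ j s', nextV G β (before T p.2.ep) j h s' = nextV G β p.1 j h s' := by
  obtain ⟨h1, h2, _⟩ := mem_hits hp
  have h1' := h1.trans (hT.before_prefix k)
  obtain ⟨h3, r, h4, h5⟩ := hT.eq_before_append h1'
  refine ⟨hT.of_prefix ((List.prefix_append _ _).trans h1'), h3, fun i => ?_, fun j s' => ?_⟩
  · unfold policyAt currentPolicy
    conv_rhs => rw [h4]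
    rw [learner_log_append G β _ _ _ _ _ fun w hw => by
      rw [← h2]; exact (h5 w hw).2.ne]
  · unfold nextV
    conv_rhs => rw [h4]
    rw [learner_V_append G β _ _ _ _ _ fun w hw e => ?_]
    have h6 := (h5 w hw).2
    rw [h2] at h6
    have h7 := congrArg Fin.val e
    simp only [Fin.val_castSucc, Fin.val_succ] at h7
    rw [Fin.lt_def] at h6
    omega

/-- The truncation in `estReturn` only serves to bound it on arbitrary lists of visits; on
chronological records it does nothing. -/
theorem estReturn_eq {m H S K : ℕ} {A : Fin m → ℕ} {G : MarkovGame m H S A} {β : Fin m → ℕ → ℝ}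
    {T : List (Visit H S K A)}
    (hβ : ∀ j t, 1 ≤ t → t ≤ K → 0 ≤ ∑ i ∈ Finset.Icc 1 t, lrW H t i * β j i)
    (hT : Chronological T) (j : Fin m) (h : Fin H) (s : Fin S) (k : Fin K)
    (y : (∀ j, Fin (A j)) × Fin S) :
    estReturn G β j h s T k y = G.r j h s y.1 + nextV G β T j h y.2 := by
  have h2 : nextV G β T j h y.2 ∈ Set.Icc (0 : ℝ) ((H : ℝ) - (h.succ : ℕ)) :=
    learner_V_mem hβ hT j h.succ y.2
  have : (0 : ℝ) ≤ ((h.succ : ℕ) : ℝ) := by positivity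
  unfold estReturn
  rw [min_eq_right (by linarith [h2.2]), max_eq_right h2.1]

/-- Optimism: the estimates dominate the values after a strategy modification. -/
theorem devValue_le_V
    (hβ : ∀ j t, 1 ≤ t → t ≤ K → 0 ≤ ∑ i ∈ Finset.Icc 1 t, lrW H t i * β j i)
    (hβ1 : ∀ j t, 1 ≤ t → t ≤ K → H * ξ j t + ε t ≤ ∑ i ∈ Finset.Icc 1 t, lrW H t i * β j i)
    (hT : Chronological T) (hg : GoodRecord G alg β ξ ε T) (j : Fin m) (φ : Modification H S A j)
    (hs : List (Fin H)) (q : Fin (H + 1)) (hq : hs = (List.finRange H).drop q) (τ : Hist S A)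
    (s : Fin S) (k : Fin K) :
    devValue G j (fun h τ s a => Function.update a j (φ h τ s (a j))) alg β T hs τ s k
      ≤ (learner G β (before T k) j).V q s := by
  induction hs generalizing q τ s k with
  | nil => exact (learner_V_mem hβ (hT.of_prefix (hT.before_prefix k)) j q s).1
  | cons h hs ih =>
    obtain ⟨h1, h2⟩ := drop_finRange_eq_cons hq
    obtain rfl : q = h.castSucc := Fin.ext (by simp [h1])
    have hlen : ((h :: hs).length : ℝ) = (H : ℝ) - (h : ℕ) := by
      rw [hq, List.length_drop, List.length_finRange, Fin.val_castSucc, Nat.cast_sub h.2.le]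
    have hle := (devValue_mem G j (fun h τ s a => Function.update a j (φ h τ s (a j))) alg β T
      (h :: hs) τ s k).2
    rw [hlen] at hle
    rw [learner_V]
    -- At an unvisited state the estimate is the number of remaining steps, an upper bound for every
    -- value.
    by_cases h0 : hits (before T k) h s = []
    · rw [if_pos h0]; exact hle
    rw [if_neg h0]
    refine le_min hle ?_
    rw [learner_Vt _ _ _ _ _ _ h0, devValue, rexp_outStep, if_neg h0]
    set L := hits (before T k) h s with hL
    obtain ⟨ht1, ht2⟩ := hits_before_eq_take hT k h s
    rw [← hL] at ht1 ht2
    have hL1 : 1 ≤ L.length := List.length_pos_iff.mpr h0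
    have hLK : L.length ≤ K := ht2.trans (hT.length_hits_le h s)
    set ψ := φ h τ s with hψ
    -- The induction hypothesis at the replaced index. Step `h + 1` has not yet been taken in that
    -- episode, so the estimate at the start of the episode is the one used at the visit. At this
    -- past and state the modification reduces to a single map `ψ`, which is why swap regret
    -- suffices.
    have step1 : ∀ p ∈ L, rexp (pmfPi fun i => policyAt G alg β T p.2.ep i h s) (fun a =>
        G.r j h s (Function.update a j (ψ (a j)))
          + rexp (G.P h s (Function.update a j (ψ (a j)))) fun s' =>
            devValue G j (fun h τ s a => Function.update a j (φ h τ s (a j))) alg β T hs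
              (τ ++ [(s, Function.update a j (ψ (a j)))]) s' p.2.ep)
        ≤ swapValue G alg β p.1 h s j ψ (nextV G β p.1 j h) := by
      intro p hp
      obtain ⟨_, _, e3, e4⟩ := at_visit (G := G) (alg := alg) (β := β) hT hp
      rw [← rexp_pmfPi_eq_swapValue]
      simp only [e3]
      refine rexp_mono fun a => add_le_add_right (rexp_mono fun s' => ?_) _
      rw [← e4]
      exact ih h.succ h2 _ s' p.2.ep
    refine (wavg_mono step1).trans ?_
    have hr := hg.regret j h s L.length hL1 ht2 ψ
    have he := hg.est j h s L.length hL1 ht2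
    rw [← ht1] at hr he
    -- Regret removes the swap, concentration then replaces expected returns by observed ones, and
    -- the bonus pays for both.
    have hr' : wavg H L (fun p => swapValue G alg β p.1 h s j ψ (nextV G β p.1 j h)
        - swapValue G alg β p.1 h s j id (nextV G β p.1 j h)) ≤ H * ξ j L.length := by
      refine le_of_eq_of_le ?_ (mul_le_mul_of_nonneg_left hr (Nat.cast_nonneg H))
      rw [← wavg_const_mul]
      refine wavg_congr fun p hp => ?_
      exact swapValue_sub_eq_lossGap alg hβ
        (at_visit (G := G) (alg := alg) (β := β) hT hp).1 h s j ψ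
    have he' : wavg H L (fun p => swapValue G alg β p.1 h s j id (nextV G β p.1 j h)
        - (G.r j h s p.2.act + nextV G β p.1 j h p.2.nxt)) ≤ ε L.length := by
      refine le_of_eq_of_le (wavg_congr fun p hp => ?_) he
      have hc := (at_visit (G := G) (alg := alg) (β := β) hT hp).1
      have e : estReturn G β j h s p.1 p.2.ep
          = fun y => G.r j h s y.1 + nextV G β p.1 j h y.2 :=
        funext fun y => estReturn_eq hβ hc j h s p.2.ep y
      unfold deviation
      rw [e, rexp_outLaw_eq_swapValue]
    rw [wavg_sub] at hr' he'
    have := hβ1 j L.length hL1 hLK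
    linarith

/-- The gap between the estimates and the values of the output policy propagates backwards. -/
theorem V_sub_certValue_le
    (hβ : ∀ j t, 1 ≤ t → t ≤ K → 0 ≤ ∑ i ∈ Finset.Icc 1 t, lrW H t i * β j i)
    (hT : Chronological T) (hg : GoodRecord G alg β ξ ε T) (j : Fin m) (h : Fin H) (s : Fin S)
    (k : Fin K) :
    (learner G β (before T k) j).V h.castSucc s
        - certValue G j alg β T ((List.finRange H).drop h) s k
      ≤ (if (hits (before T k) h s).length = 0 then (H : ℝ) else
          ∑ i ∈ Finset.Icc 1 (hits (before T k) h s).length,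
            lrW H (hits (before T k) h s).length i * β j i + ε (hits (before T k) h s).length)
        + wavg H (hits (before T k) h s) fun p =>
          (learner G β (before T p.2.ep) j).V h.succ p.2.nxt
            - certValue G j alg β T ((List.finRange H).drop (h + 1)) p.2.nxt p.2.ep := by
  have hh : (0 : ℝ) ≤ ((h : ℕ) : ℝ) := by positivity
  -- Without earlier visits the gap is at most $H$ and the average is empty.
  by_cases h0 : hits (before T k) h s = []
  · have h1 := (learner_V_mem (G := G) hβ (hT.of_prefix (hT.before_prefix k)) j h.castSucc s).2
    have h2 : 0 ≤ certValue G j alg β T ((List.finRange H).drop h) s k :=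
      (devValue_mem _ _ _ _ _ _ _ _ _ _).1
    rw [h0]
    simp only [List.length_nil, if_true, wavg_nil]
    simp only [Fin.val_castSucc] at h1
    linarith
  have hcons : (List.finRange H).drop h = h :: (List.finRange H).drop (h + 1) := by
    rw [List.drop_eq_getElem_cons (by simp)]; simp
  rw [learner_V, if_neg h0, if_neg (by simpa using h0), hcons, certValue_cons, rexp_outStep,
    if_neg h0]
  obtain ⟨ht1, ht2⟩ := hits_before_eq_take hT k h s
  set L := hits (before T k) h s with hL
  have hL1 : 1 ≤ L.length := List.length_pos_iff.mpr h0
  have hmin := min_le_right ((H : ℝ) - (h : ℕ)) ((learner G β (before T k) j).Vt h s)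
  have hVt := learner_Vt G β (before T k) j h s h0
  rw [← hL] at hVt
  have hc := hg.cert j h s L.length hL1 ht2
  rw [← ht1] at hc
  have hc' : wavg H L (fun p => G.r j h s p.2.act
        + certValue G j alg β T ((List.finRange H).drop (h + 1)) p.2.nxt p.2.ep)
      - wavg H L (fun p => rexp (pmfPi fun i => policyAt G alg β T p.2.ep i h s) fun a =>
        G.r j h s a + rexp (G.P h s a) fun s' =>
          certValue G j alg β T ((List.finRange H).drop (h + 1)) s' p.2.ep) ≤ ε L.length := by
    rw [← wavg_sub]
    refine le_of_eq_of_le (wavg_congr fun p hp => ?_) hc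
    obtain ⟨_, e2, e3, _⟩ := at_visit (G := G) (alg := alg) (β := β) hT hp
    unfold deviation certReturn
    simp only [e3, rexp_sub, rexp_const, certValue_congr G j alg β _ _ _ e2]
    unfold outLaw
    rw [rexp_outcome]
    simp only [rexp_add, rexp_const]
    ring
  -- Estimate and certified value are compared along the same observed transitions, so the rewards
  -- cancel.
  have e4 : wavg H L (fun p => G.r j h s p.2.act + nextV G β p.1 j h p.2.nxt)
      - wavg H L (fun p => G.r j h s p.2.act
        + certValue G j alg β T ((List.finRange H).drop (h + 1)) p.2.nxt p.2.ep)
      = wavg H L fun p => (learner G β (before T p.2.ep) j).V h.succ p.2.nxt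
            - certValue G j alg β T ((List.finRange H).drop (h + 1)) p.2.nxt p.2.ep := by
    rw [← wavg_sub]
    refine wavg_congr fun p hp => ?_
    rw [← (at_visit (G := G) (alg := alg) (β := β) hT hp).2.2.2]
    unfold nextV
    ring
  dsimp only
  linarith

end gap

/-! ## The correlated equilibrium gap of the output policy -/

section final
variable {m H S K : ℕ} {A : Fin m → ℕ} [∀ j, NeZero (A j)] {G : MarkovGame m H S A}
  {alg : ∀ (B : ℕ) [NeZero B], BanditAlg B} {β : Fin m → ℕ → ℝ}
  {ξ : Fin m → ℕ → ℝ} {ε : ℕ → ℝ} {T : List (Visit H S K A)}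

theorem one_add_inv_pow_le (H : ℕ) (hH : 1 ≤ H) : (1 + 1 / (H : ℝ)) ^ H ≤ 3 := by
  have h1 : (1 + 1 / (H : ℝ)) ^ H ≤ Real.exp (1 / H) ^ H :=
    pow_le_pow_left₀ (by positivity) (by rw [add_comm]; exact Real.add_one_le_exp _) H
  have hH' : (H : ℝ) ≠ 0 := by positivity
  rw [← Real.exp_nat_mul, mul_one_div_cancel hH'] at h1
  linarith [Real.exp_one_lt_d9]

/-- By optimism the gain from a modification is at most the average over `k` of the gap at the first
step; the recursion over the levels then bounds the sum of the gaps. The condition `hE` runs over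
all possible visit counts, as the actual ones are random. -/
theorem value_modify_sub_value_le [NeZero H] [NeZero K]
    (hβ : ∀ j t, 1 ≤ t → t ≤ K → 0 ≤ ∑ i ∈ Finset.Icc 1 t, lrW H t i * β j i)
    (hβ1 : ∀ j t, 1 ≤ t → t ≤ K → H * ξ j t + ε t ≤ ∑ i ∈ Finset.Icc 1 t, lrW H t i * β j i)
    (hT : IsRecord G (allSteps K H) T) (hg : GoodRecord G alg β ξ ε T) (j : Fin m) {E : ℝ}
    (hE0 : 0 ≤ E)
    (hE : ∀ N : Fin S → ℕ, ∑ s, N s = K → ∑ s, ∑ n ∈ Finset.range (N s),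
      (if n = 0 then (H : ℝ) else ∑ i ∈ Finset.Icc 1 n, lrW H n i * β j i + ε n) ≤ E)
    (φ : Modification H S A j) :
    G.value j ((outputPolicy G alg β T).modify j φ) - G.value j (outputPolicy G alg β T)
      ≤ 3 * H * E / K := by
  have hTc := hT.chronological
  have hH1 : 1 ≤ H := NeZero.pos H
  have hK0 : (0 : ℝ) < K := by exact_mod_cast NeZero.pos K
  obtain ⟨vis, hvT, hvis, sto, hs0, hst, hsn⟩ := hT.exists_visit
  let gap : Fin (H + 1) → Fin K → ℝ := fun q k =>
    (learner G β (before T k) j).V q (sto k q)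
      - certValue G j alg β T ((List.finRange H).drop q) (sto k q) k
  -- Optimism for the trivial modification. Nonnegativity is needed to sum the weighted averages at
  -- the price of a factor $1+1/H$.
  have hgap : ∀ q k, 0 ≤ gap q k := by
    intro q k
    have := devValue_le_V hβ hβ1 hTc hg j (fun _ _ _ a => a) _ q rfl [] (sto k q) k
    simp only [Function.update_eq_self] at this
    exact sub_nonneg.mpr this
  have hstep : ∀ h : Fin H, ∑ k, gap h.castSucc k ≤ E + (1 + 1 / H) * ∑ k, gap h.succ k := by
    intro h
    refine sum_le_of_le_wavg hH1 (fun k => sto k h.castSucc) _ _ (hgap h.succ) _ hE fun k => ?_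
    have hb := V_sub_certValue_le hβ hTc hg j h (sto k h.castSucc) k
    have hc := hits_before_congr vis hvT hvis k h (sto k h.castSucc) id
    simp only [id, hst] at hc
    have hl := congrArg List.length hc
    rw [List.length_map, List.length_map] at hl
    rw [hl] at hb
    refine hb.trans (le_of_eq ?_)
    congr 1
    rw [← wavg_map H _ (fun p : List (Visit H S K A) × Visit H S K A => p.2) (fun v =>
      (learner G β (before T v.ep) j).V h.succ v.nxt
        - certValue G j alg β T ((List.finRange H).drop (h + 1)) v.nxt v.ep), hc, wavg_map]
    refine wavg_congr fun k' _ => ?_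
    rw [(hvis k' h).1, hsn]
    rfl
  have hlast : ∑ k, gap (Fin.last H) k = 0 := by
    refine Finset.sum_eq_zero fun k _ => ?_
    simp only [gap, learner_V_last]
    rw [List.drop_of_length_le (by simp)]
    simp [certValue, devValue]
  have hρ : (1 : ℝ) ≤ 1 + 1 / H := by
    have : (0 : ℝ) ≤ 1 / H := by positivity
    linarith
  have hind : ∀ q : Fin (H + 1), ∑ k, gap q k ≤ E * ((H - q : ℕ) * (1 + 1 / (H : ℝ)) ^ (H - q : ℕ)) := by
    intro q
    induction q using Fin.reverseInduction with
    | last => rw [hlast]; simp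
    | cast h ih =>
      obtain ⟨n, hn⟩ : ∃ n, H - (h : ℕ) = n + 1 := ⟨H - h - 1, by have := h.2; omega⟩
      have hn' : H - (h.succ : ℕ) = n := by simp only [Fin.val_succ]; omega
      rw [hn'] at ih
      rw [Fin.val_castSucc, hn]
      refine (hstep h).trans ?_
      have h1 := mul_le_mul_of_nonneg_left ih (by linarith : (0 : ℝ) ≤ 1 + 1 / H)
      have h2 : (1 : ℝ) ≤ (1 + 1 / (H : ℝ)) ^ (n + 1) := one_le_pow₀ hρ
      have h3 := mul_le_mul_of_nonneg_left h2 hE0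
      push_cast
      rw [pow_succ] at h3 ⊢
      linarith
  have h0 : ∑ k, gap 0 k ≤ 3 * H * E := by
    refine (hind 0).trans ?_
    have := mul_le_mul_of_nonneg_left (one_add_inv_pow_le H hH1)
      (mul_nonneg hE0 (Nat.cast_nonneg (α := ℝ) H))
    simp only [Fin.val_zero, Nat.sub_zero]
    linarith
  rw [value_modify_outputPolicy, value_outputPolicy, ← sub_div, ← Finset.sum_sub_distrib]
  refine div_le_div_of_nonneg_right (le_trans (Finset.sum_le_sum fun k _ => ?_) h0) hK0.le
  have h1 := devValue_le_V hβ hβ1 hTc hg j φ (List.finRange H) 0 rfl [] G.s₁ k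
  simp only [gap, hs0]
  exact sub_le_sub_right h1 _

/-- The trivial bound, which takes over when `K` is small. -/
theorem value_modify_sub_value_le_horizon [NeZero K] (T : List (Visit H S K A)) (j : Fin m)
    (φ : Modification H S A j) :
    G.value j ((outputPolicy G alg β T).modify j φ) - G.value j (outputPolicy G alg β T) ≤ H := by
  have hK0 : (0 : ℝ) < K := by exact_mod_cast NeZero.pos K
  rw [value_modify_outputPolicy, value_outputPolicy, ← sub_div, ← Finset.sum_sub_distrib,
    div_le_iff₀ hK0]
  refine (Finset.sum_le_sum (g := fun _ => (H : ℝ)) fun k _ => ?_).trans (by simp [mul_comm])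
  have h1 := (devValue_mem G j (fun h τ s a => Function.update a j (φ h τ s (a j))) alg β T
    (List.finRange H) [] G.s₁ k).2
  have h2 := (devValue_mem G j (fun _ _ _ a => a) alg β T (List.finRange H) [] G.s₁ k).1
  rw [List.length_finRange] at h1
  linarith

/-! ## The probability of the good events -/

theorem estReturn_mem {m H S K : ℕ} {A : Fin m → ℕ} {G : MarkovGame m H S A}
    {β : Fin m → ℕ → ℝ} (j : Fin m) (h : Fin H) (s : Fin S) (T : List (Visit H S K A)) (k : Fin K)
    (y : (∀ j, Fin (A j)) × Fin S) : estReturn G β j h s T k y ∈ Set.Icc (0 : ℝ) (2 * H) := by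
  have hH : (1 : ℝ) ≤ H := by exact_mod_cast h.pos
  have h1 := G.r_mem j h s y.1
  have h2 : max 0 (min (H : ℝ) (nextV G β T j h y.2)) ≤ H :=
    max_le (by linarith) (min_le_left _ _)
  have h3 := le_max_left 0 (min (H : ℝ) (nextV G β T j h y.2))
  unfold estReturn
  exact ⟨by linarith [h1.1], by linarith [h1.2]⟩

theorem certReturn_mem (j : Fin m) (h : Fin H) (s : Fin S) (T : List (Visit H S K A)) (k : Fin K)
    (y : (∀ j, Fin (A j)) × Fin S) : certReturn G alg β j h s T k y ∈ Set.Icc (0 : ℝ) (2 * H) := by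
  have hH : (1 : ℝ) ≤ H := by exact_mod_cast h.pos
  have h1 := G.r_mem j h s y.1
  have h2 := devValue_mem G j (fun _ _ _ a => a) alg β T ((List.finRange H).drop (h + 1)) [] y.2 k
  have h3 : (((List.finRange H).drop (h + 1)).length : ℝ) ≤ H := by
    rw [List.length_drop, List.length_finRange]; exact_mod_cast Nat.sub_le _ _
  unfold certReturn certValue
  exact ⟨by linarith [h1.2, h2.2], by linarith [h1.1, h2.1]⟩

theorem exp_deviation_le [NeZero H] {t : ℕ} (ht : 1 ≤ t) {ι : ℝ} (hι : 0 ≤ ι) :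
    Real.exp (-((10 * Real.sqrt ((H : ℝ) ^ 3 * ι / t)) ^ 2 * t / (32 * (H : ℝ) ^ 3)))
      ≤ Real.exp (-(3 * ι)) := by
  have hH : (0 : ℝ) < H := by exact_mod_cast NeZero.pos H
  have ht0 : (0 : ℝ) < t := by exact_mod_cast ht
  refine Real.exp_le_exp.mpr (neg_le_neg ?_)
  rw [mul_pow, Real.sq_sqrt (by positivity)]
  -- The constant 10 is chosen so that $100/32\ge 3$.
  have : (10 : ℝ) ^ 2 * ((H : ℝ) ^ 3 * ι / t) * t / (32 * (H : ℝ) ^ 3) = 100 / 32 * ι := by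
    field_simp; ring
  rw [this]
  linarith

variable (G alg)

theorem not_good_le [NeZero H]
    (hβ : ∀ j t, 1 ≤ t → t ≤ K → 0 ≤ ∑ i ∈ Finset.Icc 1 t, lrW H t i * β j i) {ι : ℝ} (hι : 0 ≤ ι)
    (hreg : ∀ (j : Fin m) (t : ℕ), 1 ≤ t → t ≤ K →
      ∀ (Z : Type) (κ : Z → Fin (A j) → PMF (unitInterval × Z)) (z : Z),
        (envRun (alg (A j)) κ t [] z).toOuterMeasure
          {ω | ∃ ψ, ξ j t < runRegret (alg (A j)) κ H ψ ω} ≤ ENNReal.ofReal (Real.exp (-ι))) :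
    (trainLaw K G alg β).toOuterMeasure {T | ¬ (IsRecord G (allSteps K H) T ∧
        GoodRecord G alg β ξ (fun t => 10 * Real.sqrt ((H : ℝ) ^ 3 * ι / t)) T)}
      ≤ ENNReal.ofReal (m * H * S * K * (Real.exp (-ι) + 2 * Real.exp (-(3 * ι)))) := by
  let ε : ℕ → ℝ := fun t => 10 * Real.sqrt ((H : ℝ) ^ 3 * ι / t)
  -- The bad events for one player, step, state and number of visits; the last index plus one is the
  -- number of visits, which lies in $\{1,\dots,K\}$.
  let X : Fin m × Fin H × Fin S × Fin K → Set (List (Visit H S K A)) := fun x =>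
    ({T | (x.2.2.2 : ℕ) + 1 ≤ (hits T x.2.1 x.2.2.1).length ∧ ∃ ψ, ξ x.1 (x.2.2.2 + 1) <
      wavg H ((hits T x.2.1 x.2.2.1).take (x.2.2.2 + 1)) fun q =>
        lossGap G alg β x.2.1 x.2.2.1 x.1 ψ q.1} ∪
    {T | (x.2.2.2 : ℕ) + 1 ≤ (hits T x.2.1 x.2.2.1).length ∧ ε (x.2.2.2 + 1) <
      wavg H ((hits T x.2.1 x.2.2.1).take (x.2.2.2 + 1))
        (deviation G alg β x.2.1 x.2.2.1 (estReturn G β x.1 x.2.1 x.2.2.1))}) ∪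
    {T | (x.2.2.2 : ℕ) + 1 ≤ (hits T x.2.1 x.2.2.1).length ∧ ε (x.2.2.2 + 1) <
      wavg H ((hits T x.2.1 x.2.2.1).take (x.2.2.2 + 1))
        (deviation G alg β x.2.1 x.2.2.1 (certReturn G alg β x.1 x.2.1 x.2.2.1))}
  have hX : ∀ x, (trainLaw K G alg β).toOuterMeasure (X x)
      ≤ ENNReal.ofReal (Real.exp (-ι) + 2 * Real.exp (-(3 * ι))) := by
    rintro ⟨j, h, s, t⟩
    have h1 := trainLaw_regret_le G alg β hβ h s j (t + 1) (ξ j (t + 1)) _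
      (hreg j (t + 1) (by omega) t.2)
    have hdev : ∀ g : List (Visit H S K A) → Fin K → (∀ j, Fin (A j)) × Fin S → ℝ,
        (∀ T k y, g T k y ∈ Set.Icc (0 : ℝ) (2 * H)) →
        (trainLaw K G alg β).toOuterMeasure {T | (t : ℕ) + 1 ≤ (hits T h s).length ∧
          ε (t + 1) < wavg H ((hits T h s).take (t + 1)) (deviation G alg β h s g)}
        ≤ ENNReal.ofReal (Real.exp (-(3 * ι))) := fun g hg =>
      (trainLaw_deviation_le G alg β h s (by omega) g hg (by positivity)).trans
        (ENNReal.ofReal_le_ofReal (exp_deviation_le (by omega) hι))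
    have h2 := hdev _ (estReturn_mem (G := G) (β := β) j h s)
    have h3 := hdev _ (certReturn_mem (G := G) (alg := alg) (β := β) j h s)
    refine ((measure_union_le _ _).trans
      (add_le_add ((measure_union_le _ _).trans (add_le_add h1 h2)) h3)).trans (le_of_eq ?_)
    rw [← ENNReal.ofReal_add (by positivity) (by positivity),
      ← ENNReal.ofReal_add (by positivity) (by positivity)]
    congr 1; ring
  have hsub : {T | ¬ (IsRecord G (allSteps K H) T ∧ GoodRecord G alg β ξ ε T)}
      ∩ (trainLaw K G alg β).support ⊆ ⋃ x, X x := by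
    rintro T ⟨hT, hTs⟩
    have hrec := isRecord_of_mem_support_trainLaw G alg β hTs
    have hlen := fun h s => hrec.chronological.length_hits_le h s
    by_contra hU
    refine hT ⟨hrec, ?_⟩
    simp only [Set.mem_iUnion, not_exists] at hU
    have key : ∀ j h s t, 1 ≤ t → t ≤ (hits T h s).length →
        ∃ k : Fin K, t = k + 1 ∧ T ∉ X (j, h, s, k) := by
      intro j h s t h1 h2
      have := hlen h s
      exact ⟨⟨t - 1, by omega⟩, by simp only; omega, hU _⟩
    constructor
    · intro j h s t h1 h2 ψ
      obtain ⟨k, rfl, hk⟩ := key j h s t h1 h2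
      by_contra hlt
      exact hk (Or.inl (Or.inl ⟨h2, ψ, not_le.mp hlt⟩))
    · intro j h s t h1 h2
      obtain ⟨k, rfl, hk⟩ := key j h s t h1 h2
      by_contra hlt
      exact hk (Or.inl (Or.inr ⟨h2, not_le.mp hlt⟩))
    · intro j h s t h1 h2
      obtain ⟨k, rfl, hk⟩ := key j h s t h1 h2
      by_contra hlt
      exact hk (Or.inr ⟨h2, not_le.mp hlt⟩)
  refine (PMF.toOuterMeasure_mono _ hsub).trans ((measure_iUnion_fintype_le _ _).trans ?_)
  refine (Finset.sum_le_sum fun x _ => hX x).trans (le_of_eq ?_)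
  rw [Finset.sum_const, Finset.card_univ, ← ENNReal.ofReal_nsmul]
  congr 1
  simp only [Fintype.card_prod, Fintype.card_fin, nsmul_eq_mul]
  push_cast
  ring

theorem ceProb_ge [NeZero H] [NeZero K] {δ x : ℝ} (hδ0 : 0 ≤ δ)
    {ε : ℕ → ℝ}
    (hbad : (trainLaw K G alg β).toOuterMeasure {T | ¬ (IsRecord G (allSteps K H) T ∧
      GoodRecord G alg β ξ ε T)} ≤ ENNReal.ofReal δ)
    (hgood : ∀ T : List (Visit H S K A), IsRecord G (allSteps K H) T → GoodRecord G alg β ξ ε T →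
      G.IsApproxCE (outputPolicy G alg β T) x) :
    ENNReal.ofReal (1 - δ) ≤ ceProb K G alg β x := by
  have h1 := one_le_toOuterMeasure_add_compl (trainLaw K G alg β)
    {T | G.IsApproxCE (outputPolicy G alg β T) x}
  have h2 : (trainLaw K G alg β).toOuterMeasure {T | G.IsApproxCE (outputPolicy G alg β T) x}ᶜ
      ≤ ENNReal.ofReal δ := by
    refine (measure_mono ?_).trans hbad
    intro T hT hT'
    exact hT (hgood T hT'.1 hT'.2)
  rw [ENNReal.ofReal_sub _ hδ0, ENNReal.ofReal_one]
  exact tsub_le_iff_right.mpr (h1.trans (add_le_add_right h2 _))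

end final

/-! ## The guarantee under a regret bound for the subroutine -/

theorem inv_sqrt_succ_le (n : ℕ) :
    1 / Real.sqrt (n + 1 : ℕ) ≤ 2 * (Real.sqrt (n + 1 : ℕ) - Real.sqrt n) := by
  have h1 : (0 : ℝ) < Real.sqrt (n + 1 : ℕ) := Real.sqrt_pos.mpr (by positivity)
  have h2 : Real.sqrt (n + 1 : ℕ) ^ 2 = n + 1 := by
    rw [Real.sq_sqrt (by positivity)]; push_cast; ring
  have h3 : Real.sqrt n ^ 2 = (n : ℝ) := Real.sq_sqrt (by positivity)
  rw [div_le_iff₀ h1]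
  nlinarith [sq_nonneg (Real.sqrt (n + 1 : ℕ) - Real.sqrt n)]

/-- The index is the number of earlier visits, so the first visit costs `h` and the bonuses run only
up to $N-1$. The square roots telescope by `inv_sqrt_succ_le`. -/
theorem sum_range_bonus_le {b X : ℕ → ℝ} {K : ℕ} {a c d q : ℝ}
    (hb : ∀ n, 1 ≤ n → n ≤ K → b n ≤ c * (a * X n) + d * Real.sqrt (q / n))
    (hX : ∀ n, 1 ≤ n → 0 ≤ c * (a * X n)) (hd : 0 ≤ d) (hq : 0 ≤ q) (h : ℝ) (hh : 0 ≤ h) {N : ℕ}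
    (hN : N ≤ K) :
    ∑ n ∈ Finset.range N, (if n = 0 then h else b n)
      ≤ h + c * (a * ∑ n ∈ Finset.Icc 1 N, X n) + d * (Real.sqrt q * (2 * Real.sqrt N)) := by
  have key : ∀ N, N ≤ K → ∑ n ∈ Finset.range (N + 1), (if n = 0 then h else b n)
      ≤ h + c * (a * ∑ n ∈ Finset.Icc 1 N, X n) + d * (Real.sqrt q * (2 * Real.sqrt N)) := by
    intro N
    induction N with
    | zero => simp
    | succ N ih =>
      intro hN
      rw [Finset.sum_range_succ, Finset.sum_Icc_succ_top (by omega), if_neg (by omega)]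
      have h1 := ih (by omega)
      have h2 := hb (N + 1) (by omega) hN
      rw [Real.sqrt_div hq, div_eq_mul_one_div] at h2
      have h3 := mul_le_mul_of_nonneg_left (inv_sqrt_succ_le N)
        (mul_nonneg hd (Real.sqrt_nonneg q))
      linarith
  rcases N with _ | N
  · simpa using hh
  · refine (key N (by omega)).trans ?_
    rw [Finset.sum_Icc_succ_top (by omega)]
    have h1 := hX (N + 1) (by omega)
    have h2 : Real.sqrt N ≤ Real.sqrt (N + 1 : ℕ) := Real.sqrt_le_sqrt (by push_cast; linarith)
    have h3 := mul_le_mul_of_nonneg_left h2 (mul_nonneg hd (Real.sqrt_nonneg q))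
    linarith

theorem sum_sqrt_le {S K : ℕ} (N : Fin S → ℕ) (hN : ∑ s, N s = K) :
    ∑ s, Real.sqrt (N s) ≤ Real.sqrt (S * K) := by
  refine Real.le_sqrt_of_sq_le ((sq_sum_le_card_mul_sum_sq (s := Finset.univ)).trans (le_of_eq ?_))
  rw [Finset.card_univ, Fintype.card_fin, ← hN]
  push_cast
  congr 1
  exact Finset.sum_congr rfl fun s _ => Real.sq_sqrt (by positivity)

theorem sum_concave_le {S K : ℕ} (hS : 0 < S) {Y : ℝ → ℝ} (hY : ConcaveOn ℝ (Set.Ici 0) Y)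
    (N : Fin S → ℕ) (hN : ∑ s, N s = K) : ∑ s, Y (N s) ≤ S * Y (K / S) := by
  have hS' : (0 : ℝ) < S := by exact_mod_cast hS
  have := hY.le_map_sum (t := Finset.univ) (w := fun _ : Fin S => 1 / (S : ℝ))
    (p := fun s => (N s : ℝ)) (fun _ _ => by positivity)
    (by simp [mul_inv_cancel₀ hS'.ne']) (fun _ _ => by simp)
  simp only [smul_eq_mul, ← Finset.mul_sum] at this
  rw [← Nat.cast_sum, hN, one_div_mul_eq_div, one_div_mul_eq_div, div_le_iff₀ hS'] at this
  linarith

/-- At integers `Y` dominates a sum of nonnegative terms; $K/S$ lies between the integers 0 and $K$,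
and concavity does the rest. -/
theorem cumulative_nonneg {X : ℕ → ℝ} {Y : ℝ → ℝ} (hX : ∀ t, 1 ≤ t → 0 ≤ X t)
    (hXY : ∀ t : ℕ, ∑ n ∈ Finset.Icc 1 t, X n ≤ Y t) (hY : ConcaveOn ℝ (Set.Ici 0) Y)
    {S K : ℕ} (hS : 0 < S) : 0 ≤ Y (K / S) := by
  have h0 : ∀ t : ℕ, 0 ≤ Y t := fun t =>
    (Finset.sum_nonneg fun n hn => hX n (Finset.mem_Icc.mp hn).1).trans (hXY t)
  have h1 : (1 : ℝ) ≤ S := by exact_mod_cast hS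
  have := hY.min_le_of_mem_Icc (x := 0) (y := (K : ℝ)) (z := (K : ℝ) / S) (by simp) (by simp)
    ⟨by positivity, div_le_self (by positivity) h1⟩
  exact (le_min (by simpa using h0 0) (h0 K)).trans this

/-- The rate $R=\sqrt{SH^5\iota/K}$ is the geometric mean of $SH^2/K$ and $H^3\iota$. If the first
is smaller, it is at most $R$ and the cost of the first visits is absorbed; the coefficient of $R$
is $3+6(c+10)$. Otherwise $H\le 2H^3\iota\le 2R$ and the trivial bound suffices. -/
theorem gap_le_rate {H S K ι c y g : ℝ} (hH : 1 ≤ H) (hS : 0 < S) (hK : 0 < K) (hι : 1 / 2 ≤ ι)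
    (hc : 0 ≤ c) (hy : 0 ≤ y) (h1 : g ≤ H)
    (h2 : g ≤ 3 * H * (S * H + c * (H * (S * y))
      + (c + 10) * (Real.sqrt (H ^ 3 * ι) * (2 * Real.sqrt (S * K)))) / K) :
    g ≤ (9 * c + 63) * (H ^ 2 * S / K * y + Real.sqrt (S * H ^ 5 * ι / K)) := by
  have hι0 : 0 < ι := by linarith
  set R := Real.sqrt (S * H ^ 5 * ι / K) with hR
  have hR0 : 0 ≤ R := Real.sqrt_nonneg _
  have hR2 : R ^ 2 = S * H ^ 2 / K * (H ^ 3 * ι) := by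
    rw [hR, Real.sq_sqrt (by positivity)]; field_simp
  have hZ : 0 ≤ H ^ 2 * S / K * y := by positivity
  rcases le_total (S * H ^ 2 / K) (H ^ 3 * ι) with h | h
  · have h3 : S * H ^ 2 / K ≤ R := by
      refine abs_le_of_sq_le_sq' ?_ hR0 |>.2
      rw [hR2, sq]
      exact mul_le_mul_of_nonneg_left h (by positivity)
    have h4 : H * (Real.sqrt (H ^ 3 * ι) * Real.sqrt (S * K)) / K = R := by
      rw [hR, ← Real.sqrt_mul (by positivity), eq_comm, Real.sqrt_eq_iff_mul_self_eq_of_pos,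
        div_mul_div_comm, mul_mul_mul_comm H, Real.mul_self_sqrt (by positivity)]
      · field_simp
      · exact div_pos (mul_pos (by linarith) (Real.sqrt_pos.mpr (by positivity))) hK
    have h5 : 3 * H * (S * H + c * (H * (S * y))
        + (c + 10) * (Real.sqrt (H ^ 3 * ι) * (2 * Real.sqrt (S * K)))) / K
        = 3 * (S * H ^ 2 / K) + 3 * c * (H ^ 2 * S / K * y)
          + 6 * (c + 10) * (H * (Real.sqrt (H ^ 3 * ι) * Real.sqrt (S * K)) / K) := by
      ring
    rw [h5, h4] at h2
    have := mul_nonneg hc hZ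
    have := mul_nonneg hc hR0
    linarith
  · have h3 : H ^ 3 * ι ≤ R := by
      refine abs_le_of_sq_le_sq' ?_ hR0 |>.2
      rw [hR2, sq]
      exact mul_le_mul_of_nonneg_right h (by positivity)
    have h4 : H * (1 / 2) ≤ H ^ 3 * ι :=
      mul_le_mul (le_self_pow₀ hH (by norm_num)) hι (by norm_num) (by positivity)
    have := mul_nonneg hc hZ
    have := mul_nonneg hc hR0
    linarith

theorem le_maxA {m : ℕ} {A : Fin m → ℕ} (j : Fin m) : A j ≤ maxA A :=
  Finset.le_sup (f := A) (Finset.mem_univ j)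

theorem iota_denom_ge {m H S K : ℕ} {A : Fin m → ℕ} [NeZero m] [NeZero H] [NeZero K]
    (hS : 0 < S) : (maxA A : ℝ) ≤ m * H * S * maxA A * K := by
  have h : 1 ≤ m * H * S * K := Nat.one_le_iff_ne_zero.mpr (by
    have := NeZero.ne m
    have := NeZero.ne H
    have := NeZero.ne K
    simp [*, hS.ne'])
  have h' : (1 : ℝ) ≤ m * H * S * K := by exact_mod_cast h
  have := mul_le_mul_of_nonneg_right h' (Nat.cast_nonneg (α := ℝ) (maxA A))
  linarith

/-! ### From regret bounds to the probability of an approximate equilibrium. -/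

section guarantee
variable {m H S : ℕ} {A : Fin m → ℕ} [∀ j, NeZero (A j)]

theorem one_le_maxA [NeZero m] : 1 ≤ maxA A :=
  (NeZero.pos (A 0)).trans_le (le_maxA 0)

theorem exp_neg_iota [NeZero m] [NeZero H] {K : ℕ} [NeZero K] (hS : 0 < S) {δ : ℝ} (hδ : 0 < δ) :
    Real.exp (-iota H S K A δ) = δ / (m * H * S * maxA A * K) := by
  have hA : 0 < maxA A := one_le_maxA (A := A)
  have hm : 0 < m := NeZero.pos m
  have hH : 0 < H := NeZero.pos H
  have hK : 0 < K := NeZero.pos K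
  unfold iota
  rw [← Real.log_inv, Real.exp_log (by positivity), inv_div]

theorem log_maxA_le_iota [NeZero m] [NeZero H] {K : ℕ} [NeZero K] (hS : 0 < S) {δ : ℝ}
    (hδ0 : 0 < δ) (hδ1 : δ < 1) : Real.log (maxA A) ≤ iota H S K A δ := by
  have hA : 0 < maxA A := one_le_maxA (A := A)
  refine Real.log_le_log (by positivity) ((iota_denom_ge (m := m) (H := H) (K := K) hS).trans ?_)
  rw [le_div_iff₀ hδ0]
  exact mul_le_of_le_one_right (by positivity) hδ1.le

/-- A single action leaves nothing to modify. This case is separate because the union bound takes a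
factor 2 from $A\ge2$. -/
theorem isApproxCE_of_maxA_le_one {m H S : ℕ} {A : Fin m → ℕ} (G : MarkovGame m H S A) (hA : maxA A ≤ 1)
    (π : JointPolicy H S A) {x : ℝ} (hx : 0 ≤ x) : G.IsApproxCE π x := by
  intro j φ
  have hsub : Subsingleton (Fin (A j)) := by
    have := (le_maxA (A := A) j).trans hA
    rw [Fin.subsingleton_iff_le_one]; exact this
  have : G.value j (π.modify j φ) = G.value j π := by
    unfold MarkovGame.value JointPolicy.modify
    simp only
    congr 1
    funext ω
    congr 1
    funext h τ s i
    rw [Subsingleton.elim (φ h τ s (π.act j h ω τ s)) (π.act j h ω τ s)]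
    exact congrFun (Function.update_eq_self j fun i => π.act i h ω τ s) i
  rw [this, sub_self]
  exact hx

theorem ceProb_ge_of_maxA_le_one {K : ℕ} [NeZero K] (G : MarkovGame m H S A)
    (alg : ∀ (B : ℕ) [NeZero B], BanditAlg B) (β : Fin m → ℕ → ℝ) (hA : maxA A ≤ 1) {x δ : ℝ}
    (hx : 0 ≤ x) (hδ : 0 ≤ δ) : ENNReal.ofReal (1 - δ) ≤ ceProb K G alg β x := by
  have : {T : List (Visit H S K A) | G.IsApproxCE (outputPolicy G alg β T) x} = Set.univ :=
    Set.eq_univ_of_forall fun T => isApproxCE_of_maxA_le_one G hA _ hx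
  unfold ceProb
  rw [this, toOuterMeasure_eq_pexp]
  simp only [Set.indicator_univ, pexp_const]
  exact ENNReal.ofReal_le_one.mpr (by linarith)

/-- The common source of both parts. The regret bound is needed only at the confidence level
$e^{-\iota}$, so it may come from an algorithm tuned to $\iota$. The bound `ξ` depends on the
player; `X` and `Y` are uniform over the players. -/
theorem ceProb_ge_of_regret [NeZero m] [NeZero H] {K : ℕ} [NeZero K] (G : MarkovGame m H S A)
    (alg : ∀ (B : ℕ) [NeZero B], BanditAlg B) (β : Fin m → ℕ → ℝ) (hA : 2 ≤ maxA A) {δ : ℝ}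
    (hδ0 : 0 < δ) (hδ1 : δ < 1) {ξ : Fin m → ℕ → ℝ} {X : ℕ → ℝ} {Y : ℝ → ℝ} {c : ℝ} (hc : 0 ≤ c)
    (hξ : ∀ j t, 1 ≤ t → 0 ≤ ξ j t) (hX : ∀ t, 1 ≤ t → 0 ≤ X t)
    (hXY : ∀ t : ℕ, ∑ n ∈ Finset.Icc 1 t, X n ≤ Y t) (hY : ConcaveOn ℝ (Set.Ici 0) Y)
    (hreg : ∀ (j : Fin m) (t : ℕ), 1 ≤ t → t ≤ K →
      ∀ (Z : Type) (κ : Z → Fin (A j) → PMF (unitInterval × Z)) (z : Z),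
        (envRun (alg (A j)) κ t [] z).toOuterMeasure
          {ω | ∃ ψ, ξ j t < runRegret (alg (A j)) κ H ψ ω}
            ≤ ENNReal.ofReal (Real.exp (-iota H S K A δ)))
    (hβ1 : ∀ j t, 1 ≤ t → t ≤ K →
      H * ξ j t + 10 * Real.sqrt ((H : ℝ) ^ 3 * iota H S K A δ / t)
        ≤ ∑ i ∈ Finset.Icc 1 t, lrW H t i * β j i)
    (hβ2 : ∀ j t, 1 ≤ t → t ≤ K → ∑ i ∈ Finset.Icc 1 t, lrW H t i * β j i
      ≤ c * (H * X t + Real.sqrt ((H : ℝ) ^ 3 * iota H S K A δ / t))) :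
    ENNReal.ofReal (1 - δ) ≤ ceProb K G alg β ((9 * c + 63) *
      ((H : ℝ) ^ 2 * S / K * Y ((K : ℝ) / S)
        + Real.sqrt (S * (H : ℝ) ^ 5 * iota H S K A δ / K))) := by
  have hS : 0 < S := G.s₁.pos
  have hH1 : (1 : ℝ) ≤ H := by exact_mod_cast NeZero.pos H
  have hm1 : (1 : ℝ) ≤ m := by exact_mod_cast NeZero.pos m
  have hK0 : (0 : ℝ) < K := by exact_mod_cast NeZero.pos K
  have hS0 : (0 : ℝ) < S := by exact_mod_cast hS
  have hA2 : (2 : ℝ) ≤ maxA A := by exact_mod_cast hA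
  have hexp := exp_neg_iota (m := m) (H := H) (S := S) (A := A) (K := K) hS hδ0
  have hlog := log_maxA_le_iota (m := m) (H := H) (S := S) (A := A) (K := K) hS hδ0 hδ1
  set ι := iota H S K A δ
  have hι : 1 / 2 ≤ ι := by
    have h1 : Real.log 2 ≤ Real.log (maxA A) := Real.log_le_log (by norm_num) hA2
    linarith [Real.log_two_gt_d9]
  have hι0 : 0 ≤ ι := by linarith
  have hbon : ∀ j t, 1 ≤ t → t ≤ K → 0 ≤ ∑ i ∈ Finset.Icc 1 t, lrW H t i * β j i :=
    fun j t h1 h2 => (add_nonneg (mul_nonneg (by positivity) (hξ j t h1))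
      (by positivity)).trans (hβ1 j t h1 h2)
  have hYK := cumulative_nonneg hX hXY hY (S := S) (K := K) hS
  refine ceProb_ge G alg hδ0.le ((not_good_le G alg hbon hι0 hreg).trans
    (ENNReal.ofReal_le_ofReal ?_)) ?_
  · have h1 : Real.exp (-ι) ≤ 1 / 2 := by
      rw [hexp, div_le_iff₀ (by positivity)]
      have := iota_denom_ge (m := m) (H := H) (S := S) (A := A) (K := K) hS
      linarith
    have h2 : Real.exp (-(3 * ι)) = Real.exp (-ι) ^ 3 := by
      rw [← Real.exp_nat_mul]; congr 1; push_cast; ring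
    have h0 := (Real.exp_pos (-ι)).le
    -- $2e^{-3\iota}\le e^{-\iota}$ because $e^{-\iota}\le1/2$. The remaining factor 2 is at most
    -- $A$, which completes the denominator of $e^{-\iota}=\delta/(mHSAK)$.
    have h3 : Real.exp (-ι) + 2 * Real.exp (-(3 * ι)) ≤ 2 * Real.exp (-ι) := by
      rw [h2]
      nlinarith [mul_nonneg h0 h0, mul_nonneg h0 (sub_nonneg.mpr h1),
        mul_nonneg (mul_nonneg h0 h0) (sub_nonneg.mpr h1)]
    have h4 : (maxA A : ℝ) * (m * H * S * K * Real.exp (-ι)) = δ := by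
      rw [hexp]; field_simp
    have h5 : 0 ≤ m * H * S * K * Real.exp (-ι) := by positivity
    have h6 := mul_le_mul_of_nonneg_left h3 (by positivity : (0 : ℝ) ≤ m * H * S * K)
    have h7 := mul_le_mul_of_nonneg_right hA2 h5
    linarith
  · intro T hT hg j φ
    refine gap_le_rate hH1 hS0 hK0 hι hc hYK
      (value_modify_sub_value_le_horizon T j φ)
      (value_modify_sub_value_le hbon hβ1 hT hg j (by positivity) (fun N hN => ?_) φ)
    have hle : ∀ s, N s ≤ K := fun s =>
      hN ▸ Finset.single_le_sum (f := N) (fun _ _ => Nat.zero_le _) (Finset.mem_univ s)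
    have h1 : ∀ s, ∑ n ∈ Finset.range (N s), (if n = 0 then (H : ℝ) else
        ∑ i ∈ Finset.Icc 1 n, lrW H n i * β j i + 10 * Real.sqrt ((H : ℝ) ^ 3 * ι / n))
        ≤ H + c * (H * Y (N s))
          + (c + 10) * (Real.sqrt ((H : ℝ) ^ 3 * ι) * (2 * Real.sqrt (N s))) := by
      intro s
      -- `c` comes from the bonus and 10 from $\varepsilon_n$.
      refine (sum_range_bonus_le (K := K) (a := H) (c := c) (d := c + 10) (q := (H : ℝ) ^ 3 * ι)
        (X := X) (fun n h1 h2 => ?_) (fun n h1 => ?_) (by linarith) (by positivity) H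
        (by positivity) (hle s)).trans ?_
      · have := hβ2 j n h1 h2
        linarith
      · exact mul_nonneg hc (mul_nonneg (by positivity) (hX n h1))
      · have := mul_le_mul_of_nonneg_left (hXY (N s)) (mul_nonneg hc (Nat.cast_nonneg (α := ℝ) H))
        linarith
    refine (Finset.sum_le_sum fun s _ => h1 s).trans ?_
    simp only [Finset.sum_add_distrib, ← Finset.mul_sum]
    have h2 := mul_le_mul_of_nonneg_left (sum_concave_le hS hY N hN)
      (mul_nonneg hc (Nat.cast_nonneg (α := ℝ) H))
    have h3 := mul_le_mul_of_nonneg_left (sum_sqrt_le N hN)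
      (mul_nonneg (by linarith : 0 ≤ c + 10) (Real.sqrt_nonneg ((H : ℝ) ^ 3 * ι)))
    simp only [Finset.sum_const, Finset.card_univ, Fintype.card_fin, nsmul_eq_mul]
    linarith

/-- The guarantee for a subroutine that meets the weighted swap regret requirement. -/
theorem MeetsSwapRegret.ceProb_ge [NeZero m] [NeZero H] {K : ℕ} [NeZero K]
    (G : MarkovGame m H S A) {δ : ℝ} (hδ0 : 0 < δ) (hδ1 : δ < 1)
    {alg : ∀ (B : ℕ) [NeZero B], BanditAlg B} {ξ : ℕ → ℕ → ℝ → ℝ} {Ξ : ℕ → ℝ → ℝ → ℝ}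
    (h : MeetsSwapRegret H alg ξ Ξ) {β : Fin m → ℕ → ℝ} {c : ℝ} (hc : 0 ≤ c)
    (hβ : ∀ (j : Fin m) (t : ℕ), 1 ≤ t → t ≤ K →
      10 * (H * ξ (A j) t (iota H S K A δ) + Real.sqrt ((H : ℝ) ^ 3 * iota H S K A δ / t))
          ≤ ∑ i ∈ Finset.Icc 1 t, lrW H t i * β j i ∧
        ∑ i ∈ Finset.Icc 1 t, lrW H t i * β j i
          ≤ c * (H * ξ (A j) t (iota H S K A δ)
            + Real.sqrt ((H : ℝ) ^ 3 * iota H S K A δ / t))) :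
    ENNReal.ofReal (1 - δ) ≤ ceProb K G alg β ((9 * c + 63) *
      ((H : ℝ) ^ 2 * S / K * Ξ (maxA A) ((K : ℝ) / S) (iota H S K A δ)
        + Real.sqrt (S * (H : ℝ) ^ 5 * iota H S K A δ / K))) := by
  have hS : 0 < S := G.s₁.pos
  have hA1 : 1 ≤ maxA A := one_le_maxA
  have hA1' : (1 : ℝ) ≤ maxA A := by exact_mod_cast hA1
  have hden := iota_denom_ge (m := m) (H := H) (S := S) (A := A) (K := K) hS
  have hexp := exp_neg_iota (m := m) (H := H) (S := S) (A := A) (K := K) hS hδ0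
  set ι := iota H S K A δ
  -- At this level the bounds of the assumption are evaluated at $\log(1/\delta')=\iota$.
  set δ' := Real.exp (-ι) with hδ'
  have h0 : 0 < δ' := Real.exp_pos _
  have h1 : δ' < 1 := by
    rw [hexp, div_lt_one (by linarith)]; linarith
  have hι : Real.log (1 / δ') = ι := by rw [hδ', one_div, ← Real.exp_neg, neg_neg, Real.log_exp]
  have hinst : NeZero (maxA A) := ⟨by omega⟩
  have hX : ∀ t, 1 ≤ t → 0 ≤ ξ (maxA A) t ι := fun t ht => by
    rw [← hι]; exact h.nonneg (B := maxA A) ht h0 h1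
  have hξ : ∀ j t, 1 ≤ t → 0 ≤ ξ (A j) t ι := fun j t ht => by
    rw [← hι]; exact h.nonneg (B := A j) ht h0 h1
  have hXY : ∀ t : ℕ, ∑ n ∈ Finset.Icc 1 t, ξ (maxA A) n ι ≤ Ξ (maxA A) t ι := fun t => by
    rw [← hι]; exact h.cumulative _ t δ' hA1 h0 h1
  have hY : ConcaveOn ℝ (Set.Ici 0) fun t => Ξ (maxA A) t ι := by
    rw [← hι]; exact h.concave _ δ' hA1 h0 h1
  rcases Nat.lt_or_ge (maxA A) 2 with hA | hA
  · refine ceProb_ge_of_maxA_le_one G alg β (by omega) ?_ hδ0.le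
    have := cumulative_nonneg (Y := fun t => Ξ (maxA A) t ι) hX hXY hY
      (S := S) (K := K) hS
    exact mul_nonneg (by linarith)
      (add_nonneg (mul_nonneg (by positivity) this) (Real.sqrt_nonneg _))
  · refine ceProb_ge_of_regret G alg β hA hδ0 hδ1 (ξ := fun j t => ξ (A j) t ι)
      (X := fun t => ξ (maxA A) t ι) (Y := fun t => Ξ (maxA A) t ι) hc hξ hX hXY hY ?_ ?_ ?_
    · intro j t ht _ Z κ z
      have := h.envRun_le (B := A j) κ ht z h0 h1
      rwa [hι] at this
    · intro j t h2 h3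
      refine le_trans ?_ (hβ j t h2 h3).1
      have := mul_nonneg (Nat.cast_nonneg (α := ℝ) H) (hξ j t h2)
      linarith
    · intro j t h2 h3
      refine (hβ j t h2 h3).2.trans ?_
      have : ξ (A j) t ι ≤ ξ (maxA A) t ι := by
        rw [← hι]; exact h.mono _ _ t δ' (NeZero.pos (A j)) (le_maxA j) h2 h0 h1
      gcongr

end guarantee

/-! ## Follow the regularized leader with entropy regularization -/

/-- $(1-x+x^2/2)(1+x+x^2/2)=1+x^4/4\ge1$, and the second factor is at most $e^x$. -/
theorem exp_neg_le_quadratic {x : ℝ} (hx : 0 ≤ x) : Real.exp (-x) ≤ 1 - x + x ^ 2 / 2 := by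
  have h1 := Real.quadratic_le_exp_of_nonneg hx
  have h2 : Real.exp (-x) * Real.exp x = 1 := by rw [← Real.exp_add]; simp
  have h3 : 0 ≤ 1 - x + x ^ 2 / 2 := by nlinarith [sq_nonneg (x - 1)]
  have h4 : 1 ≤ (1 - x + x ^ 2 / 2) * (1 + x + x ^ 2 / 2) := by nlinarith [sq_nonneg (x ^ 2)]
  have h5 : 1 ≤ (1 - x + x ^ 2 / 2) * Real.exp x := h4.trans (mul_le_mul_of_nonneg_left h1 h3)
  refine le_of_mul_le_mul_right ?_ (Real.exp_pos x)
  rw [h2]; exact h5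

section leader
variable {B : ℕ} [NeZero B]

theorem rexp_softmax (x f : Fin B → ℝ) :
    rexp (softmax x) f = (∑ b, Real.exp (x b) * f b) / ∑ b, Real.exp (x b) := by
  unfold rexp softmax
  simp only [PMF.normalize_apply, tsum_fintype]
  rw [← ENNReal.ofReal_sum_of_nonneg fun b _ => (Real.exp_pos _).le, Finset.sum_div]
  refine Finset.sum_congr rfl fun b _ => ?_
  rw [ENNReal.toReal_mul, ENNReal.toReal_inv, ENNReal.toReal_ofReal (Real.exp_pos _).le,
    ENNReal.toReal_ofReal (Finset.sum_nonneg fun b _ => (Real.exp_pos _).le)]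
  ring

/-- The logarithm of the average of `exp (-r * L b)`. -/
def logMean (r : ℝ) (L : Fin B → ℝ) : ℝ := Real.log ((∑ b, Real.exp (-r * L b)) / B)

theorem sum_exp_pos (x : Fin B → ℝ) : 0 < ∑ b, Real.exp (x b) :=
  Finset.sum_pos (fun _ _ => Real.exp_pos _) ⟨0, Finset.mem_univ _⟩

/-- The power mean inequality. It lets the learning rate decrease between rounds without loss in the
potential. -/
theorem logMean_div_le {r r' : ℝ} (hr : 0 < r) (h : r ≤ r') (L : Fin B → ℝ) :
    logMean r L / r ≤ logMean r' L / r' := by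
  have hB : (0 : ℝ) < B := by exact_mod_cast NeZero.pos B
  have hr' : 0 < r' := hr.trans_le h
  have h1 := Real.rpow_arith_mean_le_arith_mean_rpow Finset.univ (fun _ : Fin B => 1 / (B : ℝ))
    (fun b => Real.exp (-r * L b)) (fun _ _ => by positivity)
    (by simp [mul_inv_cancel₀ hB.ne']) (fun _ _ => (Real.exp_pos _).le)
    (p := r' / r) ((one_le_div hr).mpr h)
  have h2 : ∀ b, Real.exp (-r * L b) ^ (r' / r) = Real.exp (-r' * L b) := fun b => by
    rw [← Real.exp_mul]; congr 1; field_simp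
  simp only [h2, one_div_mul_eq_div, ← Finset.sum_div] at h1
  have h3 : 0 < (∑ b, Real.exp (-r * L b)) / B := div_pos (sum_exp_pos _) hB
  have h4 := Real.log_le_log (Real.rpow_pos_of_pos h3 _) h1
  rw [Real.log_rpow h3] at h4
  unfold logMean
  rw [le_div_iff₀ hr']
  refine le_trans (le_of_eq ?_) h4
  ring

/-- One round changes the potential by the logarithm of a softmax mean of $e^{-rg}$; expand it to
second order and use $\log x\le x-1$. Only nonnegativity of the losses is needed, not boundedness.
-/
theorem logMean_add_le {r : ℝ} (hr : 0 ≤ r) (L g : Fin B → ℝ) (hg : ∀ b, 0 ≤ g b) :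
    logMean r (fun b => L b + g b) ≤ logMean r L - r * rexp (softmax fun b => -r * L b) g
      + r ^ 2 / 2 * rexp (softmax fun b => -r * L b) (fun b => g b ^ 2) := by
  have hB : (0 : ℝ) < B := by exact_mod_cast NeZero.pos B
  set p := softmax fun b => -r * L b with hp
  have h1 : (∑ b, Real.exp (-r * (L b + g b))) / B
      = (∑ b, Real.exp (-r * L b)) / B * rexp p fun b => Real.exp (-(r * g b)) := by
    rw [hp, rexp_softmax]
    have := (sum_exp_pos fun b => -r * L b).ne'
    field_simp
    refine Finset.sum_congr rfl fun b _ => ?_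
    rw [← Real.exp_add]; congr 1; ring
  have h2 : 0 < rexp p fun b => Real.exp (-(r * g b)) := by
    rw [hp, rexp_softmax]
    refine div_pos ?_ (sum_exp_pos _)
    exact Finset.sum_pos (fun _ _ => by positivity) ⟨0, Finset.mem_univ _⟩
  have h3 : rexp p (fun b => Real.exp (-(r * g b)))
      ≤ 1 - r * rexp p g + r ^ 2 / 2 * rexp p fun b => g b ^ 2 := by
    rw [← rexp_const_mul, ← rexp_const_mul, ← rexp_const p 1, ← rexp_sub, ← rexp_add]
    refine rexp_mono fun b => ?_
    refine (exp_neg_le_quadratic (mul_nonneg hr (hg b))).trans (le_of_eq ?_)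
    ring
  unfold logMean
  rw [h1, Real.log_mul (div_pos (sum_exp_pos _) hB).ne' h2.ne']
  have := Real.log_le_sub_one_of_pos h2
  linarith

/-- The regret of follow the regularized leader with decreasing rates `r`, for the cumulative
losses `L`. -/
theorem leader_regret_le (L : ℕ → Fin B → ℝ) (hL0 : ∀ b, L 0 b = 0) (hL : ∀ n b, L n b ≤ L (n + 1) b)
    (r : ℕ → ℝ) (hr : ∀ n, 0 < r n) (hanti : ∀ n, r (n + 1) ≤ r n) (b₀ : Fin B) (t : ℕ) :
    ∑ n ∈ Finset.range t, rexp (softmax fun b => -r n * L n b) (fun b => L (n + 1) b - L n b)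
      ≤ L t b₀ + Real.log B / r t + ∑ n ∈ Finset.range t,
        r n / 2 * rexp (softmax fun b => -r n * L n b) (fun b => (L (n + 1) b - L n b) ^ 2) := by
  have hB : (0 : ℝ) < B := by exact_mod_cast NeZero.pos B
  -- The potential $-\frac1r$`logMean` telescopes. It starts from 0 because the logarithm is taken
  -- of an average.
  have key : ∑ n ∈ Finset.range t,
      rexp (softmax fun b => -r n * L n b) (fun b => L (n + 1) b - L n b)
      ≤ -(logMean (r t) (L t) / r t) + ∑ n ∈ Finset.range t,
        r n / 2 * rexp (softmax fun b => -r n * L n b) (fun b => (L (n + 1) b - L n b) ^ 2) := by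
    induction t with
    | zero => simp [logMean, hL0, hB.ne']
    | succ t ih =>
      rw [Finset.sum_range_succ, Finset.sum_range_succ]
      have h1 := logMean_add_le (hr t).le (L t) (fun b => L (t + 1) b - L t b)
        fun b => sub_nonneg.mpr (hL t b)
      simp only [add_sub_cancel] at h1
      have h2 := logMean_div_le (hr (t + 1)) (hanti t) (L (t + 1))
      have h3 := div_le_div_of_nonneg_right h1 (hr t).le
      set u := rexp (softmax fun b => -r t * L t b) (fun b => L (t + 1) b - L t b)
      set v := rexp (softmax fun b => -r t * L t b) (fun b => (L (t + 1) b - L t b) ^ 2)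
      have h4 : (logMean (r t) (L t) - r t * u + r t ^ 2 / 2 * v) / r t
          = logMean (r t) (L t) / r t - u + r t / 2 * v := by
        have := (hr t).ne'
        field_simp
      rw [h4] at h3
      linarith
  refine key.trans (add_le_add_left ?_ _)
  -- Keeping only the comparator in the average costs $\log B/r_t$.
  have h1 : Real.exp (-r t * L t b₀) / B ≤ (∑ b, Real.exp (-r t * L t b)) / B :=
    div_le_div_of_nonneg_right (Finset.single_le_sum (f := fun b => Real.exp (-r t * L t b))
      (fun _ _ => (Real.exp_pos _).le) (Finset.mem_univ b₀)) hB.le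
  have h2 := Real.log_le_log (div_pos (Real.exp_pos _) hB) h1
  rw [Real.log_div (Real.exp_pos _).ne' hB.ne', Real.log_exp] at h2
  have h3 := div_le_div_of_nonneg_right h2 (hr t).le
  have h4 : (-r t * L t b₀ - Real.log B) / r t = -L t b₀ - Real.log B / r t := by
    have := (hr t).ne'
    field_simp
  rw [h4] at h3
  unfold logMean
  linarith

end leader

/-! ## The pathwise regret bound for FTRL_swap -/

section ftrl
variable {B : ℕ} [NeZero B]

theorem softmax_zero : softmax (fun _ : Fin B => (0 : ℝ)) = PMF.uniformOfFintype (Fin B) := by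
  refine PMF.ext fun b => ?_
  simp [softmax, PMF.normalize_apply, tsum_fintype]

theorem rexp_ite_eq {B : ℕ} (p : PMF (Fin B)) (a : Fin B) (y : Fin B → ℝ) :
    rexp p (fun b => if a = b then y b else 0) = (p a).toReal * y a := by
  simp [rexp]

/-- The memory of the algorithm FTRL_swap. -/
def ftrlState (w η γ : ℕ → ℝ) (hist : List (Fin B × ℝ)) : FTRLState B :=
  hist.foldl (ftrlSwapStep w η γ)
    { t := 0, L := fun _ _ => 0, θ := PMF.uniformOfFintype (Fin B) }

variable (w η γ : ℕ → ℝ)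

theorem ftrlSwap_strategy (hist : List (Fin B × ℝ)) :
    (ftrlSwap w η γ B).strategy hist = (ftrlState w η γ hist).θ := rfl

theorem ftrlState_snoc (hist : List (Fin B × ℝ)) (x : Fin B × ℝ) :
    ftrlState w η γ (hist ++ [x]) = ftrlSwapStep w η γ (ftrlState w η γ hist) x := by
  simp [ftrlState]

theorem ftrlState_t (hist : List (Fin B × ℝ)) : (ftrlState w η γ hist).t = hist.length := by
  induction hist using List.reverseRecOn with
  | nil => rfl
  | append_singleton l x ih => rw [ftrlState_snoc]; simp [ftrlSwapStep, ih]

/-- It holds before the first round as well: with zero losses every softmax is uniform, whatever the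
rate `r 0`. -/
theorem ftrlState_stationary (r : ℕ → ℝ) (hr : ∀ n, 1 ≤ n → r n = η n / w n)
    (hist : List (Fin B × ℝ)) :
    ((ftrlState w η γ hist).θ.bind fun b => softmax fun b' =>
      -r hist.length * (ftrlState w η γ hist).L b b') = (ftrlState w η γ hist).θ := by
  induction hist using List.reverseRecOn with
  | nil => simp [ftrlState, softmax_zero, PMF.bind_const]
  | append_singleton l x ih =>
    rw [List.length_append, List.length_singleton, hr _ (by omega), ftrlState_snoc]
    simp only [ftrlSwapStep, ftrlState_t]
    exact Classical.choose_spec (exists_stationary _)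

/-- For each action `b` a leader competes with the fixed action `ψ b` on the estimates scaled by
$\theta(b)$. By stationarity, the total loss of these leaders is the estimated loss of $\theta$
itself, so their regrets add up to a swap regret. No probability enters. -/
theorem ftrlSwap_regret_le (hw : ∀ n, 1 ≤ n → 0 ≤ w n) (hγ : ∀ n, 1 ≤ n → 0 < γ n) (r : ℕ → ℝ)
    (hr : ∀ n, 1 ≤ n → r n = η n / w n) (hr0 : ∀ n, 0 < r n) (hanti : ∀ n, r (n + 1) ≤ r n)
    (hist : List (Fin B × ℝ)) (hx : ∀ p ∈ hist, p.2 ∈ Set.Icc (0 : ℝ) 1) (ψ : Fin B → Fin B)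
    (θ : ℕ → Fin B → ℝ)
    (hθ : ∀ n b, θ n b = ((ftrlSwap w η γ B).strategy (hist.take n) b).toReal) :
    ∑ i : Fin hist.length, w (i + 1) * (θ i hist[i].1 * hist[i].2 / (θ i hist[i].1 + γ (i + 1)))
      ≤ ∑ b, ∑ i : Fin hist.length, w (i + 1) * (θ i b * ((if hist[i].1 = ψ b then hist[i].2 else 0)
          / (θ i (ψ b) + γ (i + 1))))
        + B * (Real.log B / r hist.length)
        + ∑ i : Fin hist.length, r i / 2 * (w (i + 1) ^ 2 / (θ i hist[i].1 + γ (i + 1))) := by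
  let L : Fin B → ℕ → Fin B → ℝ := fun b n b' => (ftrlState w η γ (hist.take n)).L b b'
  have hθ0 : ∀ n b, 0 ≤ θ n b := fun n b => by rw [hθ]; exact ENNReal.toReal_nonneg
  have hθ1 : ∀ n b, θ n b ≤ 1 := fun n b => by rw [hθ]; exact (toReal_mem_Icc _ b).2
  have hx' : ∀ i : Fin hist.length, hist[i].2 ∈ Set.Icc (0 : ℝ) 1 := fun i =>
    hx _ (List.getElem_mem _)
  have hL0 : ∀ b b', L b 0 b' = 0 := fun b b' => by simp [L, ftrlState]
  let F : Fin hist.length → Fin B → ℝ := fun i b' =>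
    if hist[i].1 = b' then w (i + 1) * hist[i].2 / (θ i b' + γ (i + 1)) else 0
  have hF0 : ∀ i b', 0 ≤ F i b' := fun i b' => by
    have h1 := (hx' i).1
    have h2 := hθ0 i b'
    have h3 := (hγ (i + 1) (by omega)).le
    have h4 := hw (i + 1) (by omega)
    simp only [F]
    split_ifs
    · positivity
    · exact le_rfl
  have hstep : ∀ (i : Fin hist.length) b b', L b (i + 1) b' = L b i b' + θ i b * F i b' := by
    intro i b b'
    have hi := i.2
    have : hist.take (i + 1) = hist.take i ++ [hist[i]] := by
      rw [List.take_add_one]; simp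
    simp only [L, this, ftrlState_snoc, ftrlSwapStep, ftrlState_t, List.length_take,
      min_eq_left hi.le, hθ, ftrlSwap_strategy, F]
    split_ifs
    · ring
    · simp
  have hLmono : ∀ b n b', L b n b' ≤ L b (n + 1) b' := by
    intro b n b'
    rcases Nat.lt_or_ge n hist.length with hn | hn
    · rw [hstep ⟨n, hn⟩ b b']
      have := mul_nonneg (hθ0 n b) (hF0 ⟨n, hn⟩ b')
      simp only
      linarith
    · simp only [L]
      rw [List.take_of_length_le hn, List.take_of_length_le (by omega)]
  have hL : ∀ b b', L b hist.length b' = ∑ i : Fin hist.length, θ i b * F i b' := by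
    intro b b'
    have h1 : L b hist.length b'
        = ∑ n ∈ Finset.range hist.length, (L b (n + 1) b' - L b n b') := by
      rw [Finset.sum_range_sub (fun n => L b n b'), hL0, sub_zero]
    rw [h1, ← Fin.sum_univ_eq_sum_range (fun n => L b (n + 1) b' - L b n b')]
    exact Finset.sum_congr rfl fun i _ => by rw [hstep]; ring
  let Q : ℕ → Fin B → PMF (Fin B) := fun n b => softmax fun b' => -r n * L b n b'
  -- A draw from $\theta$ followed by a draw from `Q` is again distributed as $\theta$.
  have hstat : ∀ (i : Fin hist.length) (f : Fin B → ℝ),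
      ∑ b, θ i b * rexp (Q i b) f = ∑ b, θ i b * f b := by
    intro i f
    have h1 := ftrlState_stationary w η γ r hr (hist.take i)
    rw [List.length_take, min_eq_left i.2.le] at h1
    have h2 := rexp_bind (ftrlState w η γ (hist.take i)).θ (Q i) f
    simp only [Q, L] at h2
    rw [h1] at h2
    simp only [hθ, ftrlSwap_strategy]
    exact h2.symm
  have hreg : ∀ b, ∑ i : Fin hist.length, θ i b * rexp (Q i b) (F i)
      ≤ ∑ i : Fin hist.length, θ i b * F i (ψ b) + Real.log B / r hist.length
        + ∑ i : Fin hist.length, r i / 2 * (θ i b * rexp (Q i b) fun b' => F i b' ^ 2) := by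
    intro b
    have h1 := leader_regret_le (L b) (hL0 b) (hLmono b) r hr0 hanti (ψ b) hist.length
    rw [hL, ← Fin.sum_univ_eq_sum_range (fun n => rexp (softmax fun b' => -r n * L b n b')
        fun b' => L b (n + 1) b' - L b n b'),
      ← Fin.sum_univ_eq_sum_range (fun n => r n / 2 * rexp (softmax fun b' => -r n * L b n b')
        fun b' => (L b (n + 1) b' - L b n b') ^ 2)] at h1
    refine le_trans (le_of_eq ?_) (h1.trans (add_le_add_right (Finset.sum_le_sum fun i _ => ?_) _))
    · refine Finset.sum_congr rfl fun i _ => ?_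
      rw [← rexp_const_mul]
      congr 1; funext b'
      rw [hstep]; ring
    · refine mul_le_mul_of_nonneg_left ?_ (by linarith [hr0 i])
      rw [← rexp_const_mul]
      refine rexp_mono fun b' => ?_
      rw [hstep, add_sub_cancel_left, mul_pow]
      refine mul_le_mul_of_nonneg_right ?_ (sq_nonneg _)
      -- $\theta(b)^2\le\theta(b)$ keeps the second order term linear in $\theta(b)$, so that
      -- stationarity applies to it too.
      nlinarith [hθ0 i b, hθ1 i b]
  have hsum := Finset.sum_le_sum fun b (_ : b ∈ Finset.univ) => hreg b
  rw [Finset.sum_add_distrib, Finset.sum_add_distrib, Finset.sum_const, Finset.card_univ,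
    Fintype.card_fin, nsmul_eq_mul, Finset.sum_comm,
    Finset.sum_comm (f := fun (b : Fin B) (i : Fin hist.length) =>
      r i / 2 * (θ i b * rexp (Q i b) fun b' => F i b' ^ 2))] at hsum
  refine le_trans (le_of_eq ?_) (hsum.trans (add_le_add (le_of_eq ?_) ?_))
  · refine Finset.sum_congr rfl fun i _ => ?_
    rw [hstat i (F i)]
    simp only [F, mul_ite, mul_zero, Finset.sum_ite_eq, Finset.mem_univ, if_true]
    ring
  · congr 1
    refine Finset.sum_congr rfl fun b _ => Finset.sum_congr rfl fun i _ => ?_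
    simp only [F]
    split_ifs
    · ring
    · simp
  · refine Finset.sum_le_sum fun i _ => ?_
    rw [← Finset.mul_sum, hstat i fun b' => F i b' ^ 2]
    refine mul_le_mul_of_nonneg_left ?_ (by linarith [hr0 i])
    simp only [F, ite_pow, ne_eq, OfNat.ofNat_ne_zero, not_false_eq_true, zero_pow, mul_ite,
      mul_zero, Finset.sum_ite_eq, Finset.mem_univ, if_true]
    have h1 := hγ (i + 1) (by omega)
    have h2 := hθ0 i hist[i].1
    have h3 : 0 < θ i hist[i].1 + γ (i + 1) := by linarith
    rw [div_pow, mul_pow, ← mul_div_assoc, div_le_div_iff₀ (by positivity) h3]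
    have h4 : hist[i].2 ^ 2 ≤ 1 := pow_le_one₀ (hx' i).1 (hx' i).2
    have h5 : θ i hist[i].1 * hist[i].2 ^ 2 ≤ θ i hist[i].1 + γ (i + 1) :=
      (mul_le_of_le_one_right h2 h4).trans (by linarith)
    have h6 := mul_le_mul_of_nonneg_left h5
      (mul_nonneg (sq_nonneg (w (i + 1))) h3.le)
    linarith

end ftrl

/-! ## Concentration along a run of a bandit -/

section concentration
variable {Z : Type} {B : ℕ} [NeZero B] {alg : BanditAlg B}
  {κ : Z → Fin B → PMF (unitInterval × Z)}

theorem pexp_envRun_exp_le {T : ℕ} (f : List (Round Z B) → Round Z B → ℝ)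
    (hf : ∀ l z, l.length < T → pexp (alg.strategy (feedbacks l)) (fun b =>
      pexp (κ z b) fun xz => ENNReal.ofReal (Real.exp (f l (z, b, xz.1)))) ≤ 1)
    (t : ℕ) (ω₀ : List (Round Z B)) (z : Z) (h : ω₀.length + t ≤ T) :
    pexp (envRun alg κ t ω₀ z) (fun ω => ENNReal.ofReal (Real.exp (prefixSum f ω)))
      ≤ ENNReal.ofReal (Real.exp (prefixSum f ω₀)) := by
  induction t generalizing ω₀ z with
  | zero => simp [envRun, pexp_pure]
  | succ t ih =>
    simp only [envRun, pexp_bind]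
    have h1 : ∀ b (xz : unitInterval × Z),
        pexp (envRun alg κ t (ω₀ ++ [(z, b, xz.1)]) xz.2)
          (fun ω => ENNReal.ofReal (Real.exp (prefixSum f ω)))
        ≤ ENNReal.ofReal (Real.exp (prefixSum f ω₀))
          * ENNReal.ofReal (Real.exp (f ω₀ (z, b, xz.1))) := by
      intro b xz
      refine (ih (ω₀ ++ [(z, b, xz.1)]) xz.2 ?_).trans (le_of_eq ?_)
      · rw [List.length_append, List.length_singleton]; omega
      · rw [prefixSum_snoc, Real.exp_add, ENNReal.ofReal_mul (Real.exp_pos _).le]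
    refine (pexp_mono fun b => pexp_mono fun xz => h1 b xz).trans ?_
    simp only [pexp_const_mul]
    exact mul_le_of_le_one_right zero_le (hf ω₀ z (by omega))

/-- Markov's inequality for a supermartingale started at 1. The terms `f` must already contain their
compensators. -/
theorem envRun_prefixSum_le (t : ℕ) (z : Z) (f : List (Round Z B) → Round Z B → ℝ)
    (hf : ∀ l z, l.length < t → pexp (alg.strategy (feedbacks l)) (fun b =>
      pexp (κ z b) fun xz => ENNReal.ofReal (Real.exp (f l (z, b, xz.1)))) ≤ 1) (s : ℝ) :
    (envRun alg κ t [] z).toOuterMeasure {ω | s ≤ prefixSum f ω}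
      ≤ ENNReal.ofReal (Real.exp (-s)) := by
  have key := pexp_envRun_exp_le f hf t [] z (by simp)
  rw [prefixSum_nil, Real.exp_zero, ENNReal.ofReal_one] at key
  have mk := (markov_pexp (envRun alg κ t [] z) _ (ENNReal.ofReal (Real.exp s))).trans key
  rw [Real.exp_neg, ENNReal.ofReal_inv_of_pos (Real.exp_pos _), ← one_div,
    ENNReal.le_div_iff_mul_le (Or.inl (by simp [Real.exp_pos])) (Or.inl ENNReal.ofReal_ne_top),
    mul_comm]
  refine le_trans (mul_le_mul_right (measure_mono ?_) _) mk
  intro ω hω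
  simp only [Set.mem_ofPred_eq] at hω ⊢
  exact ENNReal.ofReal_le_ofReal (Real.exp_le_exp.mpr hω)

end concentration

/-! ### Exponential moments of a single bandit round. -/

section round
variable {Z : Type} {B : ℕ} {κ : Z → Fin B → PMF (unitInterval × Z)}

theorem pexp_one_sub_feedback (κ : Z → Fin B → PMF (unitInterval × Z)) (z : Z) (b : Fin B) :
    pexp (κ z b) (fun xz => ENNReal.ofReal (1 - xz.1)) = ENNReal.ofReal (1 - meanLoss κ z b) := by
  have h1 : pexp (κ z b) (fun xz => ENNReal.ofReal (1 - xz.1))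
      + pexp (κ z b) (fun xz => ENNReal.ofReal xz.1) = 1 := by
    rw [← pexp_add, ← pexp_const (κ z b) 1]
    congr 1; funext xz
    rw [← ENNReal.ofReal_add (by linarith [xz.1.2.2]) xz.1.2.1]
    simp
  rw [← ofReal_meanLoss] at h1
  rw [ENNReal.ofReal_sub _ (meanLoss_mem κ z b).1, ENNReal.ofReal_one, ← h1,
    ENNReal.add_sub_cancel_right ENNReal.ofReal_ne_top]

/-- The slope may be negative. Writing $ux+v=(u+v)x+v(1-x)$ makes both coefficients nonnegative, as
expectations in `ℝ≥0∞` require. -/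
theorem pexp_feedback_affine (κ : Z → Fin B → PMF (unitInterval × Z)) (z : Z) (b : Fin B) {u v : ℝ}
    (hv : 0 ≤ v) (huv : 0 ≤ u + v) :
    pexp (κ z b) (fun xz => ENNReal.ofReal (u * xz.1 + v))
      = ENNReal.ofReal (u * meanLoss κ z b + v) := by
  have h : ∀ x : ℝ, x ∈ Set.Icc (0 : ℝ) 1 → ENNReal.ofReal (u * x + v)
      = ENNReal.ofReal (u + v) * ENNReal.ofReal x + ENNReal.ofReal v * ENNReal.ofReal (1 - x) := by
    intro x hx
    rw [← ENNReal.ofReal_mul huv, ← ENNReal.ofReal_mul hv, ← ENNReal.ofReal_add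
      (mul_nonneg huv hx.1) (mul_nonneg hv (sub_nonneg.mpr hx.2))]
    congr 1; ring
  rw [h _ (meanLoss_mem κ z b), ofReal_meanLoss, ← pexp_one_sub_feedback, ← pexp_const_mul,
    ← pexp_const_mul, ← pexp_add]
  congr 1; funext xz
  exact h _ xz.1.2

/-- A bound for one round by functions that are affine in the feedback. -/
theorem pexp_round_le_one (p : PMF (Fin B)) (z : Z) (f : Fin B → unitInterval → ℝ)
    (u v : Fin B → ℝ) (hf : ∀ b, p b ≠ 0 → ∀ x : unitInterval, Real.exp (f b x) ≤ u b * x + v b)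
    (h : rexp p (fun b => u b * meanLoss κ z b + v b) ≤ 1) :
    pexp p (fun b => pexp (κ z b) fun xz => ENNReal.ofReal (Real.exp (f b xz.1))) ≤ 1 := by
  classical
  let y : Fin B → ℝ := fun b => if p b = 0 then 0 else u b * meanLoss κ z b + v b
  have hv : ∀ b, p b ≠ 0 → 0 ≤ v b := fun b hb => by
    simpa using (Real.exp_pos _).le.trans (hf b hb 0)
  have huv : ∀ b, p b ≠ 0 → 0 ≤ u b + v b := fun b hb => by
    simpa using (Real.exp_pos _).le.trans (hf b hb 1)
  have hy : ∀ b, 0 ≤ y b := fun b => by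
    simp only [y]
    split_ifs with hb
    · exact le_rfl
    · have h1 := meanLoss_mem κ z b
      nlinarith [mul_nonneg (huv b hb) h1.1, mul_nonneg (hv b hb) (sub_nonneg.mpr h1.2)]
  refine (pexp_mono_support (g := fun b => ENNReal.ofReal (y b)) fun b hb => ?_).trans ?_
  · have hb' : p b ≠ 0 := (PMF.mem_support_iff p b).mp hb
    simp only [y, hb', if_false]
    rw [← pexp_feedback_affine κ z b (hv b hb') (huv b hb')]
    exact pexp_mono fun xz => ENNReal.ofReal_le_ofReal (hf b hb' xz.1)
  · rw [pexp_ofReal p hy]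
    refine ENNReal.ofReal_le_one.mpr (le_trans (le_of_eq ?_) h)
    refine Finset.sum_congr rfl fun b _ => ?_
    by_cases hb : p b = 0 <;> simp [y, hb]

theorem pexp_exp_feedback_le_one (p : PMF (Fin B)) (z : Z) (c : ℝ) :
    pexp p (fun b => pexp (κ z b) fun xz => ENNReal.ofReal (Real.exp
      (c * (rexp p (meanLoss κ z) - xz.1) - c ^ 2))) ≤ 1 := by
  set μ := rexp p (meanLoss κ z) with hμ
  have hμ1 : μ ∈ Set.Icc (0 : ℝ) 1 :=
    ⟨rexp_nonneg fun b => (meanLoss_mem κ z b).1, rexp_le fun b => (meanLoss_mem κ z b).2⟩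
  have he : Real.exp (-c ^ 2) * Real.exp (c ^ 2) = 1 := by rw [← Real.exp_add]; simp
  refine pexp_round_le_one p z (fun _ x => c * (μ - x) - c ^ 2) (fun _ => Real.exp (-c ^ 2) * -c)
    (fun _ => Real.exp (-c ^ 2) * (c * μ + Real.exp (c ^ 2))) (fun b _ x => ?_) ?_
  · have h1 := exp_le_add_exp_sq (c * (μ - x))
    have h2 : (c * (μ - x)) ^ 2 ≤ c ^ 2 := by
      have : (μ - (x : ℝ)) ^ 2 ≤ 1 := by
        have := x.2.1; have := x.2.2
        rw [sq_le_one_iff_abs_le_one, abs_le]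
        constructor <;> linarith [hμ1.1, hμ1.2]
      rw [mul_pow]
      exact mul_le_of_le_one_right (sq_nonneg c) this
    have h3 := Real.exp_le_exp.mpr h2
    rw [sub_eq_add_neg, Real.exp_add, mul_comm]
    have := mul_le_mul_of_nonneg_left (h1.trans (add_le_add_right h3 _)) (Real.exp_pos (-c ^ 2)).le
    refine this.trans (le_of_eq ?_)
    ring
  · rw [rexp_add, rexp_const, rexp_const_mul, ← hμ]
    refine le_of_eq ?_
    linear_combination he

-- The point of implicit exploration: as $cx\le\gamma$, the exponent is at most $cx/(\theta+cx)$,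
-- which has the form $1-1/(1+y)\le\log(1+y)$ with $y=cx/\theta$. The majorant is the unbiased
-- importance-weighted estimate, and no inverse of $\theta$ has to be controlled.
theorem exp_implicit_le {θ γ c x : ℝ} (hθ : 0 < θ) (hc : 0 ≤ c) (hcγ : c ≤ γ)
    (hx : x ∈ Set.Icc (0 : ℝ) 1) : Real.exp (c * (x / (θ + γ))) ≤ 1 + c * (x / θ) := by
  have hy : 0 ≤ c * (x / θ) := mul_nonneg hc (div_nonneg hx.1 hθ.le)
  have h1 := Real.one_sub_inv_le_log_of_pos (show 0 < 1 + c * (x / θ) by linarith)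
  rw [← Real.le_log_iff_exp_le (by linarith)]
  refine le_trans ?_ h1
  have h2 : 1 - (1 + c * (x / θ))⁻¹ = c * (x / (θ + c * x)) := by
    have h3 : 0 < θ + c * x := by nlinarith [mul_nonneg hc hx.1]
    have h4 : 1 + c * (x / θ) = (θ + c * x) / θ := by field_simp
    rw [h4, inv_div]
    field_simp
    ring
  rw [h2]
  refine mul_le_mul_of_nonneg_left (div_le_div_of_nonneg_left hx.1 ?_ ?_) hc
  · nlinarith [mul_nonneg hc hx.1]
  · have := mul_le_of_le_one_right hc hx.2
    linarith

theorem pexp_exp_implicit_le_one (p : PMF (Fin B)) (z : Z) (b' : Fin B) {c γ : ℝ} (hc : 0 ≤ c)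
    (hcγ : c ≤ γ) :
    pexp p (fun b => pexp (κ z b) fun xz => ENNReal.ofReal (Real.exp
      (c * ((if b = b' then (xz.1 : ℝ) else 0) / ((p b').toReal + γ) - meanLoss κ z b')))) ≤ 1 := by
  set ℓ := meanLoss κ z b' with hℓ
  have hℓ0 : 0 ≤ ℓ := (meanLoss_mem κ z b').1
  refine pexp_round_le_one p z
    (fun b x => c * ((if b = b' then (x : ℝ) else 0) / ((p b').toReal + γ) - ℓ))
    (fun b => if b' = b then Real.exp (-(c * ℓ)) * (c / (p b').toReal) else 0)
    (fun _ => Real.exp (-(c * ℓ))) (fun b hb x => ?_) ?_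
  · rw [mul_sub, sub_eq_add_neg, Real.exp_add, mul_comm]
    by_cases h : b = b'
    · subst h
      simp only [if_true]
      have h1 := exp_implicit_le (ENNReal.toReal_pos hb (p.apply_ne_top b)) hc hcγ x.2
      refine (mul_le_mul_of_nonneg_left h1 (Real.exp_pos _).le).trans (le_of_eq ?_)
      ring
    · simp [h, Ne.symm h]
  · rw [rexp_add, rexp_const]
    simp only [ite_mul, zero_mul]
    rw [rexp_ite_eq, ← hℓ]
    have h1 : (p b').toReal * (Real.exp (-(c * ℓ)) * (c / (p b').toReal) * ℓ)
        ≤ Real.exp (-(c * ℓ)) * (c * ℓ) := by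
      by_cases h0 : (p b').toReal = 0
      · rw [h0, zero_mul]; positivity
      · refine le_of_eq ?_
        field_simp
    have h2 := mul_le_mul_of_nonneg_left (Real.add_one_le_exp (c * ℓ)) (Real.exp_pos (-(c * ℓ))).le
    rw [← Real.exp_add, neg_add_cancel, Real.exp_zero] at h2
    linarith

/-- The mean of $1/(p(b)+\gamma)$ under $p$ is at most $B$. The condition $c\le\gamma$ keeps the
exponent in $[0,1]$, where $e^x\le1+2x$; this is the factor 2 in the compensator. -/
theorem pexp_exp_inv_le_one (p : PMF (Fin B)) (z : Z) {c γ : ℝ} (hc : 0 ≤ c) (hcγ : c ≤ γ)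
    (hγ : 0 < γ) :
    pexp p (fun b => pexp (κ z b) fun _ => ENNReal.ofReal (Real.exp
      (c * (1 / ((p b).toReal + γ)) - 2 * c * B))) ≤ 1 := by
  refine pexp_round_le_one p z (fun b _ => c * (1 / ((p b).toReal + γ)) - 2 * c * B) (fun _ => 0)
    (fun b => Real.exp (-(2 * c * B)) * (1 + 2 * c * (1 / ((p b).toReal + γ)))) (fun b _ x => ?_) ?_
  · rw [zero_mul, zero_add, sub_eq_add_neg, Real.exp_add, mul_comm]
    refine mul_le_mul_of_nonneg_left ?_ (Real.exp_pos _).le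
    have hp : (0 : ℝ) ≤ (p b).toReal := ENNReal.toReal_nonneg
    have h1 : 0 ≤ c * (1 / ((p b).toReal + γ)) := by positivity
    have h2 : c * (1 / ((p b).toReal + γ)) ≤ 1 := by
      rw [mul_one_div, div_le_one (by linarith)]; linarith
    have h3 := Real.abs_exp_sub_one_le (abs_le.mpr ⟨by linarith, h2⟩)
    rw [abs_of_nonneg h1] at h3
    linarith [le_abs_self (Real.exp (c * (1 / ((p b).toReal + γ))) - 1)]
  · simp only [zero_mul, zero_add]
    rw [rexp_const_mul, rexp_add, rexp_const, rexp_const_mul]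
    have h1 : rexp p (fun b => 1 / ((p b).toReal + γ)) ≤ B := by
      unfold rexp
      refine (Finset.sum_le_sum (g := fun _ => (1 : ℝ)) fun b _ => ?_).trans (by simp)
      have hp : (0 : ℝ) ≤ (p b).toReal := ENNReal.toReal_nonneg
      rw [mul_one_div, div_le_one (by linarith)]; linarith
    have h2 := mul_le_mul_of_nonneg_left h1 (by positivity : 0 ≤ 2 * c)
    have h3 := mul_le_mul_of_nonneg_left (h2.trans (by linarith [Real.add_one_le_exp (2 * c * B)] :
      2 * c * B ≤ Real.exp (2 * c * B) - 1)) (Real.exp_pos (-(2 * c * B))).le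
    rw [mul_sub, ← Real.exp_add, neg_add_cancel, Real.exp_zero] at h3
    linarith

end round

/-! ## The weights of FTRL_swap -/

/-- The product `∏_{i=2}^t (1 - α_i)`. -/
def lrProd (H t : ℕ) : ℝ := ∏ i ∈ Finset.Icc 2 t, (1 - lr H i)

theorem lrProd_pos (H t : ℕ) : 0 < lrProd H t := by
  refine Finset.prod_pos fun i hi => ?_
  obtain ⟨n, rfl⟩ : ∃ n, i = n + 1 := ⟨i - 1, by have := (Finset.mem_Icc.mp hi).1; omega⟩
  have hn : 0 < n := by have := (Finset.mem_Icc.mp hi).1; omega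
  rw [one_sub_lr_succ]
  positivity

theorem ftrlWeight_pos (H n : ℕ) (hH : 1 ≤ H) : 0 < ftrlWeight H n :=
  mul_pos (lr_pos H n hH) (inv_pos.mpr (lrProd_pos H n))

/-- The horizon enters the weights only through a common factor, so one run of the leader, with
weights $w_i$, serves all `t` at once. -/
theorem lrW_eq_ftrlWeight {H t i : ℕ} (hi : 1 ≤ i) (hit : i ≤ t) :
    lrW H t i = lrProd H t * ftrlWeight H i := by
  have h : lrProd H t = lrProd H i * ∏ j ∈ Finset.Icc (i + 1) t, (1 - lr H j) := by
    unfold lrProd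
    simp only [← Finset.Ico_add_one_right_eq_Icc]
    exact (Finset.prod_Ico_consecutive _ (by omega) (by omega)).symm
  have h0 := (lrProd_pos H i).ne'
  have h1 : ftrlWeight H i = lr H i * (lrProd H i)⁻¹ := rfl
  rw [h, h1]
  unfold lrW
  field_simp

theorem ftrlWeight_succ_mul {H n : ℕ} (hn : 1 ≤ n) :
    ftrlWeight H (n + 1) * n = ftrlWeight H n * (H + n) := by
  have h0 := (lrProd_pos H n).ne'
  have h1 : ∀ i, ftrlWeight H i = lr H i * (lrProd H i)⁻¹ := fun _ => rfl
  have h2 : lrProd H (n + 1) = lrProd H n * (1 - lr H (n + 1)) := by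
    unfold lrProd
    rw [Finset.prod_Icc_succ_top (by omega)]
  have hn0 : (0 : ℝ) < n := by exact_mod_cast hn
  rw [h1, h1, h2, one_sub_lr_succ]
  unfold lr
  push_cast
  field_simp
  ring

theorem ftrlWeight_le_succ {H n : ℕ} (hH : 1 ≤ H) (hn : 1 ≤ n) :
    ftrlWeight H n ≤ ftrlWeight H (n + 1) := by
  have hn0 : (0 : ℝ) < n := by exact_mod_cast hn
  have h := ftrlWeight_succ_mul (H := H) hn
  have h1 := (ftrlWeight_pos H n hH).le
  refine le_of_mul_le_mul_right ?_ hn0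
  rw [h]
  exact mul_le_mul_of_nonneg_left (by linarith [Nat.cast_nonneg (α := ℝ) H]) h1

theorem ftrlWeight_mono {H n k : ℕ} (hH : 1 ≤ H) (hn : 1 ≤ n) (h : n ≤ k) :
    ftrlWeight H n ≤ ftrlWeight H k := by
  induction k, h using Nat.le_induction with
  | base => exact le_rfl
  | succ k hk ih => exact ih.trans (ftrlWeight_le_succ hH (hn.trans hk))

theorem ftrlWeight_succ_le {H t : ℕ} (hH : 1 ≤ H) (ht : H ≤ t) :
    ftrlWeight H (t + 1) ≤ 2 * ftrlWeight H t := by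
  have ht0 : (0 : ℝ) < t := by exact_mod_cast (by omega : 0 < t)
  have hHt : (H : ℝ) ≤ t := by exact_mod_cast ht
  have h := ftrlWeight_succ_mul (H := H) (n := t) (by omega)
  refine le_of_mul_le_mul_right ?_ ht0
  rw [h]
  nlinarith [ftrlWeight_pos H t hH]

/-- The ratio $w_{n+1}/w_n=(H+n)/n$ can be as large as $H+1$, but consecutive ratios differ by at
most a factor 2. Hence $w_{n+1}^2/w_n$ is compared with the next weight $w_{n+2}$ and not with
$w_{n+1}$. -/
theorem ftrlWeight_sq_le {H n : ℕ} (hH : 1 ≤ H) (hn : 1 ≤ n) :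
    ftrlWeight H (n + 1) ^ 2 ≤ 2 * ftrlWeight H (n + 2) * ftrlWeight H n := by
  have hn0 : (1 : ℝ) ≤ n := by exact_mod_cast hn
  have hH0 : (0 : ℝ) ≤ H := Nat.cast_nonneg H
  have h1 := ftrlWeight_succ_mul (H := H) hn
  have h2 := ftrlWeight_succ_mul (H := H) (n := n + 1) (by omega)
  have e1 : ftrlWeight H n = ftrlWeight H (n + 1) * n / (H + n) := by
    rw [eq_div_iff (by positivity), h1]
  have e2 : ftrlWeight H (n + 2) = ftrlWeight H (n + 1) * (H + (n + 1)) / (n + 1) := by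
    rw [eq_div_iff (by positivity)]
    push_cast at h2
    exact h2
  have h3 : (1 : ℝ) ≤ 2 * (H + (n + 1)) * n / ((n + 1) * (H + n)) := by
    rw [one_le_div (by positivity)]
    nlinarith
  have h4 := mul_le_mul_of_nonneg_left h3 (sq_nonneg (ftrlWeight H (n + 1)))
  rw [e1, e2]
  refine le_trans (le_of_eq (mul_one _).symm) (h4.trans (le_of_eq ?_))
  field_simp

/-- The step sizes and exploration parameters `√(H ι / t)`. -/
def ftrlRate (H : ℕ) (ι : ℝ) (t : ℕ) : ℝ := Real.sqrt (H * ι / t)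

/-! ### Step sizes and the coefficients of the second order terms. -/

section rates
variable {H : ℕ} {ι : ℝ}

theorem ftrlRate_pos (hH : 1 ≤ H) (hι : 0 < ι) {n : ℕ} (hn : 1 ≤ n) : 0 < ftrlRate H ι n := by
  have h1 : (0 : ℝ) < H := by exact_mod_cast hH
  have h2 : (0 : ℝ) < n := by exact_mod_cast hn
  exact Real.sqrt_pos.mpr (by positivity)

theorem ftrlRate_anti (hι : 0 ≤ ι) {n k : ℕ} (hn : 1 ≤ n) (h : n ≤ k) :
    ftrlRate H ι k ≤ ftrlRate H ι n := by
  have h2 : (0 : ℝ) < n := by exact_mod_cast hn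
  exact Real.sqrt_le_sqrt (div_le_div_of_nonneg_left (by positivity) h2 (by exact_mod_cast h))

theorem ftrlRate_le (hι : 0 ≤ ι) {n k : ℕ} (hn : 1 ≤ n) (h : k ≤ 4 * n) (hk : 1 ≤ k) :
    ftrlRate H ι n ≤ 2 * ftrlRate H ι k := by
  have h2 : (0 : ℝ) < n := by exact_mod_cast hn
  have h3 : (0 : ℝ) < k := by exact_mod_cast hk
  have h4 : (k : ℝ) ≤ 4 * n := by exact_mod_cast h
  unfold ftrlRate
  rw [Real.sqrt_le_left (by positivity), mul_pow, Real.sq_sqrt (by positivity), div_le_iff₀ h2]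
  have : (2 : ℝ) ^ 2 * (H * ι / k) * n = H * ι * (4 * n / k) := by ring
  rw [this]
  exact le_mul_of_one_le_right (by positivity) ((one_le_div h3).mpr h4)

/-- The effective learning rate of FTRL_swap before round `n + 1`. -/
def ftrlStep (H : ℕ) (ι : ℝ) (n : ℕ) : ℝ := ftrlRate H ι (max n 1) / ftrlWeight H (max n 1)

theorem ftrlStep_pos (hH : 1 ≤ H) (hι : 0 < ι) (n : ℕ) : 0 < ftrlStep H ι n :=
  div_pos (ftrlRate_pos hH hι (le_max_right _ _)) (ftrlWeight_pos H _ hH)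

/-- Step sizes decrease and weights increase. The `max n 1` extends the sequence to $n=0$, where the
cumulative losses vanish and the rate does not affect the strategy. -/
theorem ftrlStep_succ_le (hH : 1 ≤ H) (hι : 0 < ι) (n : ℕ) :
    ftrlStep H ι (n + 1) ≤ ftrlStep H ι n := by
  have h : max n 1 ≤ max (n + 1) 1 := by omega
  exact div_le_div₀ (ftrlRate_pos hH hι (le_max_right _ _)).le
    (ftrlRate_anti hι.le (le_max_right _ _) h) (ftrlWeight_pos H _ hH)
    (ftrlWeight_mono hH (le_max_right _ _) h)

theorem ftrlStep_mul_sq_le (hH : 1 ≤ H) (hι : 0 < ι) (n : ℕ) :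
    ftrlStep H ι n * ftrlWeight H (n + 1) ^ 2
      ≤ 4 * (ftrlWeight H (n + 2) * ftrlRate H ι (n + 2)) := by
  unfold ftrlStep
  rcases Nat.eq_zero_or_pos n with rfl | hn
  · have h1 := ftrlWeight_pos H 1 hH
    have h2 := ftrlWeight_le_succ hH (le_refl 1)
    have h3 := ftrlRate_le (H := H) hι.le (le_refl 1) (by norm_num : 2 ≤ 4 * 1) (by norm_num)
    have h4 := (ftrlRate_pos hH hι (le_refl 1)).le
    have h5 := mul_le_mul h2 h3 h4 (h1.le.trans h2)
    have h6 := mul_nonneg (h1.le.trans h2) (ftrlRate_pos hH hι (by norm_num : 1 ≤ 2)).le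
    have h7 : ftrlRate H ι 1 / ftrlWeight H 1 * ftrlWeight H 1 ^ 2
        = ftrlWeight H 1 * ftrlRate H ι 1 := by field_simp
    simp only [max_eq_right (Nat.zero_le 1), zero_add] at *
    rw [h7]
    linarith
  · rw [max_eq_left hn]
    have h1 := ftrlWeight_pos H n hH
    have h2 := ftrlWeight_sq_le hH hn
    have h3 := ftrlRate_le (H := H) hι.le hn (by omega : n + 2 ≤ 4 * n) (by omega)
    have h4 := (ftrlRate_pos hH hι hn).le
    have h5 : ftrlRate H ι n / ftrlWeight H n * ftrlWeight H (n + 1) ^ 2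
        ≤ ftrlRate H ι n / ftrlWeight H n * (2 * ftrlWeight H (n + 2) * ftrlWeight H n) :=
      mul_le_mul_of_nonneg_left h2 (div_nonneg h4 h1.le)
    have h6 : ftrlRate H ι n / ftrlWeight H n * (2 * ftrlWeight H (n + 2) * ftrlWeight H n)
        = 2 * ftrlWeight H (n + 2) * ftrlRate H ι n := by field_simp
    have h7 := mul_le_mul_of_nonneg_left h3
      (mul_nonneg zero_le_two (ftrlWeight_pos H (n + 2) hH).le)
    linarith

/-- The weight in round `n + 1` of the reciprocal of the probability of the chosen action. -/
def ftrlCoef (H : ℕ) (ι : ℝ) (t n : ℕ) : ℝ :=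
  lrProd H t * (ftrlWeight H (n + 1) * ftrlRate H ι (n + 1)
    + 2 * (ftrlWeight H (n + 2) * ftrlRate H ι (n + 2)))

theorem ftrlCoef_nonneg (hH : 1 ≤ H) (hι : 0 < ι) (t n : ℕ) : 0 ≤ ftrlCoef H ι t n := by
  have h1 := (lrProd_pos H t).le
  have h2 := (ftrlWeight_pos H (n + 1) hH).le
  have h3 := (ftrlWeight_pos H (n + 2) hH).le
  have h4 := (ftrlRate_pos hH hι (by omega : 1 ≤ n + 1)).le
  have h5 := (ftrlRate_pos hH hι (by omega : 1 ≤ n + 2)).le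
  unfold ftrlCoef
  positivity

/-- Divided by $5\alpha_t$, the coefficient is at most $\gamma_{n+1}$, as `pexp_exp_inv_le_one`
requires. Here $5=1+2\cdot2$: for $H\le t$ the index shift at most doubles the weight. -/
theorem ftrlCoef_le (hH : 1 ≤ H) (hι : 0 < ι) {t n : ℕ} (hHt : H ≤ t) (hn : n < t) :
    ftrlCoef H ι t n ≤ 5 * lr H t * ftrlRate H ι (n + 1) := by
  have hP := (lrProd_pos H t).le
  have e : lr H t = lrProd H t * ftrlWeight H t := by
    rw [← lrW_eq_ftrlWeight (by omega) le_rfl, lrW_self]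
  have h1 := ftrlWeight_mono hH (by omega : 1 ≤ n + 1) hn
  have h2 : ftrlWeight H (n + 2) ≤ 2 * ftrlWeight H t :=
    (ftrlWeight_mono hH (by omega) (by omega : n + 2 ≤ t + 1)).trans (ftrlWeight_succ_le hH hHt)
  have h3 := ftrlRate_anti (H := H) hι.le (by omega : 1 ≤ n + 1) (by omega : n + 1 ≤ n + 2)
  have h4 := (ftrlRate_pos hH hι (by omega : 1 ≤ n + 1)).le
  have h5 := (ftrlRate_pos hH hι (by omega : 1 ≤ n + 2)).le
  have h6 := (ftrlWeight_pos H t hH).le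
  have h7 := mul_le_mul_of_nonneg_right h1 h4
  have h8 := mul_le_mul h2 h3 h5 (by positivity)
  have h9 := mul_le_mul_of_nonneg_left (add_le_add h7 (mul_le_mul_of_nonneg_left h8 zero_le_two)) hP
  unfold ftrlCoef
  rw [e]
  linarith

theorem sum_lrProd_mul_le (hι : 0 ≤ ι) {t : ℕ} (ht : 1 ≤ t) :
    ∑ n ∈ Finset.range t, lrProd H t * (ftrlWeight H (n + 1) * ftrlRate H ι (n + 1))
      ≤ 2 * ftrlRate H ι t := by
  have h1 := mul_le_mul_of_nonneg_left (sum_lrW_div_sqrt_le H t ht) (Real.sqrt_nonneg (H * ι))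
  have h2 : ∀ n : ℕ, ftrlRate H ι n = Real.sqrt (H * ι) / Real.sqrt n := fun n =>
    Real.sqrt_div (by positivity) _
  rw [Finset.mul_sum] at h1
  refine le_trans (le_of_eq ?_) (h1.trans (le_of_eq (by rw [h2]; ring)))
  rw [Finset.range_eq_Ico, Finset.sum_Ico_add' (fun n => lrProd H t * (ftrlWeight H n
    * ftrlRate H ι n)) 0 t 1, Finset.Ico_add_one_right_eq_Icc]
  refine Finset.sum_congr rfl fun n hn => ?_
  rw [lrW_eq_ftrlWeight (Finset.mem_Icc.mp hn).1 (Finset.mem_Icc.mp hn).2, h2]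
  ring

theorem sum_ftrlCoef_le (hH : 1 ≤ H) (hι : 0 < ι) {t : ℕ} (hHt : H ≤ t) :
    ∑ n ∈ Finset.range t, ftrlCoef H ι t n ≤ 14 * ftrlRate H ι t := by
  let u : ℕ → ℝ := fun n => lrProd H t * (ftrlWeight H (n + 1) * ftrlRate H ι (n + 1))
  have hu : ∀ n, 0 ≤ u n := fun n => mul_nonneg (lrProd_pos H t).le
    (mul_nonneg (ftrlWeight_pos H _ hH).le (ftrlRate_pos hH hι (by omega)).le)
  have h0 := sum_lrProd_mul_le (H := H) hι.le (by omega : 1 ≤ t)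
  have h1 : ∑ n ∈ Finset.range t, u (n + 1) = ∑ n ∈ Finset.range t, u n + u t - u 0 := by
    have := (Finset.sum_range_succ u t).symm.trans (Finset.sum_range_succ' u t)
    linarith
  obtain ⟨k, rfl⟩ : ∃ k, t = k + 1 := ⟨t - 1, by omega⟩
  -- The shifted sum exceeds the sum by at most its last term doubled, so the coefficients add up to
  -- at most $(1+2\cdot3)\sum u\le14\,$`ftrlRate H ι t`.
  have h2 : u (k + 1) ≤ 2 * u k := by
    have h3 := mul_le_mul (ftrlWeight_succ_le hH hHt)
      (ftrlRate_anti (H := H) hι.le (by omega : 1 ≤ k + 1) (by omega : k + 1 ≤ k + 2))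
      (ftrlRate_pos hH hι (by omega)).le (mul_nonneg zero_le_two (ftrlWeight_pos H _ hH).le)
    have := mul_le_mul_of_nonneg_left h3 (lrProd_pos H (k + 1)).le
    simp only [u]
    linarith
  have h3 : u k ≤ ∑ n ∈ Finset.range (k + 1), u n :=
    Finset.single_le_sum (fun n _ => hu n) (Finset.self_mem_range_succ k)
  have h4 : ∑ n ∈ Finset.range (k + 1), ftrlCoef H ι (k + 1) n
      = ∑ n ∈ Finset.range (k + 1), u n + 2 * ∑ n ∈ Finset.range (k + 1), u (n + 1) := by
    rw [Finset.mul_sum, ← Finset.sum_add_distrib]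
    refine Finset.sum_congr rfl fun n _ => ?_
    simp only [ftrlCoef, u]
    ring
  rw [h4, h1]
  have := hu 0
  linarith

end rates

/-! ## The swap regret of FTRL_swap -/

section regret
variable {Z : Type} {B : ℕ} [NeZero B] {κ : Z → Fin B → PMF (unitInterval × Z)}

theorem wavg_splits {γ : Type} (H : ℕ) (l : List γ) (f : List γ × γ → ℝ) :
    wavg H (splits l) f = ∑ i : Fin l.length, lrW H l.length (i + 1) * f (l.take i, l[i]) := by
  unfold wavg
  rw [sum_fin_cast (n := l.length) (by rw [splits_length])]
  refine Finset.sum_congr rfl fun i _ => ?_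
  simp only [Fin.val_cast]
  congr 1
  · rw [splits_length]
  · simp only [splits, List.get_eq_getElem, List.getElem_ofFn]
    rfl

theorem sum_fin_map {γ γ' : Type} (l : List γ) (f : γ → γ') (g : ℕ → γ' → ℝ) :
    ∑ i : Fin (l.map f).length, g i (l.map f)[i] = ∑ i : Fin l.length, g i (f l[i]) := by
  rw [sum_fin_cast (n := l.length) (by simp)]
  simp

theorem runRegret_le_one (alg : BanditAlg B) (κ : Z → Fin B → PMF (unitInterval × Z)) (H : ℕ)
    (ψ : Fin B → Fin B) {ω : List (Round Z B)} (hω : ω ≠ []) : runRegret alg κ H ψ ω ≤ 1 := by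
  have hs : splits ω ≠ [] := by
    rw [← List.length_pos_iff, splits_length]; exact List.length_pos_iff.mpr hω
  refine wavg_le hs fun p _ => ?_
  have h1 := rexp_le (p := alg.strategy (feedbacks p.1)) fun b => (meanLoss_mem κ p.2.1 b).2
  have h2 := rexp_nonneg (p := alg.strategy (feedbacks p.1))
    fun b => (meanLoss_mem κ p.2.1 (ψ b)).1
  linarith

variable (H : ℕ) (ι : ℝ)

/-- FTRL_swap with the step sizes and exploration parameters `√(H ι / t)`. -/
abbrev ftrlAlg (B : ℕ) [NeZero B] : BanditAlg B :=
  ftrlSwap (ftrlWeight H) (ftrlRate H ι) (ftrlRate H ι) B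

/-- Compensated deviations of the feedback from the expected loss. -/
def feedbackDev (κ : Z → Fin B → PMF (unitInterval × Z)) (t : ℕ) (l : List (Round Z B))
    (x : Round Z B) : ℝ :=
  let c := ι / ftrlRate H ι t * lrW H t (l.length + 1)
  c * (rexp ((ftrlAlg H ι B).strategy (feedbacks l)) (meanLoss κ x.1) - x.2.2) - c ^ 2

/-- Deviations of the loss estimates. -/
def estimateDev (κ : Z → Fin B → PMF (unitInterval × Z)) (t : ℕ) (b b' : Fin B)
    (l : List (Round Z B)) (x : Round Z B) : ℝ :=
  let θ := (ftrlAlg H ι B).strategy (feedbacks l)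
  ftrlRate H ι t / ftrlWeight H t * ftrlWeight H (l.length + 1) * (θ b).toReal
    * ((if x.2.1 = b' then (x.2.2 : ℝ) else 0) / ((θ b').toReal + ftrlRate H ι (l.length + 1))
      - meanLoss κ x.1 b')

/-- Compensated reciprocals of the probabilities of the chosen actions. -/
def reciprocalDev (t : ℕ) (l : List (Round Z B)) (x : Round Z B) : ℝ :=
  let c := ftrlCoef H ι t l.length / (5 * lr H t)
  c * (1 / (((ftrlAlg H ι B).strategy (feedbacks l) x.2.1).toReal + ftrlRate H ι (l.length + 1)))
    - 2 * c * B

variable {H ι}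

/-- The regret splits into expected minus observed loss (at most $6q$), observed loss minus
estimated comparator loss ($2Bq+28Bq+40q$, pathwise bound and reciprocals), and estimated minus true
comparator loss ($8q$ for each of the $B$ actions), where $q=\sqrt{H\iota/t}$. As $q\le Bq$, the
total is at most $84Bq$. -/
theorem runRegret_ftrl_le (hH : 1 ≤ H) (hι : 0 < ι) (hB : Real.log B ≤ ι) {t : ℕ} (hHt : H ≤ t)
    (hq : ftrlRate H ι t ≤ 1) {ω : List (Round Z B)} (hω : ω.length = t)
    (h1 : prefixSum (feedbackDev H ι κ t) ω ≤ 4 * ι)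
    (h2 : ∀ b b', prefixSum (estimateDev H ι κ t b b') ω ≤ 4 * ι)
    (h3 : prefixSum (reciprocalDev H ι t) ω ≤ 4 * ι) (ψ : Fin B → Fin B) :
    runRegret (ftrlAlg H ι B) κ H ψ ω ≤ 84 * (B * ftrlRate H ι t) := by
  subst hω
  have ht1 : 1 ≤ ω.length := hH.trans hHt
  have ht0 : (0 : ℝ) < ω.length := by exact_mod_cast ht1
  have hB1 : (1 : ℝ) ≤ B := by exact_mod_cast NeZero.pos B
  have hH0 : (0 : ℝ) < H := by exact_mod_cast hH
  set q := ftrlRate H ι ω.length with hqdef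
  have hq0 : 0 < q := ftrlRate_pos hH hι ht1
  have hq2 : q ^ 2 = H * ι / ω.length := Real.sq_sqrt (by positivity)
  have hα : lr H ω.length = lrProd H ω.length * ftrlWeight H ω.length := by
    rw [← lrW_eq_ftrlWeight ht1 le_rfl, lrW_self]
  have hα0 : 0 < lr H ω.length := lr_pos H _ hH
  have hαι : lr H ω.length * ι ≤ 2 * q ^ 2 := by
    rw [hq2]
    refine (mul_le_mul_of_nonneg_right (lr_le hH ht1) hι.le).trans (le_of_eq (by ring))
  have hP := lrProd_pos H ω.length
  have hW := ftrlWeight_pos H ω.length hH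
  let θ : ℕ → Fin B → ℝ := fun n b =>
    ((ftrlAlg H ι B).strategy (feedbacks (ω.take n)) b).toReal
  have hθ0 : ∀ n b, 0 ≤ θ n b := fun n b => ENNReal.toReal_nonneg
  have hlen : ∀ i : Fin ω.length, (ω.take i).length = i := fun i => by
    rw [List.length_take, min_eq_left i.2.le]
  have hw : ∀ i : Fin ω.length, lrW H ω.length (i + 1)
      = lrProd H ω.length * ftrlWeight H (i + 1) := fun i =>
    lrW_eq_ftrlWeight (by omega) i.2
  let α : Fin ω.length → ℝ := fun i => lrW H ω.length (i + 1)
  let x : Fin ω.length → ℝ := fun i => ω[i].2.2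
  let μ : Fin ω.length → ℝ := fun i =>
    rexp ((ftrlAlg H ι B).strategy (feedbacks (ω.take i))) (meanLoss κ ω[i].1)
  let X : Fin ω.length → ℝ := fun i => 1 / (θ i ω[i].2.1 + ftrlRate H ι (i + 1))
  let est : Fin B → Fin B → Fin ω.length → ℝ := fun b b' i => θ i b *
    ((if ω[i].2.1 = b' then x i else 0) / (θ i b' + ftrlRate H ι (i + 1)))
  have hX0 : ∀ i, 0 ≤ X i := fun i => by
    have := hθ0 i ω[i].2.1
    have := ftrlRate_pos hH hι (n := i + 1) (by omega)
    positivity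
  have hx : ∀ i, x i ∈ Set.Icc (0 : ℝ) 1 := fun i => ω[i].2.2.2
  -- the three deviations
  have d1 : ∑ i, α i * (μ i - x i) ≤ 6 * q := by
    have e : prefixSum (feedbackDev H ι κ ω.length) ω
        = ι / q * ∑ i, α i * (μ i - x i) - (ι / q) ^ 2 * ∑ i, α i ^ 2 := by
      rw [Finset.mul_sum, Finset.mul_sum, ← Finset.sum_sub_distrib]
      unfold prefixSum feedbackDev
      refine Finset.sum_congr rfl fun i _ => ?_
      simp only [hlen, α, μ, x, List.get_eq_getElem, Fin.getElem_fin]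
      ring
    have hs : ∑ i, α i ^ 2 ≤ 2 * H / ω.length := by
      have := sum_lrW_sq_le hH ht1
      rwa [← Fin.sum_univ_eq_sum_range (fun i => lrW H ω.length (i + 1) ^ 2)] at this
    have hs' := mul_le_mul_of_nonneg_left hs (sq_nonneg (ι / q))
    have e2 : (ι / q) ^ 2 * (2 * H / ω.length) = 2 * ι := by
      rw [div_pow, hq2]; field_simp
    rw [e] at h1
    have h4 : ι / q * ∑ i, α i * (μ i - x i) ≤ ι / q * (6 * q) := by
      have : ι / q * (6 * q) = 6 * ι := by field_simp
      linarith
    exact le_of_mul_le_mul_left h4 (div_pos hι hq0)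
  have d2 : ∀ b b', ∑ i, α i * est b b' i
      ≤ ∑ i, α i * (θ i b * meanLoss κ ω[i].1 b') + 8 * q := by
    intro b b'
    have e : lrProd H ω.length * prefixSum (estimateDev H ι κ ω.length b b') ω
        = q / ftrlWeight H ω.length
          * (∑ i, α i * est b b' i - ∑ i, α i * (θ i b * meanLoss κ ω[i].1 b')) := by
      rw [← Finset.sum_sub_distrib, Finset.mul_sum]
      unfold prefixSum estimateDev
      rw [Finset.mul_sum]
      refine Finset.sum_congr rfl fun i _ => ?_
      simp only [hlen, α, hw, est, θ, x, List.get_eq_getElem, Fin.getElem_fin]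
      ring
    have h4 := mul_le_mul_of_nonneg_left (h2 b b') hP.le
    rw [e] at h4
    have h5 : lrProd H ω.length * (4 * ι) ≤ q / ftrlWeight H ω.length * (8 * q) := by
      rw [div_mul_eq_mul_div, le_div_iff₀ hW]
      have : lrProd H ω.length * (4 * ι) * ftrlWeight H ω.length = 4 * (lr H ω.length * ι) := by
        rw [hα]; ring
      rw [this]
      linarith
    have := le_of_mul_le_mul_left (h4.trans h5) (div_pos hq0 hW)
    linarith
  have d3 : ∑ i : Fin ω.length, ftrlCoef H ι ω.length i * X i ≤ 28 * (B * q) + 40 * q := by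
    have e : 5 * lr H ω.length * prefixSum (reciprocalDev H ι ω.length) ω
        = ∑ i : Fin ω.length, ftrlCoef H ι ω.length i * X i
          - 2 * B * ∑ i : Fin ω.length, ftrlCoef H ι ω.length i := by
      rw [Finset.mul_sum, ← Finset.sum_sub_distrib]
      unfold prefixSum reciprocalDev
      rw [Finset.mul_sum]
      refine Finset.sum_congr rfl fun i _ => ?_
      simp only [hlen, X, θ, List.get_eq_getElem, Fin.getElem_fin]
      field_simp
    have hs : ∑ i : Fin ω.length, ftrlCoef H ι ω.length i ≤ 14 * q := by
      rw [Fin.sum_univ_eq_sum_range (ftrlCoef H ι ω.length)]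
      exact sum_ftrlCoef_le hH hι hHt
    have h4 := mul_le_mul_of_nonneg_left h3 (by positivity : 0 ≤ 5 * lr H ω.length)
    rw [e] at h4
    have h5 := mul_le_mul_of_nonneg_left hs (by positivity : (0 : ℝ) ≤ 2 * B)
    have h6 : q ^ 2 ≤ q := by rw [sq]; exact mul_le_of_le_one_left hq0.le hq
    linarith
  -- the pathwise bound
  have d4 : ∑ i, α i * x i ≤ ∑ b, ∑ i, α i * est b (ψ b) i + 2 * (B * q)
      + ∑ i : Fin ω.length, ftrlCoef H ι ω.length i * X i := by
    have hfl : (feedbacks ω).length = ω.length := by simp [feedbacks]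
    have key := ftrlSwap_regret_le (B := B) (ftrlWeight H) (ftrlRate H ι) (ftrlRate H ι)
      (fun n _ => (ftrlWeight_pos H n hH).le) (fun n hn => ftrlRate_pos hH hι hn) (ftrlStep H ι)
      (fun n hn => by simp [ftrlStep, max_eq_left hn]) (ftrlStep_pos hH hι)
      (ftrlStep_succ_le hH hι) (feedbacks ω)
      (by
        intro p hp
        obtain ⟨y, _, rfl⟩ := List.mem_map.mp hp
        exact y.2.2.2) ψ θ
      (fun n b => by simp only [θ, feedbacks, List.map_take])
    have e1 := sum_fin_map ω (fun y : Round Z B => (y.2.1, (y.2.2 : ℝ))) fun i p =>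
      ftrlWeight H (i + 1) * (θ i p.1 * p.2 / (θ i p.1 + ftrlRate H ι (i + 1)))
    have e2 := fun b => sum_fin_map ω (fun y : Round Z B => (y.2.1, (y.2.2 : ℝ))) fun i p =>
      ftrlWeight H (i + 1) * (θ i b * ((if p.1 = ψ b then p.2 else 0)
        / (θ i (ψ b) + ftrlRate H ι (i + 1))))
    have e3 := sum_fin_map ω (fun y : Round Z B => (y.2.1, (y.2.2 : ℝ))) fun i p =>
      ftrlStep H ι i / 2 * (ftrlWeight H (i + 1) ^ 2 / (θ i p.1 + ftrlRate H ι (i + 1)))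
    have key' := (e1.symm.le.trans key).trans (add_le_add (add_le_add
      (Finset.sum_le_sum fun b _ => (e2 b).le) le_rfl) e3.le)
    rw [hfl] at key'
    have key2 := mul_le_mul_of_nonneg_left key' hP.le
    rw [mul_add, mul_add, Finset.mul_sum, Finset.mul_sum, Finset.mul_sum] at key2
    -- The exploration bias: $\theta x/(\theta+\gamma)=x-\gamma x/(\theta+\gamma)$. It is charged to
    -- the first summand of `ftrlCoef`, and the second order term of the leaders to the other
    -- summand.
    have f1 : ∑ i, α i * x i - ∑ i : Fin ω.length, lrProd H ω.length *
        (ftrlWeight H (i + 1) * ftrlRate H ι (i + 1)) * X i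
        ≤ ∑ i : Fin ω.length, lrProd H ω.length * (ftrlWeight H (i + 1) *
          (θ i ω[i].2.1 * x i / (θ i ω[i].2.1 + ftrlRate H ι (i + 1)))) := by
      rw [← Finset.sum_sub_distrib]
      refine Finset.sum_le_sum fun i _ => ?_
      have g1 := ftrlRate_pos hH hι (n := i + 1) (by omega)
      have g2 : 0 < θ i ω[i].2.1 + ftrlRate H ι (i + 1) := by linarith [hθ0 i ω[i].2.1]
      have g3 : θ i ω[i].2.1 * x i / (θ i ω[i].2.1 + ftrlRate H ι (i + 1))
          = x i - ftrlRate H ι (i + 1) * x i * X i := by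
        simp only [X]; field_simp; ring
      have g4 : ftrlRate H ι (i + 1) * x i * X i ≤ ftrlRate H ι (i + 1) * X i :=
        mul_le_mul_of_nonneg_right (mul_le_of_le_one_right g1.le (hx i).2) (hX0 i)
      have g5 := mul_le_mul_of_nonneg_left g4
        (mul_nonneg hP.le (ftrlWeight_pos H (i + 1) hH).le)
      rw [g3]
      simp only [α, hw]
      linarith
    have f2 : ∑ b, lrProd H ω.length * ∑ i : Fin ω.length, ftrlWeight H (i + 1) * (θ i b *
        ((if ω[i].2.1 = ψ b then x i else 0) / (θ i (ψ b) + ftrlRate H ι (i + 1))))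
        = ∑ b, ∑ i, α i * est b (ψ b) i := by
      refine Finset.sum_congr rfl fun b _ => ?_
      rw [Finset.mul_sum]
      refine Finset.sum_congr rfl fun i _ => ?_
      simp only [α, hw, est]
      ring
    have f3 : lrProd H ω.length * (B * (Real.log B / ftrlStep H ι ω.length)) ≤ 2 * (B * q) := by
      have g1 : lrProd H ω.length * (B * (Real.log B / ftrlStep H ι ω.length))
          = B * (lr H ω.length * Real.log B) / q := by
        rw [ftrlStep, max_eq_left ht1, hα, ← hqdef]
        field_simp
      have g2 := mul_le_mul_of_nonneg_left hB hα0.le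
      have g3 := mul_le_mul_of_nonneg_left (g2.trans hαι) (by linarith : (0 : ℝ) ≤ B)
      rw [g1, div_le_iff₀ hq0]
      linarith
    have f4 : ∑ i : Fin ω.length, lrProd H ω.length * (ftrlStep H ι i / 2 *
        (ftrlWeight H (i + 1) ^ 2 / (θ i ω[i].2.1 + ftrlRate H ι (i + 1))))
        ≤ ∑ i : Fin ω.length, ftrlCoef H ι ω.length i * X i - ∑ i : Fin ω.length,
          lrProd H ω.length * (ftrlWeight H (i + 1) * ftrlRate H ι (i + 1)) * X i := by
      rw [← Finset.sum_sub_distrib]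
      refine Finset.sum_le_sum fun i _ => ?_
      have g1 := mul_le_mul_of_nonneg_right (mul_le_mul_of_nonneg_left
        (ftrlStep_mul_sq_le hH hι i) hP.le) (hX0 i)
      have g2 : lrProd H ω.length * (ftrlStep H ι i / 2 *
          (ftrlWeight H (i + 1) ^ 2 / (θ i ω[i].2.1 + ftrlRate H ι (i + 1))))
          = lrProd H ω.length * (ftrlStep H ι i * ftrlWeight H (i + 1) ^ 2) * X i / 2 := by
        simp only [X]; ring
      rw [g2]
      unfold ftrlCoef
      linarith
    rw [← f2]
    simp only [x] at f1 f2 ⊢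
    linarith
  have hreg : runRegret (ftrlAlg H ι B) κ H ψ ω = ∑ i, α i * (μ i - x i) + ∑ i, α i * x i
      - ∑ b, ∑ i, α i * (θ i b * meanLoss κ ω[i].1 (ψ b)) := by
    unfold runRegret
    rw [wavg_splits, Finset.sum_comm, ← Finset.sum_add_distrib, ← Finset.sum_sub_distrib]
    refine Finset.sum_congr rfl fun i _ => ?_
    rw [← Finset.mul_sum]
    have : ∑ b, θ i b * meanLoss κ ω[i].1 (ψ b) = rexp ((ftrlAlg H ι B).strategy
      (feedbacks (ω.take i))) fun b => meanLoss κ ω[i].1 (ψ b) := rfl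
    rw [this]
    simp only [α, μ]
    ring
  have d5 := Finset.sum_le_sum fun b (_ : b ∈ Finset.univ) => d2 b (ψ b)
  rw [Finset.sum_add_distrib, Finset.sum_const, Finset.card_univ, Fintype.card_fin,
    nsmul_eq_mul] at d5
  have hBq : q ≤ B * q := le_mul_of_one_le_left hq0.le hB1
  rw [hreg]
  linarith

end regret

/-! ### Failure probability of the regret bound of FTRL_swap. -/

section probability
variable {Z : Type} {B : ℕ} [NeZero B] {H : ℕ} {ι : ℝ}

/-- There are $B^2+2$ deviation events of probability $e^{-4\iota}$, and $B^2+2\le e^{3\iota}$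
because $e^\iota$ is at least 2 and at least $B$. -/
theorem sum_exp_neg_le (hι : Real.log 2 ≤ ι) (hB : Real.log B ≤ ι) :
    (2 + (B : ℝ) ^ 2) * Real.exp (-(4 * ι)) ≤ Real.exp (-ι) := by
  have hB0 : (0 : ℝ) < B := by exact_mod_cast NeZero.pos B
  have h1 : (2 : ℝ) ≤ Real.exp ι := (Real.log_le_iff_le_exp (by norm_num)).mp hι
  have h2 : (B : ℝ) ≤ Real.exp ι := (Real.log_le_iff_le_exp hB0).mp hB
  have h3 : Real.exp (-ι) = Real.exp ι ^ 3 * Real.exp (-(4 * ι)) := by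
    rw [← Real.exp_nat_mul, ← Real.exp_add]; congr 1; push_cast; ring
  rw [h3]
  refine mul_le_mul_of_nonneg_right ?_ (Real.exp_pos _).le
  nlinarith [mul_le_mul h2 h2 hB0.le (by linarith : 0 ≤ Real.exp ι), sq_nonneg (Real.exp ι)]

theorem envRun_ftrl_le (hH : 1 ≤ H) (hι : Real.log 2 ≤ ι) (hB : Real.log B ≤ ι) {t : ℕ}
    (ht : 1 ≤ t) (κ : Z → Fin B → PMF (unitInterval × Z)) (z : Z) :
    (envRun (ftrlAlg H ι B) κ t [] z).toOuterMeasure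
      {ω | ∃ ψ, 84 * (B * ftrlRate H ι t) < runRegret (ftrlAlg H ι B) κ H ψ ω}
      ≤ ENNReal.ofReal (Real.exp (-ι)) := by
  have hι2 : 1 / 2 < ι := by linarith [Real.log_two_gt_d9]
  have hι0 : 0 < ι := by linarith
  have hlen : ∀ ω ∈ (envRun (ftrlAlg H ι B) κ t [] z).support, ω.length = t := fun ω hω => by
    simpa using (prefix_of_mem_support_envRun hω).2
  have hq0 := ftrlRate_pos hH hι0 ht
  have hB1 : (1 : ℝ) ≤ B := by exact_mod_cast NeZero.pos B
  -- Regret never exceeds 1. Otherwise $H\iota/t\le84^{-2}$ and $\iota>1/2$ force $H\le t$, which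
  -- the estimates for the weights presuppose.
  rcases le_or_gt 1 (84 * (B * ftrlRate H ι t)) with h | h
  · refine (PMF.toOuterMeasure_mono _ (t := ∅) ?_).trans (by simp)
    rintro ω ⟨⟨ψ, hψ⟩, hω⟩
    have hne : ω ≠ [] := fun h0 => by have := hlen ω hω; simp [h0] at this; omega
    have := runRegret_le_one (ftrlAlg H ι B) κ H ψ hne
    linarith
  have hq : ftrlRate H ι t ≤ 1 / 84 := by
    have := le_mul_of_one_le_left hq0.le hB1
    linarith
  have hHt : H ≤ t := by
    have ht0 : (0 : ℝ) < t := by exact_mod_cast ht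
    have h1 : ftrlRate H ι t ^ 2 ≤ (1 / 84) ^ 2 := pow_le_pow_left₀ hq0.le hq 2
    have h2 : ftrlRate H ι t ^ 2 = H * ι / t := Real.sq_sqrt (by positivity)
    rw [h2, div_le_iff₀ ht0] at h1
    have h3 := mul_le_mul_of_nonneg_left hι2.le (Nat.cast_nonneg (α := ℝ) H)
    have : (H : ℝ) ≤ t := by linarith
    exact_mod_cast this
  have e1 := envRun_prefixSum_le (κ := κ) t z (feedbackDev H ι κ t)
    (fun l z _ => pexp_exp_feedback_le_one _ z _) (4 * ι)
  have e2 : ∀ x : Fin B × Fin B, (envRun (ftrlAlg H ι B) κ t [] z).toOuterMeasure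
      {ω | 4 * ι ≤ prefixSum (estimateDev H ι κ t x.1 x.2) ω}
      ≤ ENNReal.ofReal (Real.exp (-(4 * ι))) := fun x =>
    envRun_prefixSum_le (κ := κ) t z (estimateDev H ι κ t x.1 x.2) (fun l z hl => by
      have hW := ftrlWeight_pos H t hH
      have h1 := ftrlWeight_mono hH (by omega : 1 ≤ l.length + 1) hl
      have h2 := toReal_mem_Icc ((ftrlAlg H ι B).strategy (feedbacks l)) x.1
      have h3 := (ftrlWeight_pos H (l.length + 1) hH).le
      have h0 : 0 ≤ ftrlRate H ι t / ftrlWeight H t * ftrlWeight H (l.length + 1) := by positivity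
      -- The coefficient stays below $\gamma_{n+1}$, where $n$ is the length of `l`, because
      -- $w_{n+1}\le w_t$, $\theta\le1$ and $\gamma_t\le\gamma_{n+1}$.
      refine pexp_exp_implicit_le_one _ z x.2 (mul_nonneg h0 h2.1) ?_
      refine (mul_le_of_le_one_right h0 h2.2).trans (le_trans ?_
        (ftrlRate_anti hι0.le (by omega) hl))
      rw [div_mul_eq_mul_div, div_le_iff₀ hW]
      exact mul_le_mul_of_nonneg_left h1 hq0.le) (4 * ι)
  have e3 := envRun_prefixSum_le (κ := κ) t z (reciprocalDev H ι t) (fun l z hl => by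
      have hα := lr_pos H t hH
      refine pexp_exp_inv_le_one _ z (div_nonneg (ftrlCoef_nonneg hH hι0 t _) (by positivity)) ?_
        (ftrlRate_pos hH hι0 (by omega))
      rw [div_le_iff₀ (by positivity), mul_comm]
      exact ftrlCoef_le hH hι0 hHt hl) (4 * ι)
  have hsub : {ω | ∃ ψ, 84 * (B * ftrlRate H ι t) < runRegret (ftrlAlg H ι B) κ H ψ ω}
      ∩ (envRun (ftrlAlg H ι B) κ t [] z).support
      ⊆ ({ω | 4 * ι ≤ prefixSum (feedbackDev H ι κ t) ω}
        ∪ ⋃ x : Fin B × Fin B, {ω | 4 * ι ≤ prefixSum (estimateDev H ι κ t x.1 x.2) ω})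
        ∪ {ω | 4 * ι ≤ prefixSum (reciprocalDev H ι t) ω} := by
    rintro ω ⟨⟨ψ, hψ⟩, hω⟩
    by_contra hU
    simp only [Set.mem_union, Set.mem_iUnion, Set.mem_ofPred_eq, not_or, not_exists, not_le] at hU
    obtain ⟨⟨u1, u2⟩, u3⟩ := hU
    have := runRegret_ftrl_le hH hι0 hB hHt (by linarith) (hlen ω hω) u1.le
      (fun b b' => (u2 (b, b')).le) u3.le ψ
    linarith
  refine (PMF.toOuterMeasure_mono _ hsub).trans ((measure_union_le _ _).trans
    ((add_le_add ((measure_union_le _ _).trans (add_le_add e1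
      ((measure_iUnion_fintype_le _ _).trans (Finset.sum_le_sum fun x _ => e2 x)))) e3).trans ?_))
  rw [Finset.sum_const, Finset.card_univ, ← ENNReal.ofReal_nsmul, ← ENNReal.ofReal_add
    (by positivity) (by positivity), ← ENNReal.ofReal_add (by positivity) (by positivity)]
  refine ENNReal.ofReal_le_ofReal (le_trans (le_of_eq ?_) (sum_exp_neg_le hι hB))
  simp only [Fintype.card_prod, Fintype.card_fin, nsmul_eq_mul]
  push_cast
  ring

end probability

/-! ## The guarantee for FTRL_swap -/

theorem sum_sqrt_div_le {a : ℝ} (ha : 0 ≤ a) (t : ℕ) :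
    ∑ n ∈ Finset.Icc 1 t, Real.sqrt (a / n) ≤ 2 * (Real.sqrt a * Real.sqrt t) := by
  induction t with
  | zero => simp
  | succ t ih =>
    rw [Finset.sum_Icc_succ_top (by omega), Real.sqrt_div ha, div_eq_mul_one_div]
    have := mul_le_mul_of_nonneg_left (inv_sqrt_succ_le t) (Real.sqrt_nonneg a)
    linarith

section guarantee
variable {m H S : ℕ} {A : Fin m → ℕ} [∀ j, NeZero (A j)]

theorem ceProb_mono {K : ℕ} [NeZero K] (G : MarkovGame m H S A)
    (alg : ∀ (B : ℕ) [NeZero B], BanditAlg B) (β : Fin m → ℕ → ℝ) {x y : ℝ} (h : x ≤ y) :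
    ceProb K G alg β x ≤ ceProb K G alg β y :=
  measure_mono fun _ hT j φ => (hT j φ).trans h

theorem ftrlSwap_ceProb_ge [NeZero m] [NeZero H] {K : ℕ} [NeZero K] (G : MarkovGame m H S A)
    {δ : ℝ} (hδ0 : 0 < δ) (hδ1 : δ < 1) :
    ENNReal.ofReal (1 - δ) ≤ ceProb K G (ftrlSwap (ftrlWeight H)
        (fun t => Real.sqrt (H * iota H S K A δ / t)) (fun t => Real.sqrt (H * iota H S K A δ / t)))
      (fun j t => 94 * A j * Real.sqrt ((H : ℝ) ^ 3 * iota H S K A δ / t))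
      (15210 * (maxA A * Real.sqrt ((H : ℝ) ^ 5 * S * iota H S K A δ / K))) := by
  have hS : 0 < S := G.s₁.pos
  have hlog := log_maxA_le_iota (m := m) (H := H) (S := S) (A := A) (K := K) hS hδ0 hδ1
  set ι := iota H S K A δ
  rcases Nat.lt_or_ge (maxA A) 2 with hA | hA
  · exact ceProb_ge_of_maxA_le_one G _ _ (by omega) (by positivity) hδ0.le
  have hA2 : (2 : ℝ) ≤ maxA A := by exact_mod_cast hA
  have hA1 : (1 : ℝ) ≤ maxA A := by linarith
  have hH1 : 1 ≤ H := NeZero.pos H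
  have hH0 : (0 : ℝ) < H := by exact_mod_cast hH1
  have hS0 : (0 : ℝ) < S := by exact_mod_cast hS
  have hK0 : (0 : ℝ) < K := by exact_mod_cast NeZero.pos K
  have hι2 : Real.log 2 ≤ ι := (Real.log_le_log (by norm_num) hA2).trans hlog
  have hι0 : 0 < ι := by linarith [Real.log_two_gt_d9]
  have hAj : ∀ j, (1 : ℝ) ≤ A j := fun j => by exact_mod_cast NeZero.pos (A j)
  have hAj' : ∀ j, (A j : ℝ) ≤ maxA A := fun j => by exact_mod_cast le_maxA (A := A) j
  have hHr : ∀ t : ℕ, H * ftrlRate H ι t = Real.sqrt ((H : ℝ) ^ 3 * ι / t) := fun t => by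
    unfold ftrlRate
    rw [show (H : ℝ) ^ 3 * ι / t = (H : ℝ) ^ 2 * (H * ι / t) by ring,
      Real.sqrt_mul (by positivity), Real.sqrt_sq hH0.le]
  have hβ : ∀ (j : Fin m) (t : ℕ), ∑ i ∈ Finset.Icc 1 t,
      lrW H t i * (94 * A j * Real.sqrt ((H : ℝ) ^ 3 * ι / i))
      = 94 * A j * (Real.sqrt ((H : ℝ) ^ 3 * ι)
        * ∑ i ∈ Finset.Icc 1 t, lrW H t i / Real.sqrt i) := fun j t => by
    rw [Finset.mul_sum, Finset.mul_sum]
    refine Finset.sum_congr rfl fun i _ => ?_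
    rw [Real.sqrt_div (by positivity)]
    ring
  -- Constants: $94=84+10$ covers regret and deviation; the weighted bonuses are at most
  -- $2\cdot94\le3\cdot84$ times $A_j\sqrt{H^3\iota/t}$, hence $c=3$; summing $84/\sqrt n$ gives
  -- 168; and $15210=(9\cdot3+63)(168+1)$.
  refine le_trans (ceProb_ge_of_regret G (fun B [NeZero B] => ftrlAlg H ι B) _ hA hδ0 hδ1
    (ξ := fun j t => 84 * (A j * ftrlRate H ι t)) (X := fun t => 84 * (maxA A * ftrlRate H ι t))
    (Y := fun t => 168 * (maxA A * Real.sqrt (H * ι)) * Real.sqrt t) (c := 3) (by norm_num)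
    ?_ ?_ ?_ ?_ ?_ ?_ ?_) (ceProb_mono G _ _ ?_)
  · intro j t _; unfold ftrlRate; positivity
  · intro t _; unfold ftrlRate; positivity
  · intro t
    rw [← Finset.mul_sum, ← Finset.mul_sum]
    have := mul_le_mul_of_nonneg_left (sum_sqrt_div_le (by positivity : 0 ≤ H * ι) t)
      (by positivity : (0 : ℝ) ≤ 84 * maxA A)
    unfold ftrlRate
    linarith
  · exact Real.strictConcaveOn_sqrt.concaveOn.smul (by positivity)
  · intro j t ht _ Z κ z
    refine envRun_ftrl_le hH1 hι2 ((Real.log_le_log ?_ (hAj' j)).trans hlog) ht κ z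
    linarith [hAj j]
  · intro j t ht _
    rw [hβ]
    have h1 := mul_le_mul_of_nonneg_left (le_sum_lrW_div_sqrt H t ht)
      (Real.sqrt_nonneg ((H : ℝ) ^ 3 * ι))
    rw [mul_one_div, ← Real.sqrt_div (by positivity)] at h1
    have h2 := mul_le_mul_of_nonneg_left h1 (by linarith [hAj j] : (0 : ℝ) ≤ 94 * A j)
    have h3 := mul_le_mul_of_nonneg_right (hAj j) (Real.sqrt_nonneg ((H : ℝ) ^ 3 * ι / t))
    have h4 : H * (84 * (A j * ftrlRate H ι t)) = 84 * (A j * (H * ftrlRate H ι t)) := by ring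
    rw [h4, hHr]
    linarith
  · intro j t ht _
    rw [hβ]
    have h1 := mul_le_mul_of_nonneg_left (sum_lrW_div_sqrt_le H t ht)
      (Real.sqrt_nonneg ((H : ℝ) ^ 3 * ι))
    have e : Real.sqrt ((H : ℝ) ^ 3 * ι) * (2 / Real.sqrt t)
        = 2 * Real.sqrt ((H : ℝ) ^ 3 * ι / t) := by
      rw [Real.sqrt_div (by positivity)]; ring
    rw [e] at h1
    have h2 := mul_le_mul_of_nonneg_left h1 (by linarith [hAj j] : (0 : ℝ) ≤ 94 * A j)
    have h3 := mul_le_mul_of_nonneg_right (hAj' j) (Real.sqrt_nonneg ((H : ℝ) ^ 3 * ι / t))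
    have h4 : H * (84 * (maxA A * ftrlRate H ι t)) = 84 * (maxA A * (H * ftrlRate H ι t)) := by ring
    have h5 := mul_nonneg (by linarith : (0 : ℝ) ≤ maxA A)
      (Real.sqrt_nonneg ((H : ℝ) ^ 3 * ι / t))
    have h6 := Real.sqrt_nonneg ((H : ℝ) ^ 3 * ι / t)
    rw [h4, hHr]
    linarith
  · have e1 : (S : ℝ) * (H : ℝ) ^ 5 * ι / K = (H : ℝ) ^ 5 * S * ι / K := by ring
    have e2 : (H : ℝ) ^ 2 * S / K * (168 * (maxA A * Real.sqrt (H * ι)) * Real.sqrt (K / S))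
        = 168 * (maxA A * Real.sqrt ((H : ℝ) ^ 5 * S * ι / K)) := by
      have h1 : (H : ℝ) ^ 5 * S * ι / K = ((H : ℝ) ^ 2 * S / K) ^ 2 * (H * ι * (K / S)) := by
        field_simp
      rw [h1, Real.sqrt_mul (sq_nonneg _), Real.sqrt_sq (by positivity),
        Real.sqrt_mul (by positivity : 0 ≤ H * ι)]
      ring
    rw [e1, e2]
    have h1 := mul_le_mul_of_nonneg_right hA1 (Real.sqrt_nonneg ((H : ℝ) ^ 5 * S * ι / K))
    linarith

end guarantee

end VLearning

end

theorem theorem4 :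
    (∃ c₀ : ℝ, 0 < c₀ ∧ ∀ c₁ : ℝ, c₀ ≤ c₁ → ∃ C : ℝ, 0 < C ∧
      ∀ (m H S K : ℕ) (A : Fin m → ℕ) [∀ j, NeZero (A j)] [NeZero m] [NeZero H] [NeZero K]
        (G : VLearning.MarkovGame m H S A) (δ : ℝ), 0 < δ → δ < 1 →
        ∀ (alg : ∀ (B : ℕ) [NeZero B], VLearning.BanditAlg B)
          (ξ : ℕ → ℕ → ℝ → ℝ) (Ξ : ℕ → ℝ → ℝ → ℝ),
          VLearning.MeetsSwapRegret H alg ξ Ξ →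
        ∀ β : Fin m → ℕ → ℝ,
          (∀ (j : Fin m) (t : ℕ), 1 ≤ t → t ≤ K →
            c₀ * (H * ξ (A j) t (VLearning.iota H S K A δ)
                + Real.sqrt ((H : ℝ) ^ 3 * VLearning.iota H S K A δ / t))
              ≤ ∑ i ∈ Finset.Icc 1 t, VLearning.lrW H t i * β j i ∧
            ∑ i ∈ Finset.Icc 1 t, VLearning.lrW H t i * β j i
              ≤ c₁ * (H * ξ (A j) t (VLearning.iota H S K A δ)
                + Real.sqrt ((H : ℝ) ^ 3 * VLearning.iota H S K A δ / t))) →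
          ENNReal.ofReal (1 - δ) ≤ VLearning.ceProb K G alg β
            (C * ((H : ℝ) ^ 2 * S / K
                * Ξ (VLearning.maxA A) ((K : ℝ) / S) (VLearning.iota H S K A δ)
              + Real.sqrt (S * (H : ℝ) ^ 5 * VLearning.iota H S K A δ / K)))) ∧
    (∃ c C : ℝ, 0 < c ∧ 0 < C ∧
      ∀ (m H S K : ℕ) (A : Fin m → ℕ) [∀ j, NeZero (A j)] [NeZero m] [NeZero H] [NeZero K]
        (G : VLearning.MarkovGame m H S A) (δ : ℝ), 0 < δ → δ < 1 →
          ENNReal.ofReal (1 - δ) ≤ VLearning.ceProb K G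
            (VLearning.ftrlSwap (VLearning.ftrlWeight H)
              (fun t => Real.sqrt (H * VLearning.iota H S K A δ / t))
              (fun t => Real.sqrt (H * VLearning.iota H S K A δ / t)))
            (fun j t => c * A j * Real.sqrt ((H : ℝ) ^ 3 * VLearning.iota H S K A δ / t))
            (C * (VLearning.maxA A
              * Real.sqrt ((H : ℝ) ^ 5 * S * VLearning.iota H S K A δ / K)))) := by
  -- $c_0=10$ is the constant of the deviation bound $\varepsilon_t$.
  refine ⟨⟨10, by norm_num, fun c₁ hc₁ => ⟨9 * c₁ + 63, by linarith, ?_⟩⟩,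
    94, 15210, by norm_num, by norm_num, ?_⟩
  · intro m H S K A _ _ _ _ G δ hδ0 hδ1 alg ξ Ξ h β hβ
    exact h.ceProb_ge G hδ0 hδ1 (by linarith) hβ
  · intro m H S K A _ _ _ _ G δ hδ0 hδ1
    exact VLearning.ftrlSwap_ceProb_ge G hδ0 hδ1
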